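/- **Model.** Let $a\ge 1$ and let $\bar h:\mathbb Z\to\mathbb Z$ satisfy $\bar h_{i+a}=\bar h_i$ for all $i$. The polygonal line of a height function $h:\mathbb Z\to\mathbb Z$ consists of the horizontal unit bonds $[i,i+1]\times\{h_i\}$ and of the vertical unit bonds at each site $i$ between the heights $h_{i-1}$ and $h_i$. The wall $W$ is the infinite polygonal line of $\bar h$. In a box of length $N$ one keeps the horizontal bonds over $[i,i+1]$, $0\le i<N$, and the vertical bonds at the sites $1,\dots,N$; $W_a$ is the part of $W$ in the box of length $a$. We write $|\cdot|$ for the number of bonds, and put $r=1+\frac1a\sum_{i=1}^a|\bar h_i-\bar h_{i-1}|$. Let $J_{AB},J_{AW},J_{BW}$ be real numbers and, in the box of length $N$, $$H_N(\Gamma,W)=J_{AB}|\Gamma\setminus(\Gamma\cap W)|+J_{AW}|\Gamma\cap W|+J_{BW}|W\setminus(\Gamma\cap W)|.$$ The wall tensions are $$\tau_{AW}=\lim_{N\to\infty,\ a\mid N}-\frac1{\beta N}\log\sum_\Gamma e^{-\beta H_N(\Gamma,W)},\qquad \tau_{BW}=rJ_{BW},$$ where the sum runs over the heights $h_0,\dots,h_N$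 with $h_i\ge\bar h_i$ for all $i$, $h_0=\bar h_0$ and $h_N=\bar h_N$. **Wells.** A well of $W$ at level $z\in\mathbb Z$ is the part of $W$ between points $(p,z)$ and $(q,z)$ with $p<q$ such that $\bar h_{p-1}\ge z$, $\bar h_q\ge z$ and $\bar h_i<z$ for $p\le i<q$. Let $\rho$ be the maximum over the wells of the ratio of the length of the well to its width $q-p$, and $\rho=1$ if $W$ is flat (and so has no wells). **Clusters.** An excitation $\delta$ is a maximal connected component (as a subset of $\mathbb R^2$, the bonds being closed segments) of the set of bonds $(\Gamma\cup W)\setminus(\Gamma\cap W)$, where $\Gamma$ is the polygonal line of some $h\ge\bar h$ with $h_i=\bar h_i$ for all but finitely many $i$. Its energy is $$E(\delta)=J_{AB}|\delta\setminus(\delta\cap W)|-(J_{AW}-J_{BW})|\delta\cap W|.$$ Two excitations are compatible if they are disjoint as subsets of $\mathbb R^2$. For a family $(\delta_1,\dots,\delta_n)$ of excitations, repetitions allowed, $G(\delta_1,\dots,\delta_n)$ is the graph on $\{1,\dots,n\}$ with an edge between $i\ne j$ when $\delta_i,\delta_j$ are not compatible or coincide. A cluster $C$ is an ordered family $(\delta_1,\dots,\delta_n)$,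 $n\ge1$, for which this graph is connected, and $$\Phi^T(C)=\frac{1}{n!}\Big(\sum_{G}(-1)^{\ell(G)}\Big)\prod_{i=1}^n e^{-\beta E(\delta_i)},$$ where $G$ runs over the connected subgraphs of $G(\delta_1,\dots,\delta_n)$ that contain all its vertices and $\ell(G)$ is the number of edges of $G$. $C\ni b$ means that the bond $b$ belongs to some $\delta_i$, and $|C\cap W|$ is the number of bonds of $W$ that belong to $\delta_1\cup\dots\cup\delta_n$. **Theorem 4.1.** Assume that $J_{AB}+J_{AW}-J_{BW}\ge0$ and $$J_{AB}>\rho\,(J_{AW}-J_{BW}).$$ Then for every $\beta>\beta_0=1.9\,(1+\rho)\,[J_{AB}-\rho(J_{AW}-J_{BW})]^{-1}$ the partition functions (for $N$ a multiple of $a$) are finite, the limit $\tau_{AW}$ exists, for every bond $b\in W_a$ the series $\sum_{C\ni b}\Phi^T(C)/|C\cap W|$ converges absolutely, and $$\tau_{AW}=rJ_{AW}-\frac1{\beta a}\sum_{b\in W_a}\ \sum_{C\ni b}\frac{\Phi^T(C)}{|C\cap W|}.$$ In particular, Wenzel's law holds with corrections given by this series: $$\tau_{AW}-\tau_{BW}=r\,(J_{AW}-J_{BW})-\frac1{\beta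 a}\sum_{b\in W_a}\ \sum_{C\ni b}\frac{\Phi^T(C)}{|C\cap W|}.$$ -/

import Mathlib

noncomputable section

namespace RoughWall

open Filter Topology
open scoped Classical

/-- The bonds (closed unit segments) of the lattice `ℤ² ⊂ ℝ²`: `horiz i y` is the segment from
`(i, y)` to `(i + 1, y)` and `vert i y` is the segment from `(i, y)` to `(i, y + 1)`. -/
inductive Bond where
  | horiz (i y : ℤ) : Bond
  | vert (i y : ℤ) : Bond

/-- The two end points of a bond. -/
def Bond.ends : Bond → Set (ℤ × ℤ)
  | .horiz i y => {(i, y), (i + 1, y)}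
  | .vert i y => {(i, y), (i, y + 1)}

/-- Two bonds meet as closed subsets of the plane exactly when they share an end point
(this includes the case of equal bonds). -/
def Bond.Meets (b c : Bond) : Prop := (b.ends ∩ c.ends).Nonempty

/-- The graph on the bonds whose edges join distinct bonds that meet in the plane. A set of bonds
draws a connected subset of `ℝ²` exactly when it induces a connected subgraph. -/
def bondGraph : SimpleGraph Bond where
  Adj b c := b ≠ c ∧ b.Meets c
  symm := ⟨fun b c hbc => ⟨hbc.1.symm, by
    unfold Bond.Meets at *
    rw [Set.inter_comm]
    exact hbc.2⟩⟩
  loopless := ⟨fun _ hb => hb.1 rfl⟩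

/-- The part of the polygonal line of the height function `h` that belongs to the column `i`: the
horizontal bond at height `h i` over `[i, i + 1]`, and the vertical bonds at the site `i + 1`
between the heights `h i` and `h (i + 1)`. -/
def column (h : ℤ → ℤ) (i : ℤ) : Finset Bond :=
  insert (Bond.horiz i (h i))
    ((Finset.Ico (min (h i) (h (i + 1))) (max (h i) (h (i + 1)))).image (Bond.vert (i + 1)))

/-- The polygonal line of the heights `h 0, …, h N` in the box of length `N`; it has
`∑_{i=1}^N (1 + |h i - h (i - 1)|)` bonds. -/
def boxLine (N : ℕ) (h : ℤ → ℤ) : Finset Bond :=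
  (Finset.range N).biUnion fun i => column h (i : ℤ)

/-- The infinite polygonal line of the heights `h i`, `i ∈ ℤ`. -/
def line (h : ℤ → ℤ) : Set Bond := {b | ∃ i : ℤ, b ∈ column h i}

/-- The roughness `r` of a wall of period `a`. -/
def roughness (a : ℕ) (w : ℤ → ℤ) : ℝ :=
  1 + (∑ i ∈ Finset.Icc 1 a, |(w (i : ℤ) : ℝ) - (w ((i : ℤ) - 1) : ℝ)|) / (a : ℝ)

/-! ### The SOS model above the wall -/

/-- The configurations of the box of length `N` above the wall `w` with `h 0 = w 0` and
`h N = w N`; the heights are extended by those of the wall outside of the box. -/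
def BoxConfig (N : ℕ) (w : ℤ → ℤ) : Type :=
  {h : ℤ → ℤ // (∀ i, w i ≤ h i) ∧ ∀ i, i ≤ 0 ∨ (N : ℤ) ≤ i → h i = w i}

/-- The energy
`H_N(Γ, W) = J_AB |Γ \ (Γ ∩ W)| + J_AW |Γ ∩ W| + J_BW |W \ (Γ ∩ W)|`. -/
def hamiltonian (JAB JAW JBW : ℝ) (N : ℕ) (w h : ℤ → ℤ) : ℝ :=
  JAB * ((boxLine N h \ boxLine N w).card : ℝ)
    + JAW * ((boxLine N h ∩ boxLine N w).card : ℝ)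
    + JBW * ((boxLine N w \ boxLine N h).card : ℝ)

/-- The Boltzmann factor of a configuration. -/
def boltzmann (JAB JAW JBW β : ℝ) (N : ℕ) (w : ℤ → ℤ) (h : BoxConfig N w) : ℝ :=
  Real.exp (-β * hamiltonian JAB JAW JBW N w h.1)

/-- `τ` is the wall tension `τ_AW`: the partition functions of the boxes whose length is a multiple
`N = p a` of the period converge, and
`τ = lim_{N → ∞} -(1 / (β N)) log ∑_Γ exp (-β H_N(Γ, W))`. -/
def IsTauAW (JAB JAW JBW β : ℝ) (a : ℕ) (w : ℤ → ℤ) (τ : ℝ) : Prop :=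
  (∀ p : ℕ, Summable (boltzmann JAB JAW JBW β (p * a) w)) ∧
  Tendsto (fun p : ℕ => -(1 / (β * ((p * a : ℕ) : ℝ))) *
      Real.log (∑' h : BoxConfig (p * a) w, boltzmann JAB JAW JBW β (p * a) w h))
    atTop (𝓝 τ)

/-- The wall tension `τ_BW = r J_BW`. -/
def tauBW (JBW : ℝ) (a : ℕ) (w : ℤ → ℤ) : ℝ := roughness a w * JBW

/-! ### The wells of the wall -/

/-- The wall goes down through the level `z` at the site `p`, comes back through this level at the
site `q`, and lies below it in between: the part of the wall from `(p, z)` to `(q, z)` is a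
well. -/
def IsWell (w : ℤ → ℤ) (z p q : ℤ) : Prop :=
  p < q ∧ z ≤ w (p - 1) ∧ (∀ i, p ≤ i → i < q → w i < z) ∧ z ≤ w q

/-- The length of the part of the wall between `(p, z)` and `(q, z)`, for a well. -/
def wellLength (w : ℤ → ℤ) (z p q : ℤ) : ℤ :=
  (q - p) + (z - w p) + (∑ i ∈ Finset.Ioo p q, |w i - w (i - 1)|) + (z - w (q - 1))

/-- The ratios of the length of a well to its width. -/
def wellRatios (w : ℤ → ℤ) : Set ℝ :=
  {x | ∃ z p q : ℤ, IsWell w z p q ∧ x = (wellLength w z p q : ℝ) / ((q - p : ℤ) : ℝ)}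

/-- The largest ratio of the length of a well to its width. A flat wall has no wells, and the value
is then `1`, the supremum of `|δ ∩ W| / |δ \ (δ ∩ W)|` over the excitations of a flat wall. For a
periodic wall there are finitely many wells up to translations, so that the supremum is a
maximum. -/
def rho (w : ℤ → ℤ) : ℝ := if (wellRatios w).Nonempty then sSup (wellRatios w) else 1

/-! ### Excitations and clusters -/

/-- An excitation: a maximal connected component of the symmetric difference
`(Γ ∪ W) \ (Γ ∩ W)`, for a configuration `Γ` above the wall that differs from the wall at finitely
many sites only. -/
def IsExcitation (w : ℤ → ℤ) (δ : Finset Bond) : Prop :=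
  ∃ h : ℤ → ℤ, (∀ i, w i ≤ h i) ∧ {i | h i ≠ w i}.Finite ∧
    Maximal (fun s : Set Bond =>
      s ⊆ (line h ∪ line w) \ (line h ∩ line w) ∧ (bondGraph.induce s).Connected) (δ : Set Bond)

/-- The energy `E(δ) = J_AB |δ \ (δ ∩ W)| - (J_AW - J_BW) |δ ∩ W|`. -/
def energy (JAB JAW JBW : ℝ) (w : ℤ → ℤ) (δ : Finset Bond) : ℝ :=
  JAB * ((δ.filter fun b => b ∉ line w).card : ℝ)
    - (JAW - JBW) * ((δ.filter fun b => b ∈ line w).card : ℝ)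

/-- Two excitations are incompatible when they are not disjoint as subsets of the plane. -/
def Incompatible (δ δ' : Finset Bond) : Prop := ∃ b ∈ δ, ∃ c ∈ δ', b.Meets c

/-- The graph `G(δ₁, …, δₙ)` on the indices of a family, with an edge between two indices when the
corresponding members are incompatible or coincide. -/
def incompatGraph {n : ℕ} (δ : Fin n → Finset Bond) : SimpleGraph (Fin n) :=
  SimpleGraph.fromRel fun i j => Incompatible (δ i) (δ j) ∨ δ i = δ j

/-- The coefficient `a(δ₁, …, δₙ) = ∑_G (-1)^{ℓ(G)}`, where `G` runs over the connected subgraphs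
of `G(δ₁, …, δₙ)` that have all its vertices, given by their sets of edges, and `ℓ(G)` is the
number of edges. -/
def arithCoeff {n : ℕ} (δ : Fin n → Finset Bond) : ℤ :=
  ∑ S ∈ (incompatGraph δ).edgeFinset.powerset.filter
      (fun S : Finset (Sym2 (Fin n)) => (SimpleGraph.fromEdgeSet (S : Set (Sym2 (Fin n)))).Connected),
    (-1 : ℤ) ^ S.card

/-- The clusters: (ordered) families `δ₁, …, δₙ` of excitations, with repetitions allowed, whose
graph is connected; in particular `n ≥ 1`. -/
structure Cluster (w : ℤ → ℤ) where
  /-- the number of members -/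
  n : ℕ
  /-- the members -/
  δ : Fin n → Finset Bond
  isExcitation : ∀ i, IsExcitation w (δ i)
  connected : (incompatGraph δ).Connected

variable {w : ℤ → ℤ}

/-- The set of the bonds of the members of a cluster. -/
def Cluster.support (C : Cluster w) : Finset Bond := Finset.univ.biUnion C.δ

/-- `|C ∩ W|`, the number of the bonds of the wall that belong to the cluster. -/
def Cluster.wallCard (C : Cluster w) : ℕ := (C.support.filter fun b => b ∈ line w).card

/-- The truncated function `Φᵀ(δ₁, …, δₙ) = (a(δ₁, …, δₙ) / n!) ∏ᵢ exp (-β E(δᵢ))`. -/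
def Cluster.truncated (JAB JAW JBW β : ℝ) (C : Cluster w) : ℝ :=
  (arithCoeff C.δ : ℝ) / (Nat.factorial C.n : ℝ) *
    ∏ i, Real.exp (-β * energy JAB JAW JBW w (C.δ i))

/-- The clusters that contain the bond `b`. -/
def ClustersThrough (w : ℤ → ℤ) (b : Bond) : Type := {C : Cluster w // b ∈ C.support}

/-- The term `Φᵀ(C) / |C ∩ W|` of the expansion. -/
def clusterTerm (JAB JAW JBW β : ℝ) (w : ℤ → ℤ) (b : Bond) (C : ClustersThrough w b) : ℝ :=
  C.1.truncated JAB JAW JBW β / (C.1.wallCard : ℝ)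

/-- The series `∑_{b ∈ W_a} ∑_{C ∋ b} Φᵀ(C) / |C ∩ W|`, where `W_a` is one period of the wall. -/
def clusterSeries (JAB JAW JBW β : ℝ) (a : ℕ) (w : ℤ → ℤ) : ℝ :=
  ∑ b ∈ boxLine a w, ∑' C : ClustersThrough w b, clusterTerm JAB JAW JBW β w b C

end RoughWall

end

/-!
# The wall tension of the solid-on-solid model above a periodic wall

The energy of a configuration `Γ` above the wall `W` is that of the wall, `J_AW |W|`, plus the sum
of the energies `E(δ)` of the connected components `δ` of the symmetric difference of `Γ` and `W`.
Configurations correspond bijectively to finite families of pairwise compatible excitations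
(`IsComp.exists_lineDiff`, `exists_config`, `exists_components_eq`), so that the partition function
is a hard-core polymer gas whose logarithm is a cluster series.

*Energy.* The wall side of an excitation is at most `ρ` times as long as the other side
(`variation_sub_le`, `card_wall_le`). To see it, take the highest plateau of the configuration
above the wall: either it closes a well, and taking it down to the wall changes the lengths by those
of the well, which the definition of `ρ` controls; or it can be lowered by one unit without
increasing the length of the configuration. With `0 ≤ J_AB + J_AW - J_BW` this gives
`(1 + ρ) E(δ) ≥ (J_AB - ρ (J_AW - J_BW)) |δ|` (`energy_ge`), and the assumption on `β` becomes
`exp (-β E(δ)) ≤ exp (-1.9 |δ|) ≤ 6 ^ (-|δ|)` (`exp_energy_le`).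

*Entropy.* An excitation occupies an interval of columns, and it is determined by its columns and by
the increments of its thickness there. It has two horizontal bonds in each column and at least as
many vertical bonds at a site as the absolute value of the increment. So the sum of
`6 ^ (-|δ|) e ^ L(δ)` over the excitations in a given column, where `L(δ)` is the number of columns
of `δ`, is at most `1 / 3` (`sum_column_le`). An excitation that meets `δ` has a column among those
of `δ` and the two adjacent ones, at most `3 L(δ)` columns in all: the criterion of Kotecký and
Preiss holds with `L` as the size function (`kotecky_preiss`).

*Cluster expansion.* Summing over the connected component of one vertex gives the recursion
`connSum_insert` for the sums over connected graphs. For the series graded by the number of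
polymers it becomes a differential inequality, which bounds the absolute sum over the clusters that
contain a given polymer by the exponential of its size (`sum_rooted_le`), and the identity
`Z' = Z f'` between the generating functions of the hard-core and of the Ursell coefficients, whence
`Z = exp f` (`partition_eq_exp`). The bounds are uniform in the finite set of excitations, and
dominated convergence gives the partition function of a box, where the heights are unbounded
(`hasSum_boltzmann`).

*Limit.* Sharing each cluster equally between its bonds in the wall turns the cluster series of a
box into a sum over the bonds of the wall. By translation invariance, the bonds of the period `j` in
a box of `p` periods contribute the series of one period, up to the clusters that reach a distance
`j` or `p - j`. These errors are tails of a convergent series, and their Cesàro means vanish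
(`tendsto_boxSum_div`).
-/

noncomputable section

namespace RoughWall

open Filter Topology
open scoped Classical

set_option linter.unusedSectionVars false

/-! ### Sums over connected subgraphs -/

section Graph

variable {ι κ : Type*} [DecidableEq ι] [DecidableEq κ]

/-- The edges of `G` with both ends in `V`. -/
def edgesIn (G : SimpleGraph ι) (V : Finset ι) : Finset (Sym2 ι) :=
  V.sym2.filter (· ∈ G.edgeSet)

/-- The set `S` of edges connects the nonempty set `V` of vertices. -/
def Connects (S : Finset (Sym2 ι)) (V : Finset ι) : Prop :=
  V.Nonempty ∧ ∀ x ∈ V, ∀ y ∈ V, (SimpleGraph.fromEdgeSet (S : Set (Sym2 ι))).Reachable x y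

/-- `∑ (-1) ^ |S|` over the connected subgraphs of the graph induced by `G` on `V` that have all
the vertices of `V`. -/
def connSum (G : SimpleGraph ι) (V : Finset ι) : ℤ :=
  ∑ S ∈ (edgesIn G V).powerset.filter (fun S => Connects S V), (-1 : ℤ) ^ S.card

/-- The indicator of the event that `V` is an independent set of `G`. -/
def indep (G : SimpleGraph ι) (V : Finset ι) : ℤ :=
  if ∀ x ∈ V, ∀ y ∈ V, ¬ G.Adj x y then 1 else 0

lemma mem_edgesIn {G : SimpleGraph ι} {V : Finset ι} {x y : ι} :
    s(x, y) ∈ edgesIn G V ↔ x ∈ V ∧ y ∈ V ∧ G.Adj x y := by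
  simp [edgesIn, and_assoc]

lemma indep_eq_sum_powerset (G : SimpleGraph ι) (V : Finset ι) :
    indep G V = ∑ S ∈ (edgesIn G V).powerset, (-1 : ℤ) ^ S.card := by
  rw [Finset.sum_powerset_neg_one_pow_card, indep]
  congr 1
  rw [Finset.eq_empty_iff_forall_notMem, eq_iff_iff]
  constructor
  · intro h e
    induction e with | _ x y
    rw [mem_edgesIn]
    rintro ⟨hx, hy, ha⟩
    exact h x hx y hy ha
  · intro h x hx y hy ha
    exact h s(x, y) (mem_edgesIn.2 ⟨hx, hy, ha⟩)

lemma reachable_mono_edges {S T : Finset (Sym2 ι)} (h : S ⊆ T) {x y : ι}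
    (hxy : (SimpleGraph.fromEdgeSet (S : Set (Sym2 ι))).Reachable x y) :
    (SimpleGraph.fromEdgeSet (T : Set (Sym2 ι))).Reachable x y :=
  hxy.mono (SimpleGraph.fromEdgeSet_mono (by exact_mod_cast h))

/-- Induction along a path that starts at a fixed vertex. -/
lemma reachable_induction {S : Finset (Sym2 ι)} {v : ι} {motive : ι → Prop} (base : motive v)
    (step : ∀ x y, (SimpleGraph.fromEdgeSet (S : Set (Sym2 ι))).Reachable v x → motive x →
      s(x, y) ∈ S → x ≠ y → motive y) {x : ι}
    (h : (SimpleGraph.fromEdgeSet (S : Set (Sym2 ι))).Reachable v x) : motive x := by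
  have h' := h
  rw [SimpleGraph.reachable_iff_reflTransGen] at h'
  induction h' with
  | refl => exact base
  | @tail b c hb hbc ih =>
    have hb' := (SimpleGraph.reachable_iff_reflTransGen _ _).2 hb
    rw [SimpleGraph.fromEdgeSet_adj] at hbc
    exact step b c hb' (ih hb') (by exact_mod_cast hbc.1) hbc.2

lemma reachable_tail {S : Finset (Sym2 ι)} {v x y : ι}
    (h : (SimpleGraph.fromEdgeSet (S : Set (Sym2 ι))).Reachable v x) (hxy : s(x, y) ∈ S)
    (hne : x ≠ y) : (SimpleGraph.fromEdgeSet (S : Set (Sym2 ι))).Reachable v y :=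
  h.trans (SimpleGraph.Adj.reachable
    ((SimpleGraph.fromEdgeSet_adj _).2 ⟨by exact_mod_cast hxy, hne⟩))

/-- The part of `V` that the edges of `S` connect with `v`. -/
def componentOf (S : Finset (Sym2 ι)) (V : Finset ι) (v : ι) : Finset ι :=
  V.filter fun x => (SimpleGraph.fromEdgeSet (S : Set (Sym2 ι))).Reachable v x

lemma edgesIn_mono {G : SimpleGraph ι} {A V : Finset ι} (h : A ⊆ V) :
    edgesIn G A ⊆ edgesIn G V := by
  intro e
  induction e with | _ x y
  simp only [mem_edgesIn]
  exact fun ⟨a, b, c⟩ => ⟨h a, h b, c⟩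

lemma connects_union {G : SimpleGraph ι} {A V : Finset ι} {v : ι} (hv : v ∈ A)
    {S T : Finset (Sym2 ι)} (hAV : A ⊆ V)
    (hS : S ⊆ edgesIn G A) (hT : T ⊆ edgesIn G (V \ A)) (hc : Connects S A) :
    componentOf (S ∪ T) V v = A := by
  ext x
  rw [componentOf, Finset.mem_filter]
  constructor
  · rintro ⟨-, hx⟩
    refine reachable_induction (motive := fun x => x ∈ A) hv ?_ hx
    intro x y _ hxA hxy _
    rcases Finset.mem_union.1 hxy with h | h
    · exact (mem_edgesIn.1 (hS h)).2.1
    · exact absurd hxA (Finset.mem_sdiff.1 (mem_edgesIn.1 (hT h)).1).2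
  · intro hx
    exact ⟨hAV hx, reachable_mono_edges Finset.subset_union_left (hc.2 v hv x hx)⟩

lemma connects_component {G : SimpleGraph ι} {V : Finset ι} {v : ι} (hv : v ∈ V)
    {S : Finset (Sym2 ι)} (hS : S ⊆ edgesIn G V) :
    Connects (S ∩ edgesIn G (componentOf S V v)) (componentOf S V v) := by
  have hvA : v ∈ componentOf S V v := Finset.mem_filter.2 ⟨hv, SimpleGraph.Reachable.refl _⟩
  have key : ∀ x ∈ componentOf S V v, (SimpleGraph.fromEdgeSet
      ((S ∩ edgesIn G (componentOf S V v) : Finset (Sym2 ι)) : Set (Sym2 ι))).Reachable v x := by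
    intro x hx
    refine reachable_induction (S := S) (motive := fun x => (SimpleGraph.fromEdgeSet
      ((S ∩ edgesIn G (componentOf S V v) : Finset (Sym2 ι)) : Set (Sym2 ι))).Reachable v x)
      (SimpleGraph.Reachable.refl _) ?_ (Finset.mem_filter.1 hx).2
    intro x y hvx ih hxy hne
    obtain ⟨h1, h2, h3⟩ := mem_edgesIn.1 (hS hxy)
    refine reachable_tail ih (Finset.mem_inter.2 ⟨hxy, mem_edgesIn.2 ⟨?_, ?_, h3⟩⟩) hne
    · exact Finset.mem_filter.2 ⟨h1, hvx⟩
    · exact Finset.mem_filter.2 ⟨h2, reachable_tail hvx hxy hne⟩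
  exact ⟨⟨v, hvA⟩, fun x hx y hy => (key x hx).symm.trans (key y hy)⟩

lemma component_split {G : SimpleGraph ι} {V : Finset ι} {v : ι}
    {S : Finset (Sym2 ι)} (hS : S ⊆ edgesIn G V) :
    (S ∩ edgesIn G (componentOf S V v)) ∪ (S ∩ edgesIn G (V \ componentOf S V v)) = S := by
  ext e
  induction e with | _ x y
  simp only [Finset.mem_union, Finset.mem_inter, mem_edgesIn, Finset.mem_sdiff]
  constructor
  · rintro (h | h) <;> exact h.1
  · intro he
    obtain ⟨h1, h2, h3⟩ := mem_edgesIn.1 (hS he)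
    have hiff : x ∈ componentOf S V v ↔ y ∈ componentOf S V v := by
      simp only [componentOf, Finset.mem_filter, h1, h2, true_and]
      constructor
      · intro h
        exact reachable_tail h he h3.ne
      · intro h
        exact reachable_tail h (by rwa [Sym2.eq_swap]) h3.ne'
    by_cases hx : x ∈ componentOf S V v
    · exact Or.inl ⟨he, hx, hiff.1 hx, h3⟩
    · exact Or.inr ⟨he, ⟨h1, hx⟩, ⟨h2, fun h => hx (hiff.2 h)⟩, h3⟩

lemma disjoint_edgesIn {G : SimpleGraph ι} {A V : Finset ι} :
    Disjoint (edgesIn G A) (edgesIn G (V \ A)) := by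
  rw [Finset.disjoint_left]
  intro e
  induction e with | _ x y
  simp only [mem_edgesIn, Finset.mem_sdiff]
  rintro ⟨h, -⟩ ⟨⟨-, h'⟩, -⟩
  exact h' h

/-- Sorting the subgraphs of the graph induced on `V` by the component of the vertex `v`. -/
theorem indep_eq_sum_connSum (G : SimpleGraph ι) {V : Finset ι} {v : ι} (hv : v ∈ V) :
    indep G V = ∑ A ∈ V.powerset.filter (fun A => v ∈ A), connSum G A * indep G (V \ A) := by
  rw [indep_eq_sum_powerset, ← Finset.sum_fiberwise_of_maps_to
    (t := V.powerset.filter (fun A => v ∈ A)) (g := fun S => componentOf S V v)]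
  · refine Finset.sum_congr rfl fun A hA => ?_
    rw [Finset.mem_filter, Finset.mem_powerset] at hA
    obtain ⟨hAV, hvA⟩ := hA
    rw [indep_eq_sum_powerset, connSum, Finset.sum_mul_sum, ← Finset.sum_product']
    refine Finset.sum_bij' (fun S _ => (S ∩ edgesIn G A, S ∩ edgesIn G (V \ A)))
      (fun T _ => T.1 ∪ T.2) ?_ ?_ ?_ ?_ ?_
    · intro S hS
      rw [Finset.mem_filter, Finset.mem_powerset] at hS
      obtain ⟨hS, rfl⟩ := hS
      simp only [Finset.mem_product, Finset.mem_filter, Finset.mem_powerset]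
      exact ⟨⟨Finset.inter_subset_right, connects_component hv hS⟩, Finset.inter_subset_right⟩
    · rintro ⟨S, T⟩ h
      simp only [Finset.mem_product, Finset.mem_filter, Finset.mem_powerset] at h ⊢
      obtain ⟨⟨hS, hc⟩, hT⟩ := h
      exact ⟨Finset.union_subset (hS.trans (edgesIn_mono hAV))
        (hT.trans (edgesIn_mono Finset.sdiff_subset)), connects_union hvA hAV hS hT hc⟩
    · intro S hS
      rw [Finset.mem_filter, Finset.mem_powerset] at hS
      obtain ⟨hS, rfl⟩ := hS
      exact component_split hS
    · rintro ⟨S, T⟩ h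
      simp only [Finset.mem_product, Finset.mem_filter, Finset.mem_powerset] at h ⊢
      obtain ⟨⟨hS, hc⟩, hT⟩ := h
      have hd := disjoint_edgesIn (G := G) (A := A) (V := V)
      rw [Finset.union_inter_distrib_right, Finset.union_inter_distrib_right,
        Finset.inter_eq_left.2 hS, Finset.inter_eq_left.2 hT,
        Finset.disjoint_iff_inter_eq_empty.1 (hd.symm.mono_left hT),
        Finset.disjoint_iff_inter_eq_empty.1 (hd.mono_left hS)]
      simp
    · intro S hS
      rw [Finset.mem_filter, Finset.mem_powerset] at hS
      obtain ⟨hS, rfl⟩ := hS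
      conv_lhs => rw [← component_split (v := v) hS]
      rw [Finset.card_union_of_disjoint, pow_add]
      exact (disjoint_edgesIn (G := G)).mono Finset.inter_subset_right Finset.inter_subset_right
  · intro S _
    exact Finset.mem_filter.2 ⟨Finset.mem_powerset.2 (Finset.filter_subset _ _),
      Finset.mem_filter.2 ⟨hv, SimpleGraph.Reachable.refl _⟩⟩

/-- Disjoint pairs of subsets of `V`, listed in either order. -/
lemma sum_disjoint_swap {M : Type*} [AddCommMonoid M] (V : Finset ι) (v : ι)
    (f : Finset ι → Finset ι → M) :
    ∑ B ∈ V.powerset.filter (fun B => v ∉ B), ∑ A ∈ (V \ B).powerset.filter (fun A => v ∈ A), f A B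
      = ∑ A ∈ V.powerset.filter (fun A => v ∈ A), ∑ B ∈ (V \ A).powerset, f A B := by
  refine Finset.sum_comm' ?_
  intro B A
  simp only [Finset.mem_filter, Finset.mem_powerset, Finset.subset_sdiff]
  constructor
  · rintro ⟨⟨h1, h2⟩, ⟨h3, h4⟩, h5⟩
    exact ⟨⟨h1, h4.symm⟩, h3, h5⟩
  · rintro ⟨⟨h1, h2⟩, h3, h4⟩
    exact ⟨⟨h1, fun h => Finset.disjoint_left.1 h2 h h4⟩, ⟨h3, h2.symm⟩, h4⟩

lemma sum_disjoint_swap' {M : Type*} [AddCommMonoid M] (V : Finset ι) (v : ι)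
    (f : Finset ι → Finset ι → M) :
    ∑ A ∈ V.powerset.filter (fun A => v ∈ A), ∑ B ∈ (V \ A).powerset, f A B
      = ∑ C ∈ V.powerset.filter (fun C => v ∈ C),
          ∑ A ∈ C.powerset.filter (fun A => v ∈ A), f A (C \ A) := by
  rw [Finset.sum_sigma', Finset.sum_sigma']
  refine Finset.sum_bij' (fun x _ => ⟨x.1 ∪ x.2, x.1⟩) (fun x _ => ⟨x.2, x.1 \ x.2⟩) ?_ ?_ ?_ ?_ ?_
  · rintro ⟨A, B⟩ h
    simp only [Finset.mem_sigma, Finset.mem_filter, Finset.mem_powerset, Finset.subset_sdiff] at h ⊢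
    exact ⟨⟨Finset.union_subset h.1.1 h.2.1, Finset.mem_union_left _ h.1.2⟩,
      Finset.subset_union_left, h.1.2⟩
  · rintro ⟨C, A⟩ h
    simp only [Finset.mem_sigma, Finset.mem_filter, Finset.mem_powerset] at h ⊢
    exact ⟨⟨h.2.1.trans h.1.1, h.2.2⟩, Finset.sdiff_subset_sdiff h.1.1 subset_rfl⟩
  · rintro ⟨A, B⟩ h
    simp only [Finset.mem_sigma, Finset.mem_filter, Finset.mem_powerset, Finset.subset_sdiff] at h ⊢
    rw [Finset.union_sdiff_cancel_left h.2.2.symm]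
  · rintro ⟨C, A⟩ h
    simp only [Finset.mem_sigma, Finset.mem_filter, Finset.mem_powerset] at h ⊢
    rw [Finset.union_sdiff_of_subset h.2.1]
  · rintro ⟨A, B⟩ h
    simp only [Finset.mem_sigma, Finset.mem_filter, Finset.mem_powerset, Finset.subset_sdiff] at h ⊢
    rw [Finset.union_sdiff_cancel_left h.2.2.symm]

lemma indep_insert (G : SimpleGraph ι) (V : Finset ι) (o : ι) :
    indep G (insert o V) = (if ∃ x ∈ V, G.Adj o x then 0 else 1) * indep G V := by
  unfold indep
  by_cases h2 : ∃ x ∈ V, G.Adj o x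
  · obtain ⟨x, hx, hox⟩ := h2
    rw [if_neg, if_pos ⟨x, hx, hox⟩, zero_mul]
    exact fun h => h o (Finset.mem_insert_self _ _) x (Finset.mem_insert_of_mem hx) hox
  · rw [if_neg h2, one_mul]
    congr 1
    rw [eq_iff_iff]
    constructor
    · exact fun h x hx y hy => h x (Finset.mem_insert_of_mem hx) y (Finset.mem_insert_of_mem hy)
    · intro h x hx y hy hxy
      rcases Finset.mem_insert.1 hx with rfl | hx1 <;> rcases Finset.mem_insert.1 hy with rfl | hy1
      · exact G.loopless.irrefl _ hxy
      · exact h2 ⟨y, hy1, hxy⟩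
      · exact h2 ⟨x, hx1, hxy.symm⟩
      · exact h x hx1 y hy1 hxy

lemma indep_insert_eq_sum (G : SimpleGraph ι) {V : Finset ι} {o : ι} (ho : o ∉ V) :
    indep G (insert o V) = ∑ B ∈ V.powerset, connSum G (insert o B) * indep G (V \ B) := by
  rw [indep_eq_sum_connSum G (Finset.mem_insert_self o V)]
  symm
  refine Finset.sum_bij' (fun B _ => insert o B) (fun A _ => A.erase o) ?_ ?_ ?_ ?_ ?_
  · intro B hB
    simp only [Finset.mem_filter, Finset.mem_powerset] at hB ⊢
    exact ⟨Finset.insert_subset_insert _ hB, Finset.mem_insert_self _ _⟩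
  · intro A hA
    simp only [Finset.mem_filter, Finset.mem_powerset] at hA ⊢
    exact Finset.subset_insert_iff.1 hA.1
  · intro B hB
    exact Finset.erase_insert fun h => ho (Finset.mem_powerset.1 hB h)
  · intro A hA
    exact Finset.insert_erase (Finset.mem_filter.1 hA).2
  · intro B hB
    congr 2
    rw [Finset.insert_sdiff_insert, Finset.sdiff_insert_of_notMem ho]

/-- The recursion for the sums over connected subgraphs, obtained by taking out the vertex `o` and
looking at the component of `v` in what is left. -/
theorem connSum_insert (G : SimpleGraph ι) {o v : ι} (V : Finset ι) (ho : o ∉ V) (hv : v ∈ V) :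
    connSum G (insert o V) = ∑ A ∈ V.powerset.filter (fun A => v ∈ A),
      connSum G A * (if ∃ x ∈ A, G.Adj o x then -1 else 0) * connSum G (insert o (V \ A)) := by
  induction V using Finset.strongInduction with
  | _ V ih =>
  set c := connSum G with hc
  set e := indep G with he
  set χ : Finset ι → ℤ := fun A => if ∃ x ∈ A, G.Adj o x then 0 else 1 with hχ
  set d : Finset ι → ℤ := fun W => ∑ A ∈ W.powerset.filter (fun A => v ∈ A),
      c A * (χ A - 1) * c (insert o (W \ A)) with hd
  have hχ' : ∀ A, (if ∃ x ∈ A, G.Adj o x then -1 else 0 : ℤ) = χ A - 1 := by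
    intro A
    simp only [hχ]
    split_ifs <;> norm_num
  have hχmul : ∀ A ⊆ V, χ V = χ A * χ (V \ A) := by
    intro A hA
    have : (∃ x ∈ V, G.Adj o x) ↔ (∃ x ∈ A, G.Adj o x) ∨ ∃ x ∈ V \ A, G.Adj o x := by
      constructor
      · rintro ⟨x, hx, hox⟩
        by_cases hxA : x ∈ A
        · exact Or.inl ⟨x, hxA, hox⟩
        · exact Or.inr ⟨x, Finset.mem_sdiff.2 ⟨hx, hxA⟩, hox⟩
      · rintro (⟨x, hx, hox⟩ | ⟨x, hx, hox⟩)
        · exact ⟨x, hA hx, hox⟩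
        · exact ⟨x, (Finset.mem_sdiff.1 hx).1, hox⟩
    simp only [hχ, this]
    by_cases h1 : ∃ x ∈ A, G.Adj o x <;> by_cases h2 : ∃ x ∈ V \ A, G.Adj o x <;>
      simp only [h1, h2, or_true, or_false, if_true, if_false, mul_zero, mul_one]
  have key : ∑ B ∈ V.powerset.filter (fun B => v ∈ B), c (insert o B) * e (V \ B)
      = ∑ B ∈ V.powerset.filter (fun B => v ∈ B), d B * e (V \ B) := by
    have e1 : e (insert o V) = ∑ A ∈ V.powerset.filter (fun A => v ∈ A),
        c A * χ A * e (insert o (V \ A)) := by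
      rw [he, indep_insert, indep_eq_sum_connSum G hv, Finset.mul_sum]
      refine Finset.sum_congr rfl fun A hA => ?_
      rw [Finset.mem_filter, Finset.mem_powerset] at hA
      rw [indep_insert]
      change χ V * _ = c A * χ A * (χ (V \ A) * _)
      rw [hχmul A hA.1]
      ring
    have e2 : e (insert o V) = ∑ B ∈ V.powerset.filter (fun B => v ∈ B),
          c (insert o B) * e (V \ B)
        + ∑ A ∈ V.powerset.filter (fun A => v ∈ A), c A * e (insert o (V \ A)) := by
      rw [he, indep_insert_eq_sum G ho, ← Finset.sum_filter_add_sum_filter_not _ (fun B => v ∈ B)]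
      congr 1
      have : ∀ B ∈ V.powerset.filter (fun B => v ∉ B), c (insert o B) * e (V \ B)
          = ∑ A ∈ (V \ B).powerset.filter (fun A => v ∈ A),
              c (insert o B) * (c A * e ((V \ A) \ B)) := by
        intro B hB
        rw [Finset.mem_filter] at hB
        rw [he, indep_eq_sum_connSum G (Finset.mem_sdiff.2 ⟨hv, hB.2⟩), Finset.mul_sum]
        refine Finset.sum_congr rfl fun A _ => ?_
        rw [sdiff_sdiff_comm]
      rw [Finset.sum_congr rfl this,
        sum_disjoint_swap V v fun A B => c (insert o B) * (c A * e ((V \ A) \ B))]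
      refine Finset.sum_congr rfl fun A hA => ?_
      rw [indep_insert_eq_sum G (fun h => ho (Finset.mem_sdiff.1 h).1), Finset.mul_sum]
      exact Finset.sum_congr rfl fun B _ => by ring
    have e3 : ∑ B ∈ V.powerset.filter (fun B => v ∈ B), d B * e (V \ B)
        = ∑ A ∈ V.powerset.filter (fun A => v ∈ A), c A * (χ A - 1) * e (insert o (V \ A)) := by
      have : ∀ A ∈ V.powerset.filter (fun A => v ∈ A), c A * (χ A - 1) * e (insert o (V \ A))
          = ∑ B ∈ (V \ A).powerset, c A * (χ A - 1) * (c (insert o B) * e (V \ (A ∪ B))) := by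
        intro A hA
        rw [he, indep_insert_eq_sum G (fun h => ho (Finset.mem_sdiff.1 h).1), Finset.mul_sum]
        refine Finset.sum_congr rfl fun B _ => ?_
        rw [Finset.sdiff_sdiff_left']
        congr 3
        rw [Finset.sdiff_union_distrib]
      rw [Finset.sum_congr rfl this,
        sum_disjoint_swap' V v fun A B => c A * (χ A - 1) * (c (insert o B) * e (V \ (A ∪ B)))]
      refine Finset.sum_congr rfl fun C _ => ?_
      rw [hd, Finset.sum_mul]
      refine Finset.sum_congr rfl fun A hA => ?_
      rw [Finset.mem_filter, Finset.mem_powerset] at hA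
      rw [Finset.union_sdiff_of_subset hA.1]
      ring
    rw [e3]
    have : ∑ A ∈ V.powerset.filter (fun A => v ∈ A), c A * (χ A - 1) * e (insert o (V \ A))
        = ∑ A ∈ V.powerset.filter (fun A => v ∈ A), c A * χ A * e (insert o (V \ A))
          - ∑ A ∈ V.powerset.filter (fun A => v ∈ A), c A * e (insert o (V \ A)) := by
      rw [← Finset.sum_sub_distrib]
      exact Finset.sum_congr rfl fun A _ => by ring
    rw [this, ← e1, e2]
    ring
  have hVm : V ∈ V.powerset.filter (fun B => v ∈ B) := by simp [hv]
  rw [← Finset.add_sum_erase _ _ hVm, ← Finset.add_sum_erase _ (fun B => d B * e (V \ B)) hVm] at key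
  have hrest : ∑ B ∈ (V.powerset.filter (fun B => v ∈ B)).erase V, c (insert o B) * e (V \ B)
      = ∑ B ∈ (V.powerset.filter (fun B => v ∈ B)).erase V, d B * e (V \ B) := by
    refine Finset.sum_congr rfl fun B hB => ?_
    rw [Finset.mem_erase, Finset.mem_filter, Finset.mem_powerset] at hB
    rw [ih B (Finset.ssubset_iff_subset_ne.2 ⟨hB.2.1, hB.1⟩) (fun h => ho (hB.2.1 h)) hB.2.2]
    simp only [hχ', hd]
  rw [hrest, add_left_inj, sdiff_self] at key
  have he0 : e (⊥ : Finset ι) = 1 := by simp [he, indep]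
  simp only [he0, mul_one] at key
  rw [key]
  simp only [hχ', hd]

/-- The sums over connected subgraphs do not depend on the names of the vertices. -/
lemma connSum_comap (G : SimpleGraph ι) (f : κ ↪ ι) (W : Finset κ) :
    connSum (G.comap f) W = connSum G (W.map f) := by
  have hinj : Function.Injective (Sym2.map f) := Sym2.map.injective f.injective
  have hedge : edgesIn G (W.map f) = (edgesIn (G.comap f) W).map ⟨Sym2.map f, hinj⟩ := by
    ext e
    induction e with | _ x y
    constructor
    · intro h
      obtain ⟨hx, hy, hxy⟩ := mem_edgesIn.1 h
      rw [Finset.mem_map]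
      obtain ⟨x', hx', rfl⟩ := Finset.mem_map.1 hx
      obtain ⟨y', hy', rfl⟩ := Finset.mem_map.1 hy
      exact ⟨s(x', y'), mem_edgesIn.2 ⟨hx', hy', hxy⟩, by simp⟩
    · intro h
      obtain ⟨e', he', h⟩ := Finset.mem_map.1 h
      induction e' with | _ x' y'
      obtain ⟨h1, h2, h3⟩ := mem_edgesIn.1 he'
      have hh : s(f x', f y') = s(x, y) := h
      rw [← hh, mem_edgesIn]
      exact ⟨Finset.mem_map_of_mem _ h1, Finset.mem_map_of_mem _ h2, h3⟩
  have hconn : ∀ S ⊆ edgesIn (G.comap f) W,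
      (Connects (S.map ⟨Sym2.map f, hinj⟩) (W.map f) ↔ Connects S W) := by
    intro S hS
    unfold Connects
    rw [Finset.map_nonempty]
    refine and_congr_right fun _ => ?_
    have h1 : ∀ x y, (SimpleGraph.fromEdgeSet (S : Set (Sym2 κ))).Reachable x y →
        (SimpleGraph.fromEdgeSet ((S.map ⟨Sym2.map f, hinj⟩ : Finset (Sym2 ι)) :
          Set (Sym2 ι))).Reachable (f x) (f y) := by
      intro x y h
      refine reachable_induction (motive := fun y => (SimpleGraph.fromEdgeSet
        ((S.map ⟨Sym2.map f, hinj⟩ : Finset (Sym2 ι)) : Set (Sym2 ι))).Reachable (f x) (f y))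
        (SimpleGraph.Reachable.refl _) ?_ h
      intro y z _ ih hyz hne
      exact reachable_tail ih (Finset.mem_map.2 ⟨s(y, z), hyz, by simp⟩) (f.injective.ne hne)
    have h2 : ∀ x z, (SimpleGraph.fromEdgeSet ((S.map ⟨Sym2.map f, hinj⟩ : Finset (Sym2 ι)) :
          Set (Sym2 ι))).Reachable (f x) z → ∃ y, z = f y ∧
        (SimpleGraph.fromEdgeSet (S : Set (Sym2 κ))).Reachable x y := by
      intro x z h
      refine reachable_induction (motive := fun z => ∃ y, z = f y ∧
        (SimpleGraph.fromEdgeSet (S : Set (Sym2 κ))).Reachable x y)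
        ⟨x, rfl, SimpleGraph.Reachable.refl _⟩ ?_ h
      rintro _ z' _ ⟨y, rfl, hy⟩ hyz hne
      obtain ⟨e, he, hez⟩ := Finset.mem_map.1 hyz
      induction e with | _ a b
      have hh : s(f a, f b) = s(f y, z') := hez
      rw [Sym2.eq_iff] at hh
      rcases hh with ⟨ha, hb⟩ | ⟨ha, hb⟩
      · refine ⟨b, hb.symm, reachable_tail hy ?_ ?_⟩
        · rwa [← f.injective ha]
        · rintro rfl; exact hne hb
      · refine ⟨a, ha.symm, reachable_tail hy ?_ ?_⟩
        · rw [← f.injective hb, Sym2.eq_swap]; exact he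
        · rintro rfl; exact hne ha
    constructor
    · intro h x hx y hy
      obtain ⟨y', hy', hr⟩ := h2 x _ (h (f x) (Finset.mem_map_of_mem _ hx) (f y)
        (Finset.mem_map_of_mem _ hy))
      rwa [f.injective hy']
    · intro h x hx y hy
      obtain ⟨x, hx', rfl⟩ := Finset.mem_map.1 hx
      obtain ⟨y, hy', rfl⟩ := Finset.mem_map.1 hy
      exact h1 x y (h x hx' y hy')
  unfold connSum
  refine Finset.sum_bij (fun S _ => S.map ⟨Sym2.map f, hinj⟩) ?_ ?_ ?_ ?_
  · intro S hS
    rw [Finset.mem_filter, Finset.mem_powerset] at hS ⊢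
    rw [hedge]
    exact ⟨Finset.map_subset_map.2 hS.1, (hconn S hS.1).2 hS.2⟩
  · intro S _ T _ h
    exact Finset.map_injective _ h
  · intro T hT
    rw [Finset.mem_filter, Finset.mem_powerset, hedge] at hT
    obtain ⟨S, hS, rfl⟩ := Finset.subset_map_iff.1 hT.1
    exact ⟨S, Finset.mem_filter.2 ⟨Finset.mem_powerset.2 hS, (hconn S hS).1 hT.2⟩, rfl⟩
  · intro S _
    rw [Finset.card_map]

lemma connSum_singleton (G : SimpleGraph ι) (o : ι) : connSum G {o} = 1 := by
  have h := indep_eq_sum_connSum G (Finset.mem_singleton_self o)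
  have : ({o} : Finset ι).powerset.filter (fun A => o ∈ A) = {{o}} := by
    ext A
    simp only [Finset.mem_filter, Finset.mem_powerset, Finset.mem_singleton,
      Finset.subset_singleton_iff]
    constructor
    · rintro ⟨rfl | rfl, h⟩
      · simp at h
      · rfl
    · rintro rfl
      simp
  rw [this] at h
  simpa [indep] using h.symm

lemma indep_comap (G : SimpleGraph ι) (f : κ ↪ ι) (W : Finset κ) :
    indep (G.comap f) W = indep G (W.map f) := by
  unfold indep
  congr 1
  simp

end Graph

/-! ### Sums over families of polymers -/

section Families

variable {P : Type*} (R : P → P → Prop) (z : P → ℝ) (Λ : Finset P)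

/-- The graph on the indices of a family whose edges join the indices of related members. -/
def polyGraph {κ : Type*} (δ : κ → P) : SimpleGraph κ :=
  SimpleGraph.fromRel fun i j => R (δ i) (δ j)

/-- The weighted sum of `Φ` over the families of length `n` in `Λ`. -/
def tupleSum (n : ℕ) (Φ : (Fin n → P) → ℝ) : ℝ :=
  ∑ δ ∈ Fintype.piFinset (fun _ : Fin n => Λ), Φ δ * ∏ i, z (δ i)

/-- The coefficient of a family in the cluster expansion. -/
def ursell {n : ℕ} (δ : Fin n → P) : ℤ := connSum (polyGraph R δ) Finset.univ

/-- The indicator of the families of pairwise unrelated members. -/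
def hardcore {n : ℕ} (δ : Fin n → P) : ℤ := indep (polyGraph R δ) Finset.univ

/-- The coefficient of the family that consists of `γ` and of the members of `δ`. -/
def rooted {n : ℕ} (γ : P) (δ : Fin n → P) : ℤ :=
  connSum (polyGraph R (fun x : Option (Fin n) => x.elim γ δ)) Finset.univ

variable {R z Λ}

lemma polyGraph_comap {κ ι : Type*} (f : κ ↪ ι) (δ : ι → P) :
    polyGraph R (fun i => δ (f i)) = (polyGraph R δ).comap f := by
  ext i j
  simp [polyGraph, f.injective.ne_iff]

lemma connSum_polyGraph_map {κ ι : Type*} [DecidableEq κ] [DecidableEq ι] (f : κ ↪ ι) (δ : ι → P)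
    (W : Finset κ) :
    connSum (polyGraph R (fun i => δ (f i))) W = connSum (polyGraph R δ) (W.map f) := by
  rw [polyGraph_comap, connSum_comap]

lemma tupleSum_mono {n : ℕ} {Φ Ψ : (Fin n → P) → ℝ} (hz : ∀ γ ∈ Λ, 0 ≤ z γ)
    (h : ∀ δ, (∀ i, δ i ∈ Λ) → Φ δ ≤ Ψ δ) : tupleSum z Λ n Φ ≤ tupleSum z Λ n Ψ := by
  refine Finset.sum_le_sum fun δ hδ => ?_
  rw [Fintype.mem_piFinset] at hδ
  exact mul_le_mul_of_nonneg_right (h δ hδ) (Finset.prod_nonneg fun i _ => hz _ (hδ i))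

lemma tupleSum_nonneg {n : ℕ} {Φ : (Fin n → P) → ℝ} (hz : ∀ γ ∈ Λ, 0 ≤ z γ)
    (h : ∀ δ, 0 ≤ Φ δ) : 0 ≤ tupleSum z Λ n Φ := by
  refine Finset.sum_nonneg fun δ hδ => ?_
  rw [Fintype.mem_piFinset] at hδ
  exact mul_nonneg (h δ) (Finset.prod_nonneg fun i _ => hz _ (hδ i))

lemma tupleSum_sum {n : ℕ} {α : Type*} (s : Finset α) (Φ : α → (Fin n → P) → ℝ) :
    tupleSum z Λ n (fun δ => ∑ a ∈ s, Φ a δ) = ∑ a ∈ s, tupleSum z Λ n (Φ a) := by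
  unfold tupleSum
  rw [Finset.sum_comm]
  exact Finset.sum_congr rfl fun δ _ => Finset.sum_mul _ _ _

lemma abs_tupleSum_le {n : ℕ} (Φ : (Fin n → P) → ℝ) (hz : ∀ γ ∈ Λ, 0 ≤ z γ) :
    |tupleSum z Λ n Φ| ≤ tupleSum z Λ n (fun δ => |Φ δ|) := by
  refine (Finset.abs_sum_le_sum_abs _ _).trans (Finset.sum_le_sum fun δ hδ => ?_)
  rw [Fintype.mem_piFinset] at hδ
  rw [abs_mul, abs_of_nonneg (Finset.prod_nonneg fun i _ => hz _ (hδ i))]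

/-- A sum over families factors along a partition of the indices. -/
lemma tupleSum_split {k m n : ℕ} (e : Fin k ⊕ Fin m ≃ Fin n) (Φ : (Fin k → P) → ℝ)
    (Ψ : (Fin m → P) → ℝ) :
    tupleSum z Λ n (fun δ => Φ (fun i => δ (e (Sum.inl i))) * Ψ (fun i => δ (e (Sum.inr i))))
      = tupleSum z Λ k Φ * tupleSum z Λ m Ψ := by
  unfold tupleSum
  rw [Finset.sum_mul_sum, ← Finset.sum_product']
  refine Finset.sum_bij' (fun δ _ => (fun i => δ (e (Sum.inl i)), fun i => δ (e (Sum.inr i))))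
    (fun x _ => fun i => Sum.elim x.1 x.2 (e.symm i)) ?_ ?_ ?_ ?_ ?_
  · intro δ hδ
    simp only [Fintype.mem_piFinset, Finset.mem_product] at hδ ⊢
    exact ⟨fun i => hδ _, fun i => hδ _⟩
  · rintro ⟨a, b⟩ h
    simp only [Fintype.mem_piFinset, Finset.mem_product] at h ⊢
    intro i
    rcases e.symm i with j | j
    · exact h.1 j
    · exact h.2 j
  · intro δ _
    funext i
    obtain ⟨x, rfl⟩ := e.surjective i
    rcases x with x | x <;> simp
  · rintro ⟨a, b⟩ _
    simp
  · intro δ _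
    have : ∏ i, z (δ i) = (∏ i, z (δ (e (Sum.inl i)))) * ∏ i, z (δ (e (Sum.inr i))) := by
      rw [← Fintype.prod_sum_type (fun x => z (δ (e x))), e.prod_comp (fun i => z (δ i))]
    simp only [this]
    ring

lemma tupleSum_split_subset {n : ℕ} (A : Finset (Fin n)) :
    ∃ (f : Fin A.card ↪ Fin n) (g : Fin (n - A.card) ↪ Fin n),
      Finset.univ.map f = A ∧ Finset.univ.map g = Finset.univ \ A ∧
      ∀ (Φ : (Fin A.card → P) → ℝ) (Ψ : (Fin (n - A.card) → P) → ℝ),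
        tupleSum z Λ n (fun δ => Φ (fun i => δ (f i)) * Ψ (fun i => δ (g i)))
          = tupleSum z Λ A.card Φ * tupleSum z Λ (n - A.card) Ψ := by
  have hc : Aᶜ.card = n - A.card := by rw [Finset.card_compl, Fintype.card_fin]
  refine ⟨Function.Embedding.inl.trans (finSumEquivOfFinset rfl hc).toEmbedding,
    Function.Embedding.inr.trans (finSumEquivOfFinset rfl hc).toEmbedding, ?_, ?_,
    fun Φ Ψ => tupleSum_split (finSumEquivOfFinset rfl hc) Φ Ψ⟩
  · refine Finset.eq_of_subset_of_card_le ?_ (by simp)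
    intro x hx
    obtain ⟨i, -, rfl⟩ := Finset.mem_map.1 hx
    simp
  · rw [← Finset.compl_eq_univ_sdiff]
    refine Finset.eq_of_subset_of_card_le ?_ (by simp [hc])
    intro x hx
    obtain ⟨i, -, rfl⟩ := Finset.mem_map.1 hx
    simp

/-- A sum over families, with the member at the index `i` taken out. -/
lemma tupleSum_succ {k : ℕ} (i : Fin (k + 1)) (Φ : P → (Fin k → P) → ℝ) :
    tupleSum z Λ (k + 1) (fun δ => Φ (δ i) (fun j => δ (i.succAbove j)))
      = ∑ γ ∈ Λ, z γ * tupleSum z Λ k (Φ γ) := by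
  unfold tupleSum
  simp_rw [Finset.mul_sum]
  rw [← Finset.sum_product']
  refine Finset.sum_bij' (fun δ _ => (δ i, fun j => δ (i.succAbove j)))
    (fun x _ => i.insertNth x.1 x.2) ?_ ?_ ?_ ?_ ?_
  · intro δ hδ
    simp only [Fintype.mem_piFinset, Finset.mem_product] at hδ ⊢
    exact ⟨hδ _, fun j => hδ _⟩
  · rintro ⟨a, b⟩ h
    simp only [Fintype.mem_piFinset, Finset.mem_product] at h ⊢
    intro j
    refine Fin.succAboveCases i ?_ ?_ j
    · simpa using h.1
    · intro j; simpa using h.2 j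
  · intro δ _
    exact Fin.insertNth_self_removeNth i δ
  · rintro ⟨a, b⟩ _
    simp
  · intro δ _
    simp only [Fin.prod_univ_succAbove _ i]
    ring

lemma sum_subsets_zero {M : Type*} [AddCommMonoid M] (n : ℕ) (F : ℕ → M) :
    ∑ A ∈ (Finset.univ : Finset (Fin (n + 1))).powerset.filter (fun A => 0 ∈ A), F A.card
      = ∑ j ∈ Finset.range (n + 1), n.choose j • F (j + 1) := by
  have h := Finset.sum_powerset_apply_card (fun j => F (j + 1)) (x := (Finset.univ : Finset (Fin n)))
  rw [Finset.card_univ, Fintype.card_fin] at h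
  rw [← h]
  symm
  refine Finset.sum_bij (fun B _ => insert 0 (B.map (Fin.succEmb n))) ?_ ?_ ?_ ?_
  · intro B _
    simp
  · intro B _ C _ h
    have h0 : ∀ D : Finset (Fin n), (0 : Fin (n + 1)) ∉ D.map (Fin.succEmb n) := by
      intro D hD
      obtain ⟨i, -, hi⟩ := Finset.mem_map.1 hD
      exact Fin.succ_ne_zero i hi
    have := congrArg (fun s => s.erase 0) h
    simp only [Finset.erase_insert (h0 _)] at this
    exact Finset.map_injective _ this
  · intro A hA
    refine ⟨Finset.univ.filter (fun i => Fin.succ i ∈ A), by simp, ?_⟩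
    ext x
    simp only [Finset.mem_insert, Finset.mem_map, Finset.mem_filter, Finset.mem_univ, true_and]
    refine Fin.cases ?_ ?_ x
    · simpa using (Finset.mem_filter.1 hA).2
    · intro i
      simp
  · intro B _
    rw [Finset.card_insert_of_notMem, Finset.card_map]
    simp

lemma sum_subsets_zero_mul (n : ℕ) (a b : ℕ → ℝ) :
    ∑ A ∈ (Finset.univ : Finset (Fin (n + 1))).powerset.filter (fun A => 0 ∈ A),
        a A.card * b (n + 1 - A.card)
      = ∑ j ∈ Finset.range (n + 1), n.choose j • (a (j + 1) * b (n - j)) := by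
  simpa only [Nat.add_sub_add_right] using sum_subsets_zero n (fun k => a k * b (n + 1 - k))

lemma ursell_eq_rooted {k : ℕ} (i : Fin (k + 1)) (δ : Fin (k + 1) → P) :
    ursell R δ = rooted R (δ i) (fun j => δ (i.succAbove j)) := by
  have h := connSum_polyGraph_map (R := R) (finSuccEquiv' i).toEmbedding
    (fun x : Option (Fin k) => x.elim (δ i) (fun j => δ (i.succAbove j))) Finset.univ
  have h2 : (fun j => (fun x : Option (Fin k) => x.elim (δ i) (fun j => δ (i.succAbove j)))
      ((finSuccEquiv' i).toEmbedding j)) = δ := by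
    funext j
    refine Fin.succAboveCases i ?_ ?_ j
    · simp
    · intro j; simp
  rw [h2] at h
  rw [ursell, rooted, h]
  congr 1
  ext x
  simp

lemma ursell_zero (δ : Fin 0 → P) : ursell R δ = 0 := by
  unfold ursell connSum
  rw [Finset.filter_false_of_mem, Finset.sum_empty]
  intro S _ h
  simpa using h.1

lemma rooted_zero (γ : P) (δ : Fin 0 → P) : rooted R γ δ = 1 := by
  have : (Finset.univ : Finset (Option (Fin 0))) = {none} := by
    ext x
    rcases x with _ | x
    · simp only [Finset.mem_univ, Finset.mem_singleton]
    · exact x.elim0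
  rw [rooted, this, connSum_singleton]

/-- The recursion for the number of families of pairwise unrelated members. -/
lemma tupleSum_hardcore_succ (n : ℕ) :
    tupleSum z Λ (n + 1) (fun δ => (hardcore R δ : ℝ))
      = ∑ j ∈ Finset.range (n + 1), n.choose j •
          (tupleSum z Λ (j + 1) (fun δ => (ursell R δ : ℝ))
            * tupleSum z Λ (n - j) (fun δ => (hardcore R δ : ℝ))) := by
  have h1 : ∀ δ : Fin (n + 1) → P, (hardcore R δ : ℝ) =
      ∑ A ∈ (Finset.univ : Finset (Fin (n + 1))).powerset.filter (fun A => 0 ∈ A),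
        (connSum (polyGraph R δ) A : ℝ) * (indep (polyGraph R δ) (Finset.univ \ A) : ℝ) := by
    intro δ
    rw [hardcore, indep_eq_sum_connSum _ (Finset.mem_univ 0)]
    push_cast
    rfl
  simp only [h1]
  rw [tupleSum_sum]
  rw [← sum_subsets_zero_mul n (fun k => tupleSum z Λ k (fun δ => (ursell R δ : ℝ)))
    (fun k => tupleSum z Λ k (fun δ => (hardcore R δ : ℝ)))]
  refine Finset.sum_congr rfl fun A _ => ?_
  obtain ⟨f, g, hf, hg, hfg⟩ := tupleSum_split_subset (z := z) (Λ := Λ) A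
  rw [← hfg]
  congr 1
  funext δ
  rw [ursell, connSum_polyGraph_map, hf, hardcore, polyGraph_comap g, indep_comap, hg]

/-- The recursive bound for the coefficients of the families with a fixed member `γ`. -/
lemma abs_rooted_le (hR : ∀ a b, R a b → R b a) (γ : P) {n : ℕ} (δ : Fin (n + 1) → P) :
    |(rooted R γ δ : ℝ)| ≤
      ∑ A ∈ (Finset.univ : Finset (Fin (n + 1))).powerset.filter (fun A => 0 ∈ A),
        ((if ∃ i ∈ A, R γ (δ i) then |(connSum (polyGraph R δ) A : ℝ)| else 0) *
          |(connSum (polyGraph R (fun x : Option (Fin (n + 1)) => x.elim γ δ))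
            (insert none ((Finset.univ \ A).map Function.Embedding.some)) : ℝ)|) := by
  set G := polyGraph R (fun x : Option (Fin (n + 1)) => x.elim γ δ) with hG
  have hu : (Finset.univ : Finset (Option (Fin (n + 1))))
      = insert none (Finset.univ.map Function.Embedding.some) := by
    ext x
    rcases x with _ | x <;> simp
  have h1 : rooted R γ δ = ∑ A ∈ (Finset.univ : Finset (Fin (n + 1))).powerset.filter
      (fun A => 0 ∈ A), connSum (polyGraph R δ) A * (if ∃ i ∈ A, R γ (δ i) then -1 else 0)
        * connSum G (insert none ((Finset.univ \ A).map Function.Embedding.some)) := by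
    rw [rooted, ← hG, hu, connSum_insert G (v := some 0) _ (by simp) (by simp)]
    symm
    refine Finset.sum_bij (fun A _ => A.map Function.Embedding.some) ?_ ?_ ?_ ?_
    · intro A hA
      simp only [Finset.mem_filter, Finset.mem_powerset] at hA ⊢
      exact ⟨Finset.map_subset_map.2 hA.1, Finset.mem_map.2 ⟨0, hA.2, rfl⟩⟩
    · intro A _ B _ h
      exact Finset.map_injective _ h
    · intro A' hA'
      simp only [Finset.mem_filter, Finset.mem_powerset] at hA'
      obtain ⟨A, hA, rfl⟩ := Finset.subset_map_iff.1 hA'.1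
      refine ⟨A, ?_, rfl⟩
      simp only [Finset.mem_filter, Finset.mem_powerset]
      refine ⟨hA, ?_⟩
      obtain ⟨x, hx, hx'⟩ := Finset.mem_map.1 hA'.2
      rwa [← Option.some_injective _ hx']
    · intro A _
      have e1 : connSum (polyGraph R δ) A = connSum G (A.map Function.Embedding.some) := by
        rw [hG, ← connSum_polyGraph_map]
        rfl
      have e2 : (∃ x ∈ A.map Function.Embedding.some, G.Adj none x) ↔ ∃ i ∈ A, R γ (δ i) := by
        constructor
        · rintro ⟨x, hx, hxG⟩
          obtain ⟨i, hi, rfl⟩ := Finset.mem_map.1 hx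
          refine ⟨i, hi, ?_⟩
          rcases ((SimpleGraph.fromRel_adj _ _ _).1 hxG).2 with h | h
          · exact h
          · exact hR _ _ h
        · rintro ⟨i, hi, h⟩
          exact ⟨some i, Finset.mem_map_of_mem _ hi,
            (SimpleGraph.fromRel_adj _ _ _).2 ⟨by simp, Or.inl h⟩⟩
      have e3 : Finset.univ.map Function.Embedding.some \ A.map Function.Embedding.some
          = (Finset.univ \ A).map Function.Embedding.some := by
        ext x
        rcases x with _ | x <;> simp
      rw [e1, e3]
      simp only [e2]
  rw [h1]
  push_cast
  refine (Finset.abs_sum_le_sum_abs _ _).trans (Finset.sum_le_sum fun A _ => ?_)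
  rw [abs_mul, abs_mul]
  refine mul_le_mul_of_nonneg_right ?_ (abs_nonneg _)
  split_ifs <;> simp

/-- The recursive bound for the sums over the families with a fixed member `γ`. -/
lemma tupleSum_rooted_succ_le (hR : ∀ a b, R a b → R b a) (hz : ∀ γ ∈ Λ, 0 ≤ z γ) (γ : P) (n : ℕ) :
    tupleSum z Λ (n + 1) (fun δ => |(rooted R γ δ : ℝ)|)
      ≤ ∑ j ∈ Finset.range (n + 1), n.choose j •
          (tupleSum z Λ (j + 1) (fun δ => if ∃ i, R γ (δ i) then |(ursell R δ : ℝ)| else 0)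
            * tupleSum z Λ (n - j) (fun δ => |(rooted R γ δ : ℝ)|)) := by
  refine (tupleSum_mono hz fun δ _ => abs_rooted_le hR γ δ).trans (le_of_eq ?_)
  rw [tupleSum_sum]
  rw [← sum_subsets_zero_mul n
    (fun k => tupleSum z Λ k (fun δ => if ∃ i, R γ (δ i) then |(ursell R δ : ℝ)| else 0))
    (fun k => tupleSum z Λ k (fun δ => |(rooted R γ δ : ℝ)|))]
  refine Finset.sum_congr rfl fun A _ => ?_
  obtain ⟨f, g, hf, hg, hfg⟩ := tupleSum_split_subset (z := z) (Λ := Λ) A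
  rw [← hfg]
  congr 1
  funext δ
  have e1 : (∃ i, R γ (δ (f i))) ↔ ∃ i ∈ A, R γ (δ i) := by
    have : (∃ i ∈ Finset.univ.map f, R γ (δ i)) ↔ ∃ i ∈ A, R γ (δ i) := by rw [hf]
    rw [← this]
    simp
  have e2 : rooted R γ (fun i => δ (g i))
      = connSum (polyGraph R (fun x : Option (Fin (n + 1)) => x.elim γ δ))
            (insert none ((Finset.univ \ A).map Function.Embedding.some)) := by
    have h := connSum_polyGraph_map (R := R) g.optionMap
      (fun x : Option (Fin (n + 1)) => x.elim γ δ) Finset.univ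
    have h3 : (fun i => (fun x : Option (Fin (n + 1)) => x.elim γ δ) (g.optionMap i))
        = fun x : Option (Fin (n + 1 - A.card)) => x.elim γ (fun i => δ (g i)) := by
      funext x
      rcases x with _ | x <;> rfl
    rw [h3] at h
    rw [rooted, h, ← hg]
    congr 1
    ext x
    rcases x with _ | x
    · simp
    · simp
  rw [e2]
  simp only [e1, ursell, connSum_polyGraph_map, hf]

/-- Families with a member that satisfies `Q`, in terms of families with a fixed member. -/
lemma tupleSum_exists_le (hz : ∀ γ ∈ Λ, 0 ≤ z γ) (Q : P → Prop) (k : ℕ) :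
    tupleSum z Λ (k + 1) (fun δ => if ∃ i, Q (δ i) then |(ursell R δ : ℝ)| else 0)
      ≤ (k + 1) * ∑ γ ∈ Λ.filter Q, z γ * tupleSum z Λ k (fun δ => |(rooted R γ δ : ℝ)|) := by
  have h1 : tupleSum z Λ (k + 1) (fun δ => if ∃ i, Q (δ i) then |(ursell R δ : ℝ)| else 0)
      ≤ tupleSum z Λ (k + 1) (fun δ => ∑ i : Fin (k + 1),
          if Q (δ i) then |(ursell R δ : ℝ)| else 0) := by
    refine tupleSum_mono hz fun δ _ => ?_
    split_ifs with h
    · obtain ⟨i, hi⟩ := h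
      refine le_trans (by rw [if_pos hi])
        (Finset.single_le_sum (f := fun i => if Q (δ i) then |(ursell R δ : ℝ)| else 0)
          (fun j _ => ?_) (Finset.mem_univ i))
      split_ifs <;> positivity
    · exact Finset.sum_nonneg fun j _ => by split_ifs <;> positivity
  refine h1.trans (le_of_eq ?_)
  rw [tupleSum_sum]
  have h2 : ∀ i ∈ (Finset.univ : Finset (Fin (k + 1))), tupleSum z Λ (k + 1)
      (fun δ => if Q (δ i) then |(ursell R δ : ℝ)| else 0)
      = ∑ γ ∈ Λ.filter Q, z γ * tupleSum z Λ k (fun δ => |(rooted R γ δ : ℝ)|) := by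
    intro i _
    rw [Finset.sum_filter]
    have := tupleSum_succ (z := z) (Λ := Λ) i
      (fun γ δ => if Q γ then |(rooted R γ δ : ℝ)| else 0)
    simp only [← ursell_eq_rooted i] at this
    rw [this]
    refine Finset.sum_congr rfl fun γ _ => ?_
    split_ifs
    · rfl
    · simp [tupleSum]
  rw [Finset.sum_congr rfl h2]
  simp

end Families

/-! ### Exponentials of sequences -/

section Exponential

lemma sum_cauchy_le {N : ℕ} {a b : ℕ → ℝ} (ha : ∀ k, 0 ≤ a k) (hb : ∀ n, 0 ≤ b n) :
    ∑ n ∈ Finset.range N, ∑ j ∈ Finset.range (n + 1), a j * b (n - j)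
      ≤ (∑ j ∈ Finset.range N, a j) * ∑ m ∈ Finset.range N, b m := by
  rw [Finset.sum_comm' (t' := Finset.range N) (s' := fun j => Finset.Ico j N)
    (by intro x y; simp only [Finset.mem_range, Finset.mem_Ico]; omega), Finset.sum_mul]
  refine Finset.sum_le_sum fun j _ => ?_
  rw [← Finset.mul_sum, Finset.sum_Ico_eq_sum_range]
  refine mul_le_mul_of_nonneg_left ?_ (ha j)
  simp only [Nat.add_sub_cancel_left]
  exact Finset.sum_le_sum_of_subset_of_nonneg (Finset.range_mono (Nat.sub_le _ _))
    fun i _ _ => hb i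

lemma hasDerivAt_sum_pow (t : ℕ → ℝ) (N : ℕ) (x : ℝ) :
    HasDerivAt (fun x => ∑ n ∈ Finset.range (N + 1), t n * x ^ n)
      (∑ n ∈ Finset.range N, ((n : ℝ) + 1) * t (n + 1) * x ^ n) x := by
  have h := HasDerivAt.fun_sum (u := Finset.range (N + 1)) (A := fun n x => t n * x ^ n)
    (A' := fun n => t n * (n * x ^ (n - 1))) (x := x)
    (fun n _ => (hasDerivAt_pow n x).const_mul (t n))
  refine h.congr_deriv ?_
  rw [Finset.sum_range_succ']
  simp only [Nat.cast_zero, zero_mul, mul_zero, add_zero, Nat.add_sub_cancel, Nat.cast_add,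
    Nat.cast_one]
  exact Finset.sum_congr rfl fun n _ => by ring

/-- A sequence whose generating function grows at most as fast as the exponential of that of `c`
is bounded by this exponential. -/
lemma sum_le_exp_of_recursion {t c : ℕ → ℝ} (ht : ∀ n, 0 ≤ t n) (hc : ∀ n, 0 ≤ c n)
    (ht0 : t 0 ≤ 1)
    (hrec : ∀ n : ℕ, ((n : ℝ) + 1) * t (n + 1)
      ≤ ∑ j ∈ Finset.range (n + 1), ((j : ℝ) + 1) * c (j + 1) * t (n - j)) (N : ℕ) :
    ∑ n ∈ Finset.range (N + 1), t n ≤ Real.exp (∑ k ∈ Finset.range N, c (k + 1)) := by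
  set c' : ℕ → ℝ := fun n => if n = 0 then 0 else c n with hc'
  set S : ℝ → ℝ := fun x => ∑ n ∈ Finset.range (N + 1), t n * x ^ n with hS
  set C : ℝ → ℝ := fun x => ∑ n ∈ Finset.range (N + 1), c' n * x ^ n with hC
  have hS' := hasDerivAt_sum_pow t N
  have hC' := hasDerivAt_sum_pow c' N
  have hd : ∀ x, HasDerivAt (fun x => S x * Real.exp (-C x))
      ((∑ n ∈ Finset.range N, ((n : ℝ) + 1) * t (n + 1) * x ^ n) * Real.exp (-C x)
        + S x * (Real.exp (-C x) * -(∑ n ∈ Finset.range N, ((n : ℝ) + 1) * c' (n + 1) * x ^ n))) x :=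
    fun x => (hS' x).mul ((hC' x).neg.exp)
  have hanti : AntitoneOn (fun x => S x * Real.exp (-C x)) (Set.Icc 0 1) := by
    refine antitoneOn_of_deriv_nonpos (convex_Icc 0 1)
      (fun x _ => (hd x).continuousAt.continuousWithinAt)
      (fun x _ => (hd x).differentiableAt.differentiableWithinAt) ?_
    intro x hx
    rw [interior_Icc] at hx
    have hx0 : 0 ≤ x := hx.1.le
    rw [(hd x).deriv]
    have key : ∑ n ∈ Finset.range N, ((n : ℝ) + 1) * t (n + 1) * x ^ n
        ≤ (∑ n ∈ Finset.range N, ((n : ℝ) + 1) * c' (n + 1) * x ^ n) * S x := by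
      calc ∑ n ∈ Finset.range N, ((n : ℝ) + 1) * t (n + 1) * x ^ n
          ≤ ∑ n ∈ Finset.range N, ∑ j ∈ Finset.range (n + 1),
              (((j : ℝ) + 1) * c' (j + 1) * x ^ j) * (t (n - j) * x ^ (n - j)) := by
            refine Finset.sum_le_sum fun n _ => ?_
            refine (mul_le_mul_of_nonneg_right (hrec n) (pow_nonneg hx0 n)).trans (le_of_eq ?_)
            rw [Finset.sum_mul]
            refine Finset.sum_congr rfl fun j hj => ?_
            have hjn : j ≤ n := Nat.lt_succ_iff.1 (Finset.mem_range.1 hj)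
            rw [← pow_mul_pow_sub x hjn]
            simp only [hc', Nat.succ_ne_zero, if_false]
            ring
        _ ≤ (∑ n ∈ Finset.range N, ((n : ℝ) + 1) * c' (n + 1) * x ^ n)
              * ∑ n ∈ Finset.range N, t n * x ^ n := by
            refine sum_cauchy_le (fun k => ?_) (fun n => mul_nonneg (ht n) (pow_nonneg hx0 n))
            have : 0 ≤ c' (k + 1) := by simpa [hc'] using hc (k + 1)
            positivity
        _ ≤ _ := by
            refine mul_le_mul_of_nonneg_left ?_ (Finset.sum_nonneg fun n _ => ?_)
            · exact Finset.sum_le_sum_of_subset_of_nonneg (Finset.range_mono (Nat.le_succ N))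
                fun i _ _ => mul_nonneg (ht i) (pow_nonneg hx0 i)
            · have : 0 ≤ c' (n + 1) := by simpa [hc'] using hc (n + 1)
              positivity
    have he := Real.exp_pos (-C x)
    nlinarith
  have h01 := hanti (Set.left_mem_Icc.2 zero_le_one) (Set.right_mem_Icc.2 zero_le_one) zero_le_one
  have e0 : S 0 = t 0 := by
    simp [hS, Finset.sum_range_succ']
  have e1 : C 0 = 0 := by
    simp [hC, hc', Finset.sum_range_succ']
  have e2 : S 1 = ∑ n ∈ Finset.range (N + 1), t n := by simp [hS]
  have e3 : C 1 = ∑ k ∈ Finset.range N, c (k + 1) := by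
    simp [hC, hc', Finset.sum_range_succ']
  simp only [e0, e1, e2, e3, neg_zero, Real.exp_zero, mul_one] at h01
  rw [Real.exp_neg, ← div_eq_mul_inv, div_le_iff₀ (Real.exp_pos _)] at h01
  exact h01.trans (mul_le_of_le_one_left (Real.exp_pos _).le ht0)

lemma hasDerivAt_tsum_pow {f : ℕ → ℝ} (hf : Summable fun n : ℕ => ((n : ℝ) + 1) * |f (n + 1)|)
    {x : ℝ} (hx : x ∈ Set.Ioo (-1 : ℝ) 1) :
    HasDerivAt (fun x => ∑' n, f (n + 1) * x ^ (n + 1))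
      (∑' n : ℕ, ((n : ℝ) + 1) * f (n + 1) * x ^ n) x := by
  refine hasDerivAt_tsum_of_isPreconnected (u := fun n : ℕ => ((n : ℝ) + 1) * |f (n + 1)|)
    (t := Set.Ioo (-1 : ℝ) 1) (y₀ := 0) (g := fun n x => f (n + 1) * x ^ (n + 1))
    (g' := fun n x => ((n : ℝ) + 1) * f (n + 1) * x ^ n) hf isOpen_Ioo isPreconnected_Ioo ?_ ?_
    (by simp) (by simp) hx
  · intro n y _
    refine ((hasDerivAt_pow (n + 1) y).const_mul (f (n + 1))).congr_deriv ?_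
    rw [Nat.add_sub_cancel]
    push_cast
    ring
  · intro n y hy
    have hy' : |y| ≤ 1 := abs_le.2 ⟨hy.1.le, hy.2.le⟩
    rw [Real.norm_eq_abs, abs_mul, abs_mul, abs_pow, abs_of_nonneg (by positivity : (0:ℝ) ≤ n + 1)]
    exact mul_le_of_le_one_right (by positivity) (pow_le_one₀ (abs_nonneg y) hy')

lemma continuousOn_tsum_pow {f : ℕ → ℝ} (hf : Summable fun n : ℕ => |f (n + 1)|) :
    ContinuousOn (fun x : ℝ => ∑' n, f (n + 1) * x ^ (n + 1)) (Set.Icc 0 1) := by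
  refine continuousOn_tsum (fun n => by fun_prop) hf ?_
  intro n x hx
  rw [Real.norm_eq_abs, abs_mul, abs_pow, abs_of_nonneg hx.1]
  exact mul_le_of_le_one_right (abs_nonneg _) (pow_le_one₀ hx.1 hx.2)

/-- If the formal derivative of `z` is the product of `z` and of the formal derivative of `f`, then
`z` is the exponential of `f`. -/
lemma sum_eq_exp_of_recursion {z f : ℕ → ℝ} (hz0 : z 0 = 1) (M : ℕ) (hzM : ∀ n, M < n → z n = 0)
    (hf : Summable fun n : ℕ => ((n : ℝ) + 1) * |f (n + 1)|)
    (hrec : ∀ n : ℕ, ((n : ℝ) + 1) * z (n + 1)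
      = ∑ j ∈ Finset.range (n + 1), ((j : ℝ) + 1) * f (j + 1) * z (n - j)) :
    ∑ n ∈ Finset.range (M + 1), z n = Real.exp (∑' n, f (n + 1)) := by
  have hf1 : Summable fun n : ℕ => |f (n + 1)| := by
    refine Summable.of_nonneg_of_le (fun n => abs_nonneg _) (fun n => ?_) hf
    have : (0 : ℝ) ≤ n := n.cast_nonneg
    nlinarith [abs_nonneg (f (n + 1))]
  set Z : ℝ → ℝ := fun x => ∑ n ∈ Finset.range (M + 1), z n * x ^ n with hZ
  set F : ℝ → ℝ := fun x => ∑' n, f (n + 1) * x ^ (n + 1) with hF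
  have hZ' : ∀ x ∈ Set.Ioo (-1 : ℝ) 1,
      HasDerivAt Z ((∑' n : ℕ, ((n : ℝ) + 1) * f (n + 1) * x ^ n) * Z x) x := by
    intro x hx
    have hx' : |x| ≤ 1 := abs_le.2 ⟨hx.1.le, hx.2.le⟩
    have e1 : Z x = ∑' n, z n * x ^ n := by
      rw [hZ, tsum_eq_sum]
      intro n hn
      rw [hzM n (by simpa [Nat.lt_succ_iff] using hn), zero_mul]
    have s1 : Summable fun n : ℕ => ‖((n : ℝ) + 1) * f (n + 1) * x ^ n‖ := by
      refine Summable.of_nonneg_of_le (fun n => norm_nonneg _) (fun n => ?_) hf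
      rw [Real.norm_eq_abs, abs_mul, abs_mul, abs_pow,
        abs_of_nonneg (by positivity : (0:ℝ) ≤ n + 1)]
      exact mul_le_of_le_one_right (by positivity) (pow_le_one₀ (abs_nonneg x) hx')
    have s2 : Summable fun n : ℕ => ‖z n * x ^ n‖ := by
      refine summable_of_ne_finset_zero (s := Finset.range (M + 1)) fun n hn => ?_
      rw [hzM n (by simpa [Nat.lt_succ_iff] using hn), zero_mul, norm_zero]
    rw [e1, tsum_mul_tsum_eq_tsum_sum_range_of_summable_norm s1 s2]
    convert hasDerivAt_sum_pow z M x using 1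
    have e2 : ∀ n, ∑ k ∈ Finset.range (n + 1),
        ((k : ℝ) + 1) * f (k + 1) * x ^ k * (z (n - k) * x ^ (n - k))
        = ((n : ℝ) + 1) * z (n + 1) * x ^ n := by
      intro n
      rw [hrec, Finset.sum_mul]
      refine Finset.sum_congr rfl fun j hj => ?_
      have hjn : j ≤ n := Nat.lt_succ_iff.1 (Finset.mem_range.1 hj)
      rw [← pow_mul_pow_sub x hjn]
      ring
    simp only [e2]
    refine tsum_eq_sum fun n hn => ?_
    rw [hzM (n + 1) (by simpa [Nat.lt_succ_iff] using hn), mul_zero, zero_mul]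
  have hF' : ∀ x ∈ Set.Ioo (-1 : ℝ) 1, HasDerivAt F _ x := fun x hx => hasDerivAt_tsum_pow hf hx
  have hcont : ContinuousOn (fun x => Z x * Real.exp (-F x)) (Set.Icc 0 1) := by
    refine ContinuousOn.mul (by fun_prop) ?_
    exact Real.continuous_exp.comp_continuousOn (continuousOn_tsum_pow hf1).neg
  have hconst : ∀ x ∈ Set.Icc (0 : ℝ) 1, Z x * Real.exp (-F x) = Z 0 * Real.exp (-F 0) := by
    refine constant_of_has_deriv_right_zero hcont fun x hx => ?_
    have hx' : x ∈ Set.Ioo (-1 : ℝ) 1 := ⟨by linarith [hx.1], hx.2⟩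
    have h := (hZ' x hx').mul ((hF' x hx').neg.exp)
    refine HasDerivAt.hasDerivWithinAt (h.congr_deriv ?_)
    ring
  have h1 := hconst 1 (Set.right_mem_Icc.2 zero_le_one)
  have e0 : Z 0 = 1 := by simp [hZ, Finset.sum_range_succ', hz0]
  have e1 : F 0 = 0 := by simp [hF]
  have e2 : Z 1 = ∑ n ∈ Finset.range (M + 1), z n := by simp [hZ]
  have e3 : F 1 = ∑' n, f (n + 1) := by simp [hF]
  rw [e0, e1, e2, e3, neg_zero, Real.exp_zero, mul_one, Real.exp_neg, ← div_eq_mul_inv,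
    div_eq_one_iff_eq (Real.exp_ne_zero _)] at h1
  exact h1

end Exponential

/-! ### The cluster expansion of a finite set of polymers -/

section Expansion

variable {P : Type*} {R : P → P → Prop} {z : P → ℝ} {Λ : Finset P}

lemma recursion_of_factorial {n : ℕ} {x : ℝ} {a b : ℕ → ℝ}
    (h : x = ∑ j ∈ Finset.range (n + 1), n.choose j • (a (j + 1) * b (n - j))) :
    ((n : ℝ) + 1) * (x / ((n + 1).factorial : ℝ)) = ∑ j ∈ Finset.range (n + 1),
      ((j : ℝ) + 1) * (a (j + 1) / ((j + 1).factorial : ℝ)) * (b (n - j) / ((n - j).factorial : ℝ)) := by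
  have hn : (n.factorial : ℝ) ≠ 0 := by exact_mod_cast n.factorial_ne_zero
  rw [h, Nat.factorial_succ, Nat.cast_mul, Nat.cast_succ]
  have : ((n : ℝ) + 1) ≠ 0 := by positivity
  rw [mul_div_assoc', mul_div_mul_left _ _ this, Finset.sum_div]
  refine Finset.sum_congr rfl fun j hj => ?_
  have hjn : j ≤ n := Nat.lt_succ_iff.1 (Finset.mem_range.1 hj)
  have hj0 : (j.factorial : ℝ) ≠ 0 := by exact_mod_cast j.factorial_ne_zero
  have hnj0 : ((n - j).factorial : ℝ) ≠ 0 := by exact_mod_cast (n - j).factorial_ne_zero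
  have hj1 : ((j : ℝ) + 1) ≠ 0 := by positivity
  have hch : (n.choose j : ℝ) * j.factorial * (n - j).factorial = n.factorial := by
    exact_mod_cast Nat.choose_mul_factorial_mul_factorial hjn
  rw [nsmul_eq_mul, Nat.factorial_succ, Nat.cast_mul, Nat.cast_succ, ← hch]
  have hcn : (n.choose j : ℝ) ≠ 0 := by
    exact_mod_cast (Nat.choose_pos hjn).ne'
  field_simp

/-- The convergence of the cluster expansion, under the criterion of Kotecký and Preiss. By induction
on the order: the recursion bounds the series at `γ` by the exponential of the series of the
families that meet `γ`, and choosing a member `γ'` that meets `γ` bounds these by series at `γ'` of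
smaller order. -/
theorem sum_rooted_le (hR : ∀ a b, R a b → R b a) (hz : ∀ γ ∈ Λ, 0 ≤ z γ) {a : P → ℝ}
    (hKP : ∀ γ ∈ Λ, ∑ γ' ∈ Λ.filter (R γ), z γ' * Real.exp (a γ') ≤ a γ) (N : ℕ) :
    ∀ γ ∈ Λ, ∑ n ∈ Finset.range N,
      tupleSum z Λ n (fun δ => |(rooted R γ δ : ℝ)|) / (n.factorial : ℝ) ≤ Real.exp (a γ) := by
  induction N with
  | zero => intro γ _; simpa using (Real.exp_pos _).le
  | succ N ih =>
    intro γ hγ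
    set c : ℕ → ℝ := fun k =>
      tupleSum z Λ k (fun δ => if ∃ i, R γ (δ i) then |(ursell R δ : ℝ)| else 0)
        / (k.factorial : ℝ) with hc
    have hT : ∀ (γ : P) n, 0 ≤ tupleSum z Λ n (fun δ => |(rooted R γ δ : ℝ)|) :=
      fun γ n => tupleSum_nonneg hz fun δ => abs_nonneg _
    refine (sum_le_exp_of_recursion (c := c) (fun n => ?_) (fun n => ?_) ?_ (fun n => ?_) N).trans
      (Real.exp_le_exp.2 ?_)
    · exact div_nonneg (hT γ n) (Nat.cast_nonneg _)
    · refine div_nonneg (tupleSum_nonneg hz fun δ => ?_) (Nat.cast_nonneg _)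
      split_ifs <;> positivity
    · simp [tupleSum, rooted_zero]
    · rw [← recursion_of_factorial (n := n)
        (a := fun k => tupleSum z Λ k (fun δ => if ∃ i, R γ (δ i) then |(ursell R δ : ℝ)| else 0))
        (b := fun k => tupleSum z Λ k (fun δ => |(rooted R γ δ : ℝ)|)) rfl]
      refine mul_le_mul_of_nonneg_left ?_ (by positivity)
      exact div_le_div_of_nonneg_right (tupleSum_rooted_succ_le hR hz γ n) (Nat.cast_nonneg _)
    · calc ∑ k ∈ Finset.range N, c (k + 1)
          ≤ ∑ k ∈ Finset.range N, ∑ γ' ∈ Λ.filter (R γ),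
              z γ' * (tupleSum z Λ k (fun δ => |(rooted R γ' δ : ℝ)|) / (k.factorial : ℝ)) := by
            refine Finset.sum_le_sum fun k _ => ?_
            have h := tupleSum_exists_le (R := R) hz (R γ) k
            simp only [hc]
            rw [div_le_iff₀ (by exact_mod_cast (k + 1).factorial_pos)]
            refine h.trans (le_of_eq ?_)
            rw [Nat.factorial_succ, Nat.cast_mul, Nat.cast_succ, Finset.sum_mul, Finset.mul_sum]
            refine Finset.sum_congr rfl fun γ' _ => ?_
            have : (k.factorial : ℝ) ≠ 0 := by exact_mod_cast k.factorial_ne_zero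
            field_simp
        _ = ∑ γ' ∈ Λ.filter (R γ), z γ' * ∑ k ∈ Finset.range N,
              tupleSum z Λ k (fun δ => |(rooted R γ' δ : ℝ)|) / (k.factorial : ℝ) := by
            rw [Finset.sum_comm]
            simp only [Finset.mul_sum]
        _ ≤ ∑ γ' ∈ Λ.filter (R γ), z γ' * Real.exp (a γ') := by
            refine Finset.sum_le_sum fun γ' hγ' => ?_
            have hγ'Λ := (Finset.mem_filter.1 hγ').1
            exact mul_le_mul_of_nonneg_left (ih γ' hγ'Λ) (hz γ' hγ'Λ)
        _ ≤ a γ := hKP γ hγ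

/-- The absolute sum over the families with a member that satisfies `Q`. -/
theorem sum_exists_ursell_le (hR : ∀ a b, R a b → R b a) (hz : ∀ γ ∈ Λ, 0 ≤ z γ) {a : P → ℝ}
    (hKP : ∀ γ ∈ Λ, ∑ γ' ∈ Λ.filter (R γ), z γ' * Real.exp (a γ') ≤ a γ) (Q : P → Prop) (N : ℕ) :
    ∑ n ∈ Finset.range N,
      tupleSum z Λ n (fun δ => if ∃ i, Q (δ i) then |(ursell R δ : ℝ)| else 0)
        / (n.factorial : ℝ) ≤ ∑ γ ∈ Λ.filter Q, z γ * Real.exp (a γ) := by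
  rcases N with _ | N
  · simpa using Finset.sum_nonneg fun γ hγ =>
      mul_nonneg (hz γ (Finset.mem_filter.1 hγ).1) (Real.exp_pos _).le
  rw [Finset.sum_range_succ']
  have h0 : tupleSum z Λ 0 (fun δ => if ∃ i, Q (δ i) then |(ursell R δ : ℝ)| else 0) = 0 := by
    simp [tupleSum]
  rw [h0, zero_div, add_zero]
  calc _ ≤ ∑ k ∈ Finset.range N, ∑ γ ∈ Λ.filter Q,
              z γ * (tupleSum z Λ k (fun δ => |(rooted R γ δ : ℝ)|) / (k.factorial : ℝ)) := by
            refine Finset.sum_le_sum fun k _ => ?_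
            rw [div_le_iff₀ (by exact_mod_cast (k + 1).factorial_pos)]
            refine (tupleSum_exists_le (R := R) hz Q k).trans (le_of_eq ?_)
            rw [Nat.factorial_succ, Nat.cast_mul, Nat.cast_succ, Finset.sum_mul, Finset.mul_sum]
            refine Finset.sum_congr rfl fun γ' _ => ?_
            have : (k.factorial : ℝ) ≠ 0 := by exact_mod_cast k.factorial_ne_zero
            field_simp
    _ = ∑ γ ∈ Λ.filter Q, z γ * ∑ k ∈ Finset.range N,
              tupleSum z Λ k (fun δ => |(rooted R γ δ : ℝ)|) / (k.factorial : ℝ) := by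
            rw [Finset.sum_comm]
            simp only [Finset.mul_sum]
    _ ≤ _ := by
            refine Finset.sum_le_sum fun γ hγ => ?_
            have hγΛ := (Finset.mem_filter.1 hγ).1
            exact mul_le_mul_of_nonneg_left (sum_rooted_le hR hz hKP N γ hγΛ) (hz γ hγΛ)

lemma hardcore_eq (hr : ∀ a, R a a) (hR : ∀ a b, R a b → R b a) {n : ℕ} (δ : Fin n → P) :
    hardcore R δ = if Function.Injective δ ∧
      ((Finset.univ.image δ : Finset P) : Set P).Pairwise (fun a b => ¬ R a b) then 1 else 0 := by
  unfold hardcore indep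
  congr 1
  rw [eq_iff_iff]
  constructor
  · intro h
    have h' : ∀ i j, i ≠ j → ¬ R (δ i) (δ j) := fun i j hij hRij =>
      h i (Finset.mem_univ _) j (Finset.mem_univ _)
        ((SimpleGraph.fromRel_adj _ _ _).2 ⟨hij, Or.inl hRij⟩)
    refine ⟨fun i j hij => by_contra fun hne => h' i j hne (hij ▸ hr _), ?_⟩
    intro a ha b hb hab
    simp only [Finset.coe_image, Finset.coe_univ, Set.image_univ, Set.mem_range] at ha hb
    obtain ⟨i, rfl⟩ := ha
    obtain ⟨j, rfl⟩ := hb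
    exact h' i j (fun hij => hab (by rw [hij]))
  · rintro ⟨hinj, hp⟩ i _ j _ hij
    obtain ⟨hne, h⟩ := (SimpleGraph.fromRel_adj _ _ _).1 hij
    have hn := hp (by simp) (by simp) (hinj.ne hne)
    rcases h with h | h
    · exact hn h
    · exact hn (hR _ _ h)

/-- Each set of `n` polymers is listed by `n!` families. -/
lemma tupleSum_hardcore (hr : ∀ a, R a a) (hR : ∀ a b, R a b → R b a) (n : ℕ) :
    tupleSum z Λ n (fun δ => (hardcore R δ : ℝ)) / (n.factorial : ℝ)
      = ∑ X ∈ (Λ.powersetCard n).filter (fun X : Finset P => (X : Set P).Pairwise (fun a b => ¬ R a b)),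
          ∏ γ ∈ X, z γ := by
  have hn : (n.factorial : ℝ) ≠ 0 := by exact_mod_cast n.factorial_ne_zero
  rw [div_eq_iff hn, Finset.sum_mul]
  unfold tupleSum
  have h1 : ∀ δ : Fin n → P, (hardcore R δ : ℝ) * ∏ i, z (δ i) = if Function.Injective δ ∧
      ((Finset.univ.image δ : Finset P) : Set P).Pairwise (fun a b => ¬ R a b) then
        ∏ i, z (δ i) else 0 := by
    intro δ
    rw [hardcore_eq hr hR]
    split_ifs <;> simp
  simp only [h1]
  rw [← Finset.sum_filter, ← Finset.sum_fiberwise_of_maps_to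
    (t := (Λ.powersetCard n).filter (fun X : Finset P => (X : Set P).Pairwise (fun a b => ¬ R a b)))
    (g := fun δ : Fin n → P => Finset.univ.image δ)]
  · refine Finset.sum_congr rfl fun X hX => ?_
    rw [Finset.mem_filter, Finset.mem_powersetCard] at hX
    obtain ⟨⟨hXΛ, hXn⟩, hXp⟩ := hX
    have h2 : ∀ δ ∈ ((Fintype.piFinset (fun _ : Fin n => Λ)).filter (fun δ : Fin n → P =>
        Function.Injective δ ∧
        ((Finset.univ.image δ : Finset P) : Set P).Pairwise (fun a b => ¬ R a b))).filter
          (fun δ => Finset.univ.image δ = X), ∏ i, z (δ i) = ∏ γ ∈ X, z γ := by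
      intro δ hδ
      simp only [Finset.mem_filter] at hδ
      rw [← hδ.2, Finset.prod_image (fun i _ j _ h => hδ.1.2.1 h)]
    rw [Finset.sum_congr rfl h2, Finset.sum_const, nsmul_eq_mul, mul_comm]
    congr 2
    have e : Fin n ≃ X := (Fintype.equivFinOfCardEq (by simpa using hXn)).symm
    have hperm : (Finset.univ : Finset (Equiv.Perm (Fin n))).card = n.factorial := by
      rw [Finset.card_univ, Fintype.card_perm, Fintype.card_fin]
    rw [← hperm]
    symm
    refine Finset.card_bij (fun σ _ => fun i => (e (σ i) : P)) ?_ ?_ ?_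
    · intro σ _
      have himg : Finset.univ.image (fun i => (e (σ i) : P)) = X := by
        ext x
        simp only [Finset.mem_image, Finset.mem_univ, true_and]
        constructor
        · rintro ⟨i, rfl⟩
          exact (e (σ i)).2
        · intro hx
          exact ⟨σ.symm (e.symm ⟨x, hx⟩), by simp⟩
      simp only [Finset.mem_filter, Fintype.mem_piFinset]
      refine ⟨⟨fun i => hXΛ (e (σ i)).2, ?_, ?_⟩, himg⟩
      · intro i j hij
        exact σ.injective (e.injective (Subtype.ext hij))
      · rw [himg]; exact hXp
    · intro σ _ τ _ h
      ext i : 1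
      exact e.injective (Subtype.ext (congrFun h i))
    · intro δ hδ
      simp only [Finset.mem_filter] at hδ
      obtain ⟨⟨-, hinj, -⟩, himg⟩ := hδ
      have hmem : ∀ i, δ i ∈ X := fun i => himg ▸ Finset.mem_image_of_mem _ (Finset.mem_univ i)
      have hbij : Function.Bijective (fun i => e.symm ⟨δ i, hmem i⟩) := by
        rw [← Finite.injective_iff_bijective]
        intro i j hij
        exact hinj (congrArg Subtype.val (e.symm.injective hij))
      exact ⟨Equiv.ofBijective _ hbij, Finset.mem_univ _, by funext i; simp⟩
  · intro δ hδ
    simp only [Finset.mem_filter, Fintype.mem_piFinset, Finset.mem_powersetCard] at hδ ⊢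
    refine ⟨⟨?_, ?_⟩, hδ.2.2⟩
    · intro x hx
      obtain ⟨i, -, rfl⟩ := Finset.mem_image.1 hx
      exact hδ.1 i
    · rw [Finset.card_image_of_injective _ hδ.2.1]
      simp

/-- The logarithm of the partition function of a finite set of polymers. -/
theorem partition_eq_exp (hr : ∀ a, R a a) (hR : ∀ a b, R a b → R b a) (hz : ∀ γ ∈ Λ, 0 ≤ z γ)
    {a : P → ℝ}
    (hKP : ∀ γ ∈ Λ, ∑ γ' ∈ Λ.filter (R γ), z γ' * Real.exp (a γ') ≤ a γ) :
    ∑ X ∈ Λ.powerset.filter (fun X : Finset P => (X : Set P).Pairwise (fun a b => ¬ R a b)), ∏ γ ∈ X, z γ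
      = Real.exp (∑' n, tupleSum z Λ n (fun δ => (ursell R δ : ℝ)) / (n.factorial : ℝ)) := by
  set Z : ℕ → ℝ := fun n => tupleSum z Λ n (fun δ => (hardcore R δ : ℝ)) / (n.factorial : ℝ)
    with hZ
  set f : ℕ → ℝ := fun n => tupleSum z Λ n (fun δ => (ursell R δ : ℝ)) / (n.factorial : ℝ)
    with hf
  have hf0 : f 0 = 0 := by simp [hf, tupleSum, ursell_zero]
  have hsum : Summable fun n : ℕ => ((n : ℝ) + 1) * |f (n + 1)| := by
    refine summable_of_sum_range_le (c := ∑ γ ∈ Λ, z γ * Real.exp (a γ))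
      (fun n => by positivity) fun N => ?_
    calc ∑ k ∈ Finset.range N, ((k : ℝ) + 1) * |f (k + 1)|
        ≤ ∑ k ∈ Finset.range N, ∑ γ ∈ Λ,
              z γ * (tupleSum z Λ k (fun δ => |(rooted R γ δ : ℝ)|) / (k.factorial : ℝ)) := by
            refine Finset.sum_le_sum fun k _ => ?_
            have hkf : (0 : ℝ) < (k + 1).factorial := by exact_mod_cast (k + 1).factorial_pos
            have h := tupleSum_succ (z := z) (Λ := Λ) (0 : Fin (k + 1))
              (fun γ δ => |(rooted R γ δ : ℝ)|)
            simp only [← ursell_eq_rooted] at h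
            have h3 := (abs_tupleSum_le (Λ := Λ) (z := z)
              (fun δ : Fin (k + 1) → P => (ursell R δ : ℝ)) hz).trans (le_of_eq h)
            simp only [hf]
            rw [abs_div, abs_of_pos hkf, mul_div_assoc', div_le_iff₀ hkf]
            refine (mul_le_mul_of_nonneg_left h3 (by positivity)).trans (le_of_eq ?_)
            rw [Nat.factorial_succ, Nat.cast_mul, Nat.cast_succ, Finset.sum_mul, Finset.mul_sum]
            refine Finset.sum_congr rfl fun γ' _ => ?_
            have : (k.factorial : ℝ) ≠ 0 := by exact_mod_cast k.factorial_ne_zero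
            field_simp
      _ = ∑ γ ∈ Λ, z γ * ∑ k ∈ Finset.range N,
              tupleSum z Λ k (fun δ => |(rooted R γ δ : ℝ)|) / (k.factorial : ℝ) := by
            rw [Finset.sum_comm]
            simp only [Finset.mul_sum]
      _ ≤ _ := Finset.sum_le_sum fun γ hγ =>
            mul_le_mul_of_nonneg_left (sum_rooted_le hR hz hKP N γ hγ) (hz γ hγ)
  have hmain := sum_eq_exp_of_recursion (z := Z) (f := f) (by simp [hZ, tupleSum, hardcore, indep])
    Λ.card (fun n hn => by
      simp only [hZ]
      rw [tupleSum_hardcore hr hR, Finset.powersetCard_eq_empty.2 hn]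
      simp) hsum (fun n => recursion_of_factorial
        (a := fun k => tupleSum z Λ k (fun δ => (ursell R δ : ℝ)))
        (b := fun k => tupleSum z Λ k (fun δ => (hardcore R δ : ℝ)))
        (tupleSum_hardcore_succ n))
  have hsf : Summable f := by
    rw [← summable_nat_add_iff 1]
    refine Summable.of_norm (Summable.of_nonneg_of_le (fun n => norm_nonneg _) (fun n => ?_) hsum)
    have : (0 : ℝ) ≤ n := n.cast_nonneg
    rw [Real.norm_eq_abs]
    nlinarith [abs_nonneg (f (n + 1))]
  rw [hsf.tsum_eq_zero_add, hf0, zero_add, ← hmain, Finset.sum_filter,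
    Finset.sum_powerset]
  refine Finset.sum_congr rfl fun n _ => ?_
  simp only [hZ]
  rw [tupleSum_hardcore hr hR, Finset.sum_filter]

end Expansion

/-! ### Wells and the length of the wall under an excitation -/

section Wells

/-- The total variation of the heights `f A, …, f B`. -/
def variation (A B : ℤ) (f : ℤ → ℤ) : ℤ := ∑ i ∈ Finset.Ioc A B, |f i - f (i - 1)|

lemma sum_Ioc_split {A B s t : ℤ} (f : ℤ → ℤ) (hs : A < s) (hst : s < t) (ht : t ≤ B) :
    ∑ i ∈ Finset.Ioc A B, f i = ∑ i ∈ Finset.Ioc A (s - 1), f i + f s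
      + ∑ i ∈ Finset.Ioo s t, f i + f t + ∑ i ∈ Finset.Ioc t B, f i := by
  have h : Finset.Ioc A B = Finset.Ioc A (s - 1) ∪ ({s} ∪ (Finset.Ioo s t ∪ ({t} ∪
      Finset.Ioc t B))) := by
    ext i
    simp only [Finset.mem_Ioc, Finset.mem_union, Finset.mem_singleton, Finset.mem_Ioo]
    omega
  rw [h, Finset.sum_union, Finset.sum_union, Finset.sum_union, Finset.sum_union,
    Finset.sum_singleton, Finset.sum_singleton]
  · ring
  all_goals
    rw [Finset.disjoint_left]
    intro i
    simp only [Finset.mem_Ioc, Finset.mem_union, Finset.mem_singleton, Finset.mem_Ioo]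
    omega

lemma exists_run (Q : ℤ → Prop) {A B j : ℤ} (hA : A ≤ j) (hB : j ≤ B) (hj : Q j) (hQA : ¬ Q A)
    (hQB : ¬ Q B) : ∃ s t, A < s ∧ s ≤ j ∧ j < t ∧ t ≤ B ∧ (∀ i, s ≤ i → i < t → Q i) ∧
      ¬ Q (s - 1) ∧ ¬ Q t := by
  obtain ⟨u, ⟨hu1, hu2⟩, hu⟩ := Int.exists_greatest_of_bdd (P := fun u => u ≤ j ∧ ¬ Q u)
    ⟨j, fun z hz => hz.1⟩ ⟨A, hA, hQA⟩
  obtain ⟨t, ⟨ht1, ht2⟩, ht⟩ := Int.exists_least_of_bdd (P := fun u => j ≤ u ∧ ¬ Q u)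
    ⟨j, fun z hz => hz.1⟩ ⟨B, hB, hQB⟩
  have huj : u ≠ j := fun h => hu2 (h ▸ hj)
  have htj : t ≠ j := fun h => ht2 (h ▸ hj)
  have hAu := hu A ⟨hA, hQA⟩
  have htB := ht B ⟨hB, hQB⟩
  refine ⟨u + 1, t, by omega, by omega, by omega, htB, ?_, by simpa using hu2, ht2⟩
  intro i hi1 hi2
  by_contra hQ
  rcases le_total i j with h | h
  · have := hu i ⟨h, hQ⟩
    omega
  · have := ht i ⟨h, hQ⟩
    omega

variable {w : ℤ → ℤ}

/-- The wall gains at most `(ρ - 1)` in variation per column over any configuration above it. The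
highest plateau above the wall is either the lid of a well, which is taken off, or it can be lowered
by one unit without any gain in variation. -/
theorem variation_sub_le {ρ : ℝ} (hρ : 1 ≤ ρ)
    (hwell : ∀ z p q, IsWell w z p q → (wellLength w z p q : ℝ) ≤ ρ * ((q - p : ℤ) : ℝ))
    (A B : ℤ) (h : ℤ → ℤ) (hge : ∀ i, w i ≤ h i) (hout : ∀ i, i ≤ A ∨ B ≤ i → h i = w i) :
    (variation A B w : ℝ) - variation A B h
      ≤ (ρ - 1) * ((Finset.Ioo A B).filter (fun i => w i < h i)).card := by
  induction hn : (∑ i ∈ Finset.Ioo A B, (h i - w i)).toNat using Nat.strong_induction_on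
    generalizing h with
  | _ n ih =>
  set F := (Finset.Ioo A B).filter (fun i => w i < h i) with hF
  have memF : ∀ i, w i < h i → i ∈ F := by
    intro i hi
    rw [hF, Finset.mem_filter, Finset.mem_Ioo]
    refine ⟨⟨?_, ?_⟩, hi⟩
    · by_contra hc
      have := hout i (Or.inl (not_lt.1 hc))
      omega
    · by_contra hc
      have := hout i (Or.inr (not_lt.1 hc))
      omega
  rcases F.eq_empty_or_nonempty with hFe | hFne
  · have : h = w := by
      funext i
      by_contra hne
      have := memF i (lt_of_le_of_ne (hge i) (Ne.symm hne))
      rw [hFe] at this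
      simp at this
    rw [this, hFe]
    simp
  obtain ⟨j, hjF, hjmax⟩ := Finset.exists_max_image F h hFne
  have hjm := hjF
  rw [hF, Finset.mem_filter, Finset.mem_Ioo] at hjm
  obtain ⟨⟨hAj, hjB⟩, hjw⟩ := hjm
  set z := h j with hz
  have hQA : ¬ (h A = z ∧ w A < z) := by
    have := hout A (Or.inl le_rfl)
    omega
  have hQB : ¬ (h B = z ∧ w B < z) := by
    have := hout B (Or.inr le_rfl)
    omega
  obtain ⟨s, t, hAs, hsj, hjt, htB, hrun, hs1, ht1⟩ :=
    exists_run (fun i => h i = z ∧ w i < z) hAj.le hjB.le ⟨rfl, hjw⟩ hQA hQB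
  have hbd : ∀ i, ¬ (h i = z ∧ w i < z) → z ≤ w i ∨ h i ≤ z - 1 := by
    intro i hi
    have h1 := hge i
    by_cases hwi : w i < h i
    · have := hjmax i (memF i hwi)
      omega
    · omega
  have hrunF : ∀ i, s ≤ i → i < t → i ∈ F := fun i h1 h2 =>
    memF i (by have := hrun i h1 h2; omega)
  have hsum : ∀ h' : ℤ → ℤ, (∀ i, w i ≤ h' i) → (∀ i, h' i ≤ h i) → h' j < h j →
      (∑ i ∈ Finset.Ioo A B, (h' i - w i)).toNat < n := by
    intro h' h1 h2 h3
    have h4 : ∑ i ∈ Finset.Ioo A B, (h' i - w i) < ∑ i ∈ Finset.Ioo A B, (h i - w i) :=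
      Finset.sum_lt_sum (fun i _ => by have := h2 i; omega)
        ⟨j, Finset.mem_Ioo.2 ⟨hAj, hjB⟩, by omega⟩
    have h5 : 0 ≤ ∑ i ∈ Finset.Ioo A B, (h' i - w i) :=
      Finset.sum_nonneg fun i _ => by have := h1 i; omega
    omega
  have hs0 := hrun s le_rfl (by omega)
  have ht0 := hrun (t - 1) (by omega) (by omega)
  by_cases hW : z ≤ w (s - 1) ∧ z ≤ w t
  · -- the plateau closes a well
    set h' : ℤ → ℤ := fun i => if s ≤ i ∧ i < t then w i else h i with hh'
    have hin : ∀ i, s ≤ i → i < t → h' i = w i := fun i h1 h2 => if_pos ⟨h1, h2⟩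
    have hoff : ∀ i, i < s ∨ t ≤ i → h' i = h i := fun i h1 => if_neg (by omega)
    have hge' : ∀ i, w i ≤ h' i := fun i => by
      simp only [hh']; split_ifs; exacts [le_rfl, hge i]
    have hle' : ∀ i, h' i ≤ h i := fun i => by
      simp only [hh']; split_ifs; exacts [hge i, le_rfl]
    have key := ih _ (hsum h' hge' hle' (by rw [hin j hsj hjt]; exact hjw)) h' hge'
      (fun i hi => by rw [hoff i (by omega), hout i hi]) rfl
    have hwl := hwell z s t ⟨by omega, hW.1, fun i h1 h2 => (hrun i h1 h2).2, hW.2⟩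
    have hvar : variation A B h' - variation A B h = wellLength w z s t - (t - s) := by
      unfold variation wellLength
      rw [sum_Ioc_split _ hAs (by omega : s < t) htB, sum_Ioc_split _ hAs (by omega : s < t) htB]
      have e1 : ∑ i ∈ Finset.Ioc A (s - 1), |h' i - h' (i - 1)|
          = ∑ i ∈ Finset.Ioc A (s - 1), |h i - h (i - 1)| := by
        refine Finset.sum_congr rfl fun i hi => ?_
        rw [Finset.mem_Ioc] at hi
        rw [hoff i (by omega), hoff (i - 1) (by omega)]
      have e2 : ∑ i ∈ Finset.Ioc t B, |h' i - h' (i - 1)|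
          = ∑ i ∈ Finset.Ioc t B, |h i - h (i - 1)| := by
        refine Finset.sum_congr rfl fun i hi => ?_
        rw [Finset.mem_Ioc] at hi
        rw [hoff i (by omega), hoff (i - 1) (by omega)]
      have e3 : ∑ i ∈ Finset.Ioo s t, |h' i - h' (i - 1)|
          = ∑ i ∈ Finset.Ioo s t, |w i - w (i - 1)| := by
        refine Finset.sum_congr rfl fun i hi => ?_
        rw [Finset.mem_Ioo] at hi
        rw [hin i (by omega) (by omega), hin (i - 1) (by omega) (by omega)]
      have e4 : ∑ i ∈ Finset.Ioo s t, |h i - h (i - 1)| = 0 := by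
        refine Finset.sum_eq_zero fun i hi => ?_
        rw [Finset.mem_Ioo] at hi
        rw [(hrun i (by omega) (by omega)).1, (hrun (i - 1) (by omega) (by omega)).1]
        simp
      rw [e1, e2, e3, e4, hin s le_rfl (by omega), hin (t - 1) (by omega) (by omega),
        hoff (s - 1) (by omega), hoff t (by omega), hs0.1, ht0.1]
      have := hge (s - 1)
      have := hge t
      rw [abs_of_nonpos (by omega : w s - h (s - 1) ≤ 0), abs_of_nonneg (by omega : 0 ≤ h t - w (t - 1)),
        abs_of_nonpos (by omega : z - h (s - 1) ≤ 0), abs_of_nonneg (by omega : 0 ≤ h t - z)]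
      ring
    have hcard : (F.card : ℤ)
        = ((Finset.Ioo A B).filter (fun i => w i < h' i)).card + (t - s) := by
      have : F = (Finset.Ioo A B).filter (fun i => w i < h' i) ∪ Finset.Ico s t := by
        ext i
        by_cases hi : s ≤ i ∧ i < t
        · exact ⟨fun _ => Finset.mem_union_right _ (Finset.mem_Ico.2 hi),
            fun _ => hrunF i hi.1 hi.2⟩
        · have h1 : i ∈ F ↔ i ∈ (Finset.Ioo A B).filter (fun i => w i < h' i) := by
            rw [hF, Finset.mem_filter, Finset.mem_filter, hoff i (by omega)]
          rw [Finset.mem_union, h1, Finset.mem_Ico]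
          simp only [hi, or_false]
      rw [this, Finset.card_union_of_disjoint, Int.card_Ico]
      · push_cast
        rw [Int.toNat_of_nonneg (by omega)]
      · rw [Finset.disjoint_left]
        intro i hi hi'
        rw [Finset.mem_Ico] at hi'
        rw [Finset.mem_filter, hin i hi'.1 hi'.2] at hi
        exact lt_irrefl _ hi.2
    have hcard' : (F.card : ℝ)
        = ((Finset.Ioo A B).filter (fun i => w i < h' i)).card + ((t - s : ℤ) : ℝ) := by
      exact_mod_cast hcard
    have hvar' : (variation A B h' : ℝ) - variation A B h
        = wellLength w z s t - ((t - s : ℤ) : ℝ) := by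
      exact_mod_cast hvar
    rw [hcard']
    linarith
  · -- an end of the plateau belongs to the configuration
    set h' : ℤ → ℤ := fun i => if s ≤ i ∧ i < t then z - 1 else h i with hh'
    have hin : ∀ i, s ≤ i → i < t → h' i = z - 1 := fun i h1 h2 => if_pos ⟨h1, h2⟩
    have hoff : ∀ i, i < s ∨ t ≤ i → h' i = h i := fun i h1 => if_neg (by omega)
    have hge' : ∀ i, w i ≤ h' i := fun i => by
      by_cases hi : s ≤ i ∧ i < t
      · rw [hin i hi.1 hi.2]
        have := hrun i hi.1 hi.2
        omega
      · rw [hoff i (by omega)]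
        exact hge i
    have hle' : ∀ i, h' i ≤ h i := fun i => by
      by_cases hi : s ≤ i ∧ i < t
      · rw [hin i hi.1 hi.2]
        have := hrun i hi.1 hi.2
        omega
      · rw [hoff i (by omega)]
    have key := ih _ (hsum h' hge' hle' (by rw [hin j hsj hjt]; omega)) h' hge'
      (fun i hi => by rw [hoff i (by omega), hout i hi]) rfl
    have hvar : variation A B h' ≤ variation A B h := by
      unfold variation
      rw [sum_Ioc_split _ hAs (by omega : s < t) htB, sum_Ioc_split _ hAs (by omega : s < t) htB]
      have e1 : ∑ i ∈ Finset.Ioc A (s - 1), |h' i - h' (i - 1)|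
          = ∑ i ∈ Finset.Ioc A (s - 1), |h i - h (i - 1)| := by
        refine Finset.sum_congr rfl fun i hi => ?_
        rw [Finset.mem_Ioc] at hi
        rw [hoff i (by omega), hoff (i - 1) (by omega)]
      have e2 : ∑ i ∈ Finset.Ioc t B, |h' i - h' (i - 1)|
          = ∑ i ∈ Finset.Ioc t B, |h i - h (i - 1)| := by
        refine Finset.sum_congr rfl fun i hi => ?_
        rw [Finset.mem_Ioc] at hi
        rw [hoff i (by omega), hoff (i - 1) (by omega)]
      have e3 : ∑ i ∈ Finset.Ioo s t, |h' i - h' (i - 1)|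
          = ∑ i ∈ Finset.Ioo s t, |h i - h (i - 1)| := by
        refine Finset.sum_congr rfl fun i hi => ?_
        rw [Finset.mem_Ioo] at hi
        rw [hin i (by omega) (by omega), hin (i - 1) (by omega) (by omega),
          (hrun i (by omega) (by omega)).1, (hrun (i - 1) (by omega) (by omega)).1]
        simp
      rw [e1, e2, e3, hin s le_rfl (by omega), hin (t - 1) (by omega) (by omega),
        hoff (s - 1) (by omega), hoff t (by omega), hs0.1, ht0.1]
      have hend : h (s - 1) ≤ z - 1 ∨ h t ≤ z - 1 := by
        have := hbd (s - 1) hs1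
        have := hbd t ht1
        omega
      have a1 : |z - 1 - h (s - 1)| + |h t - (z - 1)| ≤ |z - h (s - 1)| + |h t - z| := by
        rcases abs_cases (z - 1 - h (s - 1)) with ⟨c1, -⟩ | ⟨c1, -⟩ <;>
        rcases abs_cases (h t - (z - 1)) with ⟨c2, -⟩ | ⟨c2, -⟩ <;>
        rcases abs_cases (z - h (s - 1)) with ⟨c3, _⟩ | ⟨c3, _⟩ <;>
        rcases abs_cases (h t - z) with ⟨c4, _⟩ | ⟨c4, _⟩ <;>
        omega
      linarith
    have hcard : (((Finset.Ioo A B).filter (fun i => w i < h' i)).card : ℝ) ≤ F.card := by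
      have : (Finset.Ioo A B).filter (fun i => w i < h' i) ⊆ F := by
        intro i hi
        exact memF i ((Finset.mem_filter.1 hi).2.trans_le (hle' i))
      exact_mod_cast Finset.card_le_card this
    have hvar' : (variation A B h' : ℝ) ≤ variation A B h := by exact_mod_cast hvar
    have := mul_le_mul_of_nonneg_left hcard (by linarith : 0 ≤ ρ - 1)
    linarith

lemma exists_abs_le_of_periodic {a : ℕ} (ha : 0 < a) (hw : ∀ i : ℤ, w (i + (a : ℤ)) = w i) :
    ∃ M : ℤ, ∀ i, |w i| ≤ M := by
  refine ⟨∑ j ∈ Finset.range a, |w (j : ℤ)|, fun i => ?_⟩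
  have ha' : (0 : ℤ) < a := by exact_mod_cast ha
  have hper : Function.Periodic w (a : ℤ) := hw
  have h1 : w i = w (i % a) := by
    have h2 := hper.int_mul (i / a) (i % a)
    rw [← h2]
    congr 1
    have := Int.emod_add_mul_ediv i a
    push_cast
    linarith
  have h3 : i % a = (((i % a).toNat : ℕ) : ℤ) := (Int.toNat_of_nonneg (Int.emod_nonneg _ ha'.ne')).symm
  rw [h1, h3]
  refine Finset.single_le_sum (f := fun j : ℕ => |w (j : ℤ)|) (fun j _ => abs_nonneg _) ?_
  rw [Finset.mem_range]
  have := Int.emod_lt_of_pos i ha'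
  have := Int.emod_nonneg i ha'.ne'
  omega

lemma le_wellLength {z p q : ℤ} (h : IsWell w z p q) : q - p ≤ wellLength w z p q := by
  obtain ⟨hpq, -, hlow, -⟩ := h
  have h1 := hlow p le_rfl hpq
  have h2 := hlow (q - 1) (by omega) (by omega)
  have h3 : 0 ≤ ∑ i ∈ Finset.Ioo p q, |w i - w (i - 1)| := Finset.sum_nonneg fun i _ => abs_nonneg _
  unfold wellLength
  omega

lemma bddAbove_wellRatios {M : ℤ} (hM : ∀ i, |w i| ≤ M) : BddAbove (wellRatios w) := by
  refine ⟨((1 + 6 * M : ℤ) : ℝ), ?_⟩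
  rintro x ⟨z, p, q, ⟨hpq, h1, h2, h3⟩, rfl⟩
  have hpos : (0 : ℝ) < ((q - p : ℤ) : ℝ) := by exact_mod_cast (by omega : 0 < q - p)
  rw [div_le_iff₀ hpos]
  have e : ∀ i, -M ≤ w i ∧ w i ≤ M := fun i => abs_le.1 (hM i)
  have e1 := e p
  have e2 := e q
  have e3 := e (q - 1)
  have hM0 : 0 ≤ M := (abs_nonneg _).trans (hM 0)
  have hs : ∑ i ∈ Finset.Ioo p q, |w i - w (i - 1)| ≤ (q - p) * (2 * M) := by
    refine (Finset.sum_le_card_nsmul _ _ (2 * M) fun i _ => ?_).trans ?_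
    · have := e i
      have := e (i - 1)
      rw [abs_le]
      constructor <;> omega
    · rw [nsmul_eq_mul, Int.card_Ioo]
      refine mul_le_mul_of_nonneg_right ?_ (by omega)
      have : ((q - p - 1).toNat : ℤ) = q - p - 1 := Int.toNat_of_nonneg (by omega)
      omega
  have : wellLength w z p q ≤ (1 + 6 * M) * (q - p) := by
    unfold wellLength
    nlinarith
  exact_mod_cast this

lemma wellLength_le_rho {M : ℤ} (hM : ∀ i, |w i| ≤ M) {z p q : ℤ} (h : IsWell w z p q) :
    (wellLength w z p q : ℝ) ≤ rho w * ((q - p : ℤ) : ℝ) := by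
  have hmem : (wellLength w z p q : ℝ) / ((q - p : ℤ) : ℝ) ∈ wellRatios w := ⟨z, p, q, h, rfl⟩
  have hpos : (0 : ℝ) < ((q - p : ℤ) : ℝ) := by exact_mod_cast (by have := h.1; omega : 0 < q - p)
  rw [← div_le_iff₀ hpos, rho, if_pos ⟨_, hmem⟩]
  exact le_csSup (bddAbove_wellRatios hM) hmem

lemma one_le_rho {M : ℤ} (hM : ∀ i, |w i| ≤ M) : 1 ≤ rho w := by
  unfold rho
  split_ifs with h
  · obtain ⟨x, hx⟩ := h
    refine le_trans ?_ (le_csSup (bddAbove_wellRatios hM) hx)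
    obtain ⟨z, p, q, hwell, rfl⟩ := hx
    have hpos : (0 : ℝ) < ((q - p : ℤ) : ℝ) := by
      exact_mod_cast (by have := hwell.1; omega : 0 < q - p)
    rw [one_le_div hpos]
    exact_mod_cast le_wellLength hwell
  · exact le_rfl

end Wells

/-! ### Connected sets of bonds -/

section Connectedness

/-- The points `x` and `y` of the lattice are joined by a path of bonds of `S`. -/
def Joined (S : Set Bond) : ℤ × ℤ → ℤ × ℤ → Prop :=
  Relation.ReflTransGen fun x y => ∃ b ∈ S, x ∈ b.ends ∧ y ∈ b.ends

/-- The set `S` of bonds draws a nonempty connected subset of the plane. -/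
def IsConn (S : Set Bond) : Prop :=
  S.Nonempty ∧ ∀ b ∈ S, ∀ c ∈ S, ∀ x ∈ b.ends, ∀ y ∈ c.ends, Joined S x y

/-- The set `δ` of bonds is a connected component of `S`. -/
def IsComp (S δ : Set Bond) : Prop :=
  δ ⊆ S ∧ IsConn δ ∧ ∀ b ∈ δ, ∀ c ∈ S, b.Meets c → c ∈ δ

variable {S T δ δ' : Set Bond} {x y : ℤ × ℤ} {b c : Bond}

lemma Joined.symm (h : Joined S x y) : Joined S y x := by
  induction h with
  | refl => exact Relation.ReflTransGen.refl
  | tail _ hbc ih =>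
    obtain ⟨b, hb, h1, h2⟩ := hbc
    exact Relation.ReflTransGen.head ⟨b, hb, h2, h1⟩ ih

lemma Joined.mono (hST : S ⊆ T) (h : Joined S x y) : Joined T x y :=
  Relation.ReflTransGen.mono (fun _ _ ⟨b, hb, h⟩ => ⟨b, hST hb, h⟩) _ _ h

lemma Joined.of_mem (hb : b ∈ S) (hx : x ∈ b.ends) (hy : y ∈ b.ends) : Joined S x y :=
  Relation.ReflTransGen.single ⟨b, hb, hx, hy⟩

lemma Bond.ends_nonempty (b : Bond) : b.ends.Nonempty := by
  cases b <;> simp [Bond.ends]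

lemma Bond.Meets.refl (b : Bond) : b.Meets b := by
  simpa [Bond.Meets] using b.ends_nonempty

lemma Bond.Meets.symm (h : b.Meets c) : c.Meets b := by
  unfold Bond.Meets at *
  rwa [Set.inter_comm]

lemma induce_connected_iff : (bondGraph.induce S).Connected ↔ IsConn S := by
  constructor
  · intro h
    have hne : S.Nonempty := Set.nonempty_coe_sort.1 h.nonempty
    refine ⟨hne, fun b hb c hc => ?_⟩
    have hr : (bondGraph.induce S).Reachable ⟨b, hb⟩ ⟨c, hc⟩ := h.preconnected _ _
    rw [SimpleGraph.reachable_iff_reflTransGen] at hr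
    have key : ∀ d : S, Relation.ReflTransGen (bondGraph.induce S).Adj ⟨b, hb⟩ d →
        ∀ x ∈ b.ends, ∀ y ∈ d.1.ends, Joined S x y := by
      intro d hd
      induction hd with
      | refl => exact fun x hx y hy => Joined.of_mem hb hx hy
      | @tail d e _ hde ih =>
        intro x hx y hy
        obtain ⟨p, hp1, hp2⟩ := hde.2
        exact (ih x hx p hp1).trans (Joined.of_mem e.2 hp2 hy)
    exact key _ hr
  · rintro ⟨hne, h⟩
    have key : ∀ b (hb : b ∈ S) x y, x ∈ b.ends → Joined S x y → ∀ c (hc : c ∈ S), y ∈ c.ends →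
        (bondGraph.induce S).Reachable ⟨b, hb⟩ ⟨c, hc⟩ := by
      intro b hb x y hx hxy
      have meets : ∀ d (hd : d ∈ S) c (hc : c ∈ S), d.Meets c →
          (bondGraph.induce S).Reachable ⟨d, hd⟩ ⟨c, hc⟩ := by
        intro d hd c hc hm
        by_cases hdc : d = c
        · subst hdc
          exact SimpleGraph.Reachable.refl _
        · exact SimpleGraph.Adj.reachable ⟨hdc, hm⟩
      induction hxy with
      | refl => exact fun c hc hy => meets b hb c hc ⟨x, hx, hy⟩
      | tail _ hyz ih =>
        intro c hc hz
        obtain ⟨d, hd, h1, h2⟩ := hyz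
        exact (ih d hd h1).trans (meets d hd c hc ⟨_, h2, hz⟩)
    have : Nonempty S := hne.to_subtype
    refine ⟨fun b c => ?_⟩
    obtain ⟨x, hx⟩ := b.1.ends_nonempty
    obtain ⟨y, hy⟩ := c.1.ends_nonempty
    exact key b.1 b.2 x y hx (h b.1 b.2 c.1 c.2 x hx y hy) c.1 c.2 hy

lemma IsComp.mem_of_joined (hδ : IsComp S δ) (hb : b ∈ δ) (hx : x ∈ b.ends) (hxy : Joined S x y)
    (hc : c ∈ S) (hy : y ∈ c.ends) : c ∈ δ := by
  induction hxy generalizing c with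
  | refl => exact hδ.2.2 b hb c hc ⟨x, hx, hy⟩
  | tail _ hyz ih =>
    obtain ⟨d, hd, h1, h2⟩ := hyz
    exact hδ.2.2 d (ih hd h1) c hc ⟨_, h2, hy⟩

lemma IsComp.subset_of_meets (hδ : IsComp S δ) (hδ' : IsComp S δ') (hb : b ∈ δ) (hc : c ∈ δ')
    (hm : b.Meets c) : δ' ⊆ δ := by
  intro d hd
  obtain ⟨p, hp1, hp2⟩ := hm
  obtain ⟨y, hy⟩ := d.ends_nonempty
  exact hδ.mem_of_joined hb hp1 ((hδ'.2.1.2 c hc d hd p hp2 y hy).mono hδ'.1) (hδ'.1 hd) hy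

lemma IsComp.eq_of_meets (hδ : IsComp S δ) (hδ' : IsComp S δ') (hb : b ∈ δ) (hc : c ∈ δ')
    (hm : b.Meets c) : δ = δ' :=
  (hδ'.subset_of_meets hδ hc hb hm.symm).antisymm (hδ.subset_of_meets hδ' hb hc hm)

lemma exists_isComp (hb : b ∈ S) : ∃ δ, IsComp S δ ∧ b ∈ δ := by
  obtain ⟨x, hx⟩ := b.ends_nonempty
  set δ : Set Bond := {c | c ∈ S ∧ ∃ y ∈ c.ends, Joined S x y} with hδ
  have hin : ∀ y, Joined S x y → Joined δ x y := by
    intro y hy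
    induction hy with
    | refl => exact Relation.ReflTransGen.refl
    | tail hxy hyz ih =>
      obtain ⟨d, hd, h1, h2⟩ := hyz
      exact Relation.ReflTransGen.tail ih ⟨d, ⟨hd, _, h1, hxy⟩, h1, h2⟩
  have hall : ∀ c ∈ δ, ∀ y ∈ c.ends, Joined δ x y := by
    intro c hc y hy
    obtain ⟨hcS, z, hz, hxz⟩ := hc
    exact (hin z hxz).trans (Joined.of_mem ⟨hcS, z, hz, hxz⟩ hz hy)
  have hbδ : b ∈ δ := ⟨hb, x, hx, Relation.ReflTransGen.refl⟩
  refine ⟨δ, ⟨fun c hc => hc.1, ⟨⟨b, hbδ⟩, ?_⟩, ?_⟩, hbδ⟩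
  · intro c hc d hd y hy z hz
    exact (hall c hc y hy).symm.trans (hall d hd z hz)
  · rintro c ⟨hc, y, hy, hxy⟩ d hd ⟨p, hp1, hp2⟩
    exact ⟨hd, p, hp2, hxy.trans (Joined.of_mem hc hy hp1)⟩

lemma maximal_iff_isComp :
    Maximal (fun s : Set Bond => s ⊆ S ∧ (bondGraph.induce s).Connected) δ ↔ IsComp S δ := by
  simp only [induce_connected_iff]
  constructor
  · intro h
    obtain ⟨b, hb⟩ := h.prop.2.1
    obtain ⟨δ', hδ', hbδ'⟩ := exists_isComp (h.prop.1 hb)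
    have hsub : δ ⊆ δ' := by
      intro d hd
      obtain ⟨x, hx⟩ := b.ends_nonempty
      obtain ⟨y, hy⟩ := d.ends_nonempty
      exact hδ'.mem_of_joined hbδ' hx ((h.prop.2.2 b hb d hd x hx y hy).mono h.prop.1)
        (h.prop.1 hd) hy
    have heq : δ = δ' := h.eq_of_subset ⟨hδ'.1, hδ'.2.1⟩ hsub
    rwa [heq]
  · intro h
    refine ⟨⟨h.1, h.2.1⟩, ?_⟩
    rintro t ⟨htS, htc⟩ hδt d hd
    obtain ⟨b, hb⟩ := h.2.1.1
    obtain ⟨x, hx⟩ := b.ends_nonempty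
    obtain ⟨y, hy⟩ := d.ends_nonempty
    exact h.mem_of_joined hb hx ((htc.2 b (hδt hb) d hd x hx y hy).mono htS) (htS hd) hy

end Connectedness

/-! ### The symmetric difference of the wall and of a configuration -/

section LineDiff

variable {w h h' : ℤ → ℤ}

/-- The bonds that belong to exactly one of the lines of `h` and of `w`. -/
def lineDiff (w h : ℤ → ℤ) : Set Bond := (line h ∪ line w) \ (line h ∩ line w)

/-- The unit square over `[i, i + 1]` with bottom height `y` lies between the lines. -/
def Cell (w h : ℤ → ℤ) (i y : ℤ) : Prop := w i ≤ y ∧ y < h i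

/-- The set of bonds has a horizontal bond over `[i, i + 1]`. -/
def InCols (δ : Set Bond) (i : ℤ) : Prop := ∃ y, Bond.horiz i y ∈ δ

lemma horiz_mem_line {i y : ℤ} : Bond.horiz i y ∈ line h ↔ y = h i := by
  simp only [line, column, Set.mem_ofPred_eq, Finset.mem_insert, Finset.mem_image, Bond.horiz.injEq,
    reduceCtorEq, and_false, exists_false, or_false]
  constructor
  · rintro ⟨j, rfl, rfl⟩
    rfl
  · rintro rfl
    exact ⟨i, rfl, rfl⟩

lemma vert_mem_line {i y : ℤ} :
    Bond.vert i y ∈ line h ↔ min (h (i - 1)) (h i) ≤ y ∧ y < max (h (i - 1)) (h i) := by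
  simp only [line, column, Set.mem_ofPred_eq, Finset.mem_insert, Finset.mem_image, Bond.vert.injEq,
    reduceCtorEq, false_or, Finset.mem_Ico]
  constructor
  · rintro ⟨j, y, hy, rfl, rfl⟩
    simpa using hy
  · intro hy
    exact ⟨i - 1, y, by simpa using hy, by ring, rfl⟩

lemma horiz_mem_lineDiff (hge : ∀ i, w i ≤ h i) {i y : ℤ} :
    Bond.horiz i y ∈ lineDiff w h ↔ w i < h i ∧ (y = w i ∨ y = h i) := by
  simp only [lineDiff, Set.mem_sdiff, Set.mem_union, Set.mem_inter_iff, horiz_mem_line]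
  have := hge i
  omega

lemma vert_mem_lineDiff (hge : ∀ i, w i ≤ h i) {i y : ℤ} :
    Bond.vert i y ∈ lineDiff w h ↔ ¬ (Cell w h (i - 1) y ↔ Cell w h i y) := by
  simp only [lineDiff, Set.mem_sdiff, Set.mem_union, Set.mem_inter_iff, vert_mem_line, Cell]
  have := hge i
  have := hge (i - 1)
  omega

lemma inCols_lineDiff (hge : ∀ i, w i ≤ h i) {i : ℤ} :
    InCols (lineDiff w h) i ↔ w i < h i := by
  simp only [InCols, horiz_mem_lineDiff hge]
  exact ⟨fun ⟨_, h, _⟩ => h, fun h => ⟨w i, h, Or.inl rfl⟩⟩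

lemma lineDiff_injective (hge : ∀ i, w i ≤ h i) (hge' : ∀ i, w i ≤ h' i)
    (he : lineDiff w h = lineDiff w h') : h = h' := by
  funext i
  have h1 := hge i
  have h2 := hge' i
  have h3 : ∀ y, (w i < h i ∧ (y = w i ∨ y = h i)) ↔ (w i < h' i ∧ (y = w i ∨ y = h' i)) := by
    intro y
    rw [← horiz_mem_lineDiff hge, ← horiz_mem_lineDiff hge', he]
  have h4 := h3 (h i)
  have h5 := h3 (h' i)
  omega

lemma Joined.vert {S : Set Bond} {i y₁ y₂ : ℤ} (hy : y₁ ≤ y₂)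
    (hS : ∀ y, y₁ ≤ y → y < y₂ → Bond.vert i y ∈ S) : Joined S (i, y₁) (i, y₂) := by
  induction y₂, hy using Int.leInduction with
  | base => exact Relation.ReflTransGen.refl
  | succ y hy ih =>
    refine (ih fun y' h1 h2 => hS y' h1 (by omega)).trans ?_
    exact Joined.of_mem (hS y hy (by omega)) (by simp [Bond.ends]) (by simp [Bond.ends])

lemma Joined.horiz {S : Set Bond} {i y : ℤ} (hS : Bond.horiz i y ∈ S) :
    Joined S (i, y) (i + 1, y) :=
  Joined.of_mem hS (by simp [Bond.ends]) (by simp [Bond.ends])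

/-- The tops of adjacent columns with a common side are joined, and so are their bottoms. -/
lemma joined_of_common_side (hge : ∀ i, w i ≤ h i) {i j y : ℤ} (hj : j = i + 1)
    (h1 : Cell w h i y) (h2 : Cell w h j y) :
    Joined (lineDiff w h) (j, h i) (j, h j) ∧ Joined (lineDiff w h) (j, w i) (j, w j) := by
  have hi : j - 1 = i := by omega
  unfold Cell at h1 h2
  constructor
  · rcases le_total (h i) (h j) with hl | hl
    · refine Joined.vert hl fun y' _ _ => ?_
      rw [vert_mem_lineDiff hge, hi]
      unfold Cell
      omega
    · refine (Joined.vert hl fun y' _ _ => ?_).symm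
      rw [vert_mem_lineDiff hge, hi]
      unfold Cell
      omega
  · rcases le_total (w i) (w j) with hl | hl
    · refine Joined.vert hl fun y' _ _ => ?_
      rw [vert_mem_lineDiff hge, hi]
      unfold Cell
      omega
    · refine (Joined.vert hl fun y' _ _ => ?_).symm
      rw [vert_mem_lineDiff hge, hi]
      unfold Cell
      omega

lemma exists_bound_of_finite (hfin : {i | h i ≠ w i}.Finite) :
    ∃ A B : ℤ, A ≤ B ∧ ∀ i, i ≤ A ∨ B ≤ i → h i = w i := by
  obtain ⟨B, hB⟩ := hfin.bddAbove
  obtain ⟨A, hA⟩ := hfin.bddBelow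
  refine ⟨min (A - 1) B, B + 1, by omega, fun i hi => ?_⟩
  by_contra hne
  have h1 := hB hne
  have h2 := hA hne
  omega

/-- The bottom and the top of a column are joined: go right as long as the adjacent columns have a
common side, and take the side of the last one. -/
lemma joined_bottom_top (hge : ∀ i, w i ≤ h i) (hfin : {i | h i ≠ w i}.Finite) {i : ℤ}
    (hi : w i < h i) : Joined (lineDiff w h) (i, w i) (i, h i) ∧
      Joined (lineDiff w h) (i + 1, w i) (i + 1, h i) := by
  obtain ⟨A, B, -, hB⟩ := exists_bound_of_finite hfin
  induction hn : (B - i).toNat generalizing i with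
  | zero =>
    have := hB i (by omega)
    omega
  | succ n ih =>
    have hbot : Joined (lineDiff w h) (i, w i) (i + 1, w i) :=
      Joined.horiz ((horiz_mem_lineDiff hge).2 ⟨hi, Or.inl rfl⟩)
    have htop : Joined (lineDiff w h) (i, h i) (i + 1, h i) :=
      Joined.horiz ((horiz_mem_lineDiff hge).2 ⟨hi, Or.inr rfl⟩)
    have hright : Joined (lineDiff w h) (i + 1, w i) (i + 1, h i) := by
      by_cases hc : ∃ y, Cell w h i y ∧ Cell w h (i + 1) y
      · obtain ⟨y, h1, h2⟩ := hc
        obtain ⟨h3, h4⟩ := joined_of_common_side hge rfl h1 h2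
        have h5 := ih (i := i + 1) (by unfold Cell at h2; omega) (by omega)
        exact h4.trans (h5.1.trans h3.symm)
      · push Not at hc
        refine Joined.vert hi.le fun y h1 h2 => ?_
        rw [vert_mem_lineDiff hge, show i + 1 - 1 = i by omega]
        intro hiff
        exact hc y ⟨h1, h2⟩ (hiff.1 ⟨h1, h2⟩)
    exact ⟨hbot.trans (hright.trans htop.symm), hright⟩

/-- The vertical bonds on the side of a column are joined with its top. -/
lemma joined_side_top (hge : ∀ i, w i ≤ h i) (hfin : {i | h i ≠ w i}.Finite) {i j k y : ℤ}
    (hjk : (j = i - 1 ∧ k = i) ∨ (j = i ∧ k = i - 1)) (h1 : Cell w h j y) (h2 : ¬ Cell w h k y) :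
    Joined (lineDiff w h) (i, y) (i, h j) := by
  have hcell : ∀ y', Cell w h j y' → ¬ Cell w h k y' → Bond.vert i y' ∈ lineDiff w h := by
    intro y' h3 h4
    rw [vert_mem_lineDiff hge]
    rcases hjk with ⟨rfl, rfl⟩ | ⟨rfl, rfl⟩ <;> tauto
  by_cases hc : ∃ y', y ≤ y' ∧ y' < h j ∧ Cell w h k y'
  · obtain ⟨y', hy1, hy2, hy3⟩ := hc
    have hk : y < w k ∧ w k < h k ∧ w k < h j ∧ w j < h j ∧ w j ≤ w k := by
      unfold Cell at *; omega
    have e1 : Joined (lineDiff w h) (i, y) (i, w k) := by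
      refine Joined.vert hk.1.le fun y'' h3 h4 => hcell y'' ?_ ?_ <;> unfold Cell at * <;> omega
    have e2 : Joined (lineDiff w h) (i, w k) (i, w j) := by
      rcases hjk with ⟨hj, hk'⟩ | ⟨hj, hk'⟩
      · have := (joined_of_common_side hge (i := j) (j := k) (y := w k) (by omega)
          (by unfold Cell; omega) (by unfold Cell; omega)).2.symm
        rwa [hk'] at this ⊢
      · have := (joined_of_common_side hge (i := k) (j := j) (y := w k) (by omega)
          (by unfold Cell; omega) (by unfold Cell; omega)).2
        rwa [hj] at this ⊢
    have e3 : Joined (lineDiff w h) (i, w j) (i, h j) := by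
      rcases hjk with ⟨hj, -⟩ | ⟨hj, -⟩
      · have := (joined_bottom_top hge hfin (i := j) (by omega)).2
        rwa [show j + 1 = i by omega] at this
      · have := (joined_bottom_top hge hfin (i := j) (by omega)).1
        rwa [hj] at this ⊢
    exact e1.trans (e2.trans e3)
  · push Not at hc
    refine Joined.vert h1.2.le fun y' h3 h4 => hcell y' ?_ (hc y' h3 h4)
    unfold Cell at *
    omega

lemma mem_ends_horiz {i y x₁ x₂ : ℤ} :
    ((x₁, x₂) : ℤ × ℤ) ∈ (Bond.horiz i y).ends ↔ (x₁ = i ∨ x₁ = i + 1) ∧ x₂ = y := by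
  simp only [Bond.ends, Set.mem_insert_iff, Set.mem_singleton_iff, Prod.mk.injEq]
  omega

lemma mem_ends_vert {i y x₁ x₂ : ℤ} :
    ((x₁, x₂) : ℤ × ℤ) ∈ (Bond.vert i y).ends ↔ x₁ = i ∧ (x₂ = y ∨ x₂ = y + 1) := by
  simp only [Bond.ends, Set.mem_insert_iff, Set.mem_singleton_iff, Prod.mk.injEq]
  omega

section Component

variable {δ : Set Bond}

lemma IsComp.horiz_mem (hge : ∀ i, w i ≤ h i) (hfin : {i | h i ≠ w i}.Finite)
    (hδ : IsComp (lineDiff w h) δ) {i : ℤ} (hi : InCols δ i) :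
    w i < h i ∧ Bond.horiz i (w i) ∈ δ ∧ Bond.horiz i (h i) ∈ δ := by
  obtain ⟨y, hy⟩ := hi
  obtain ⟨hlt, hyy⟩ := (horiz_mem_lineDiff hge).1 (hδ.1 hy)
  have hj := (joined_bottom_top hge hfin hlt).1
  have hw : Bond.horiz i (w i) ∈ lineDiff w h := (horiz_mem_lineDiff hge).2 ⟨hlt, Or.inl rfl⟩
  have hh : Bond.horiz i (h i) ∈ lineDiff w h := (horiz_mem_lineDiff hge).2 ⟨hlt, Or.inr rfl⟩
  have hends : ∀ y, ((i, y) : ℤ × ℤ) ∈ (Bond.horiz i y).ends := fun y => by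
    rw [mem_ends_horiz]; simp
  refine ⟨hlt, ?_⟩
  rcases hyy with rfl | rfl
  · exact ⟨hy, hδ.mem_of_joined hy (hends _) hj hh (hends _)⟩
  · exact ⟨hδ.mem_of_joined hy (hends _) hj.symm hw (hends _), hy⟩

lemma IsComp.vert_mem_iff (hge : ∀ i, w i ≤ h i) (hfin : {i | h i ≠ w i}.Finite)
    (hδ : IsComp (lineDiff w h) δ) {i j k y : ℤ}
    (hjk : (j = i - 1 ∧ k = i) ∨ (j = i ∧ k = i - 1)) (h1 : Cell w h j y) (h2 : ¬ Cell w h k y) :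
    Bond.vert i y ∈ δ ↔ InCols δ j := by
  have hj := joined_side_top hge hfin hjk h1 h2
  have hlt : w j < h j := by unfold Cell at h1; omega
  have hh : Bond.horiz j (h j) ∈ lineDiff w h := (horiz_mem_lineDiff hge).2 ⟨hlt, Or.inr rfl⟩
  have hv : Bond.vert i y ∈ lineDiff w h := by
    rw [vert_mem_lineDiff hge]
    rcases hjk with ⟨rfl, rfl⟩ | ⟨rfl, rfl⟩ <;> tauto
  have e1 : ((i, y) : ℤ × ℤ) ∈ (Bond.vert i y).ends := by rw [mem_ends_vert]; simp
  have e2 : ((i, h j) : ℤ × ℤ) ∈ (Bond.horiz j (h j)).ends := by rw [mem_ends_horiz]; omega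
  constructor
  · intro hmem
    exact ⟨h j, hδ.mem_of_joined hmem e1 hj hh e2⟩
  · intro hc
    exact hδ.mem_of_joined (hδ.horiz_mem hge hfin hc).2.2 e2 hj.symm hv e1

lemma IsComp.inCols_iff (hge : ∀ i, w i ≤ h i) (hfin : {i | h i ≠ w i}.Finite)
    (hδ : IsComp (lineDiff w h) δ) {i y : ℤ} (h1 : Cell w h (i - 1) y) (h2 : Cell w h i y) :
    InCols δ (i - 1) ↔ InCols δ i := by
  have hj := (joined_of_common_side hge (i := i - 1) (j := i) (by omega) h1 h2).1
  have e1 : ((i, h i) : ℤ × ℤ) ∈ (Bond.horiz i (h i)).ends := by rw [mem_ends_horiz]; omega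
  have e2 : ((i, h (i - 1)) : ℤ × ℤ) ∈ (Bond.horiz (i - 1) (h (i - 1))).ends := by
    rw [mem_ends_horiz]; omega
  have m1 : Bond.horiz i (h i) ∈ lineDiff w h :=
    (horiz_mem_lineDiff hge).2 ⟨by unfold Cell at h2; omega, Or.inr rfl⟩
  have m2 : Bond.horiz (i - 1) (h (i - 1)) ∈ lineDiff w h :=
    (horiz_mem_lineDiff hge).2 ⟨by unfold Cell at h1; omega, Or.inr rfl⟩
  constructor
  · intro hc
    exact ⟨_, hδ.mem_of_joined (hδ.horiz_mem hge hfin hc).2.2 e2 hj m1 e1⟩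
  · intro hc
    exact ⟨_, hδ.mem_of_joined (hδ.horiz_mem hge hfin hc).2.2 e1 hj.symm m2 e2⟩

/-- A component of the symmetric difference is itself the symmetric difference of the wall and of a
configuration, which follows `h` above the component and the wall elsewhere. -/
theorem IsComp.exists_lineDiff (hge : ∀ i, w i ≤ h i) (hfin : {i | h i ≠ w i}.Finite)
    (hδ : IsComp (lineDiff w h) δ) :
    ∃ g : ℤ → ℤ, (∀ i, w i ≤ g i) ∧ (∀ i, g i ≤ h i) ∧ δ = lineDiff w g := by
  set g : ℤ → ℤ := fun i => if InCols δ i then h i else w i with hg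
  have hge' : ∀ i, w i ≤ g i := fun i => by simp only [hg]; split_ifs; exacts [hge i, le_rfl]
  have hle' : ∀ i, g i ≤ h i := fun i => by simp only [hg]; split_ifs; exacts [le_rfl, hge i]
  have hcell : ∀ i y, Cell w g i y ↔ Cell w h i y ∧ InCols δ i := by
    intro i y
    simp only [Cell, hg]
    split_ifs with hc <;> simp [hc]
  refine ⟨g, hge', hle', ?_⟩
  ext b
  cases b with
  | horiz i y =>
    rw [horiz_mem_lineDiff hge']
    by_cases hc : InCols δ i
    · obtain ⟨h1, h2, h3⟩ := hδ.horiz_mem hge hfin hc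
      simp only [hg, if_pos hc, h1, true_and]
      constructor
      · intro hy
        exact ((horiz_mem_lineDiff hge).1 (hδ.1 hy)).2
      · rintro (rfl | rfl)
        exacts [h2, h3]
    · simp only [hg, if_neg hc, lt_irrefl, false_and, iff_false]
      exact fun hy => hc ⟨y, hy⟩
  | vert i y =>
    rw [vert_mem_lineDiff hge', hcell, hcell]
    by_cases c1 : Cell w h (i - 1) y <;> by_cases c2 : Cell w h i y
    · simp only [c1, c2, true_and, hδ.inCols_iff hge hfin c1 c2, not_true, iff_false]
      intro hm
      have := (vert_mem_lineDiff hge).1 (hδ.1 hm)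
      tauto
    · rw [hδ.vert_mem_iff hge hfin (Or.inl ⟨rfl, rfl⟩) c1 c2]
      tauto
    · rw [hδ.vert_mem_iff hge hfin (Or.inr ⟨rfl, rfl⟩) c2 c1]
      tauto
    · simp only [c1, c2, false_and, not_true, iff_false]
      intro hm
      have := (vert_mem_lineDiff hge).1 (hδ.1 hm)
      tauto

end Component

/-- The columns of a connected symmetric difference form an interval. -/
lemma lt_of_between (hge : ∀ i, w i ≤ h i) (hc : IsConn (lineDiff w h)) {i j k : ℤ}
    (hi : w i < h i) (hk : w k < h k) (hij : i ≤ j) (hjk : j ≤ k) : w j < h j := by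
  by_contra hj
  have hm : ∀ l, w l < h l → Bond.horiz l (w l) ∈ lineDiff w h := fun l hl =>
    (horiz_mem_lineDiff hge).2 ⟨hl, Or.inl rfl⟩
  have hJ := hc.2 _ (hm i hi) _ (hm k hk) (i, w i) (by rw [mem_ends_horiz]; simp) (k + 1, w k)
    (by rw [mem_ends_horiz]; simp)
  have key : ∀ p, Joined (lineDiff w h) (i, w i) p → p.1 ≤ j := by
    intro p hp
    induction hp with
    | refl => exact hij
    | @tail p q _ hpq ih =>
      obtain ⟨b, hb, h1, h2⟩ := hpq
      obtain ⟨p1, p2⟩ := p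
      obtain ⟨q1, q2⟩ := q
      cases b with
      | horiz l y =>
        rw [mem_ends_horiz] at h1 h2
        have := ((horiz_mem_lineDiff hge).1 hb).1
        by_contra hcon
        have hl : l = j := by simp only at ih hcon; omega
        rw [hl] at this
        exact hj this
      | vert l y =>
        rw [mem_ends_vert] at h1 h2
        simp only at ih ⊢
        omega
  have := key _ hJ
  simp only at this
  omega

lemma lt_of_mem_ends (hge : ∀ i, w i ≤ h i) {b : Bond} (hb : b ∈ lineDiff w h) {p : ℤ × ℤ}
    (hp : p ∈ b.ends) : w (p.1 - 1) < h (p.1 - 1) ∨ w p.1 < h p.1 := by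
  obtain ⟨p1, p2⟩ := p
  cases b with
  | horiz l y =>
    rw [mem_ends_horiz] at hp
    have h1 := ((horiz_mem_lineDiff hge).1 hb).1
    rcases hp.1 with h | h
    · right; simpa [h] using h1
    · left; simpa [h] using h1
  | vert l y =>
    rw [mem_ends_vert] at hp
    have h1 := (vert_mem_lineDiff hge).1 hb
    rw [hp.1]
    unfold Cell at h1
    simp only
    omega

/-- Configurations whose symmetric differences with the wall do not meet can be superposed. -/
lemma lineDiff_max (hge : ∀ i, w i ≤ h i) (hge' : ∀ i, w i ≤ h' i)
    (hd : ∀ b ∈ lineDiff w h, b ∉ lineDiff w h') :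
    lineDiff w (fun i => max (h i) (h' i)) = lineDiff w h ∪ lineDiff w h' := by
  have hge'' : ∀ i, w i ≤ max (h i) (h' i) := fun i => (hge i).trans (le_max_left _ _)
  have hcol : ∀ i, ¬ (w i < h i ∧ w i < h' i) := by
    rintro i ⟨h1, h2⟩
    exact hd _ ((horiz_mem_lineDiff hge).2 ⟨h1, Or.inl rfl⟩)
      ((horiz_mem_lineDiff hge').2 ⟨h2, Or.inl rfl⟩)
  have hcell : ∀ i y, ¬ (Cell w h i y ∧ Cell w h' i y) := by
    intro i y
    have := hcol i
    unfold Cell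
    omega
  have hmax : ∀ i y, Cell w (fun i => max (h i) (h' i)) i y ↔ Cell w h i y ∨ Cell w h' i y := by
    intro i y
    change (w i ≤ y ∧ y < max (h i) (h' i)) ↔ _
    unfold Cell
    omega
  ext b
  cases b with
  | horiz i y =>
    rw [Set.mem_union, horiz_mem_lineDiff hge'', horiz_mem_lineDiff hge, horiz_mem_lineDiff hge']
    have := hcol i
    have := hge i
    have := hge' i
    change (w i < max (h i) (h' i) ∧ (y = w i ∨ y = max (h i) (h' i))) ↔ _
    omega
  | vert i y =>
    have h1 := hd (Bond.vert i y)
    rw [vert_mem_lineDiff hge, vert_mem_lineDiff hge'] at h1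
    rw [Set.mem_union, vert_mem_lineDiff hge'', vert_mem_lineDiff hge, vert_mem_lineDiff hge',
      hmax, hmax]
    have h2 := hcell i y
    have h3 := hcell (i - 1) y
    tauto

end LineDiff

/-! ### Excitations -/

section Excitations

variable {w h : ℤ → ℤ}

lemma isExcitation_iff {δ : Finset Bond} : IsExcitation w δ ↔
    ∃ h : ℤ → ℤ, (∀ i, w i ≤ h i) ∧ {i | h i ≠ w i}.Finite ∧ (δ : Set Bond) = lineDiff w h ∧
      IsConn (lineDiff w h) := by
  constructor
  · rintro ⟨h, hge, hfin, hmax⟩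
    have hcomp : IsComp (lineDiff w h) (δ : Set Bond) := maximal_iff_isComp.1 hmax
    obtain ⟨g, hg1, hg2, hg3⟩ := hcomp.exists_lineDiff hge hfin
    refine ⟨g, hg1, hfin.subset ?_, hg3, hg3 ▸ hcomp.2.1⟩
    intro i hi hh
    have := hg1 i
    have := hg2 i
    exact hi (by omega)
  · rintro ⟨h, hge, hfin, heq, hc⟩
    refine ⟨h, hge, hfin, maximal_iff_isComp.2 ?_⟩
    rw [heq]
    exact ⟨subset_rfl, hc, fun b _ c hc _ => hc⟩

lemma finite_lineDiff (hge : ∀ i, w i ≤ h i) (hfin : {i | h i ≠ w i}.Finite) :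
    (lineDiff w h).Finite := by
  obtain ⟨A, B, hAB, hout⟩ := exists_bound_of_finite hfin
  have hsub : lineDiff w h ⊆ ⋃ i ∈ Set.Icc (A - 1) B, ((column h i ∪ column w i : Finset Bond) : Set Bond) := by
    intro b hb
    have hcol : ∃ i, (w i < h i ∨ w (i + 1) < h (i + 1)) ∧ (b ∈ column h i ∨ b ∈ column w i) := by
      rcases hb.1 with ⟨i, hi⟩ | ⟨i, hi⟩
      · refine ⟨i, ?_, Or.inl hi⟩
        by_contra hcon
        push Not at hcon
        refine hb.2 ⟨⟨i, hi⟩, i, ?_⟩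
        have e1 : h i = w i := le_antisymm hcon.1 (hge i)
        have e2 : h (i + 1) = w (i + 1) := le_antisymm hcon.2 (hge _)
        unfold column at hi ⊢
        rwa [e1, e2] at hi
      · refine ⟨i, ?_, Or.inr hi⟩
        by_contra hcon
        push Not at hcon
        refine hb.2 ⟨⟨i, ?_⟩, i, hi⟩
        have e1 : h i = w i := le_antisymm hcon.1 (hge i)
        have e2 : h (i + 1) = w (i + 1) := le_antisymm hcon.2 (hge _)
        unfold column at hi ⊢
        rwa [e1, e2]
    obtain ⟨i, hi, hbi⟩ := hcol
    rw [Set.mem_iUnion₂]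
    refine ⟨i, ?_, by simpa using hbi⟩
    rw [Set.mem_Icc]
    by_contra hcon
    have e1 := hout i (by omega)
    have e2 := hout (i + 1) (by omega)
    omega
  exact ((Set.finite_Icc _ _).biUnion fun i _ => Finset.finite_toSet _).subset hsub

/-- The connected components of a finite set of bonds. -/
def components (S : Finset Bond) : Finset (Finset Bond) :=
  S.powerset.filter fun δ => IsComp (S : Set Bond) (δ : Set Bond)

lemma mem_components {S δ : Finset Bond} :
    δ ∈ components S ↔ IsComp (S : Set Bond) (δ : Set Bond) := by
  rw [components, Finset.mem_filter, Finset.mem_powerset, and_iff_right_iff_imp]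
  intro h
  exact_mod_cast h.1

lemma biUnion_components (S : Finset Bond) : (components S).biUnion id = S := by
  ext b
  rw [Finset.mem_biUnion]
  constructor
  · rintro ⟨δ, hδ, hb⟩
    exact_mod_cast (mem_components.1 hδ).1 (by exact_mod_cast hb)
  · intro hb
    obtain ⟨δ, hδ, hbδ⟩ := exists_isComp (S := (S : Set Bond)) (by exact_mod_cast hb)
    have hfin : δ.Finite := S.finite_toSet.subset hδ.1
    refine ⟨hfin.toFinset, mem_components.2 (by simpa using hδ), by simpa using hbδ⟩

/-- Two excitations are in conflict when they are incompatible or coincide. -/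
def Conflict (δ δ' : Finset Bond) : Prop := Incompatible δ δ' ∨ δ = δ'

lemma Conflict.refl (δ : Finset Bond) : Conflict δ δ := Or.inr rfl

lemma Conflict.symm {δ δ' : Finset Bond} (h : Conflict δ δ') : Conflict δ' δ := by
  rcases h with ⟨b, hb, c, hc, hm⟩ | h
  · exact Or.inl ⟨c, hc, b, hb, hm.symm⟩
  · exact Or.inr h.symm

lemma pairwise_components (S : Finset Bond) :
    ((components S : Finset (Finset Bond)) : Set (Finset Bond)).Pairwise
      (fun a b => ¬ Conflict a b) := by
  intro δ hδ δ' hδ' hne hconf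
  rcases hconf with ⟨b, hb, c, hc, hm⟩ | h
  · refine hne ?_
    have := (mem_components.1 (by exact_mod_cast hδ)).eq_of_meets
      (mem_components.1 (by exact_mod_cast hδ')) (by exact_mod_cast hb) (by exact_mod_cast hc) hm
    exact_mod_cast this
  · exact hne h

lemma components_biUnion {X : Finset (Finset Bond)}
    (hX : (X : Set (Finset Bond)).Pairwise (fun a b => ¬ Conflict a b))
    (hc : ∀ δ ∈ X, IsConn (δ : Set Bond)) : components (X.biUnion id) = X := by
  have hcomp : ∀ δ ∈ X, δ ∈ components (X.biUnion id) := by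
    intro δ hδ
    rw [mem_components]
    refine ⟨?_, hc δ hδ, ?_⟩
    · intro b hb
      simp only [Finset.coe_biUnion, Set.mem_iUnion]
      exact ⟨δ, hδ, hb⟩
    · intro b hb c hcX hm
      simp only [Finset.coe_biUnion, Set.mem_iUnion] at hcX
      obtain ⟨δ', hδ', hcδ'⟩ := hcX
      by_contra hcon
      have hne : δ ≠ δ' := by
        rintro rfl
        exact hcon hcδ'
      exact hX hδ hδ' hne (Or.inl ⟨b, by exact_mod_cast hb, c, hcδ', hm⟩)
  refine Finset.Subset.antisymm ?_ hcomp
  intro δ hδ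
  have hδc := mem_components.1 hδ
  obtain ⟨b, hb⟩ := hδc.2.1.1
  have hbX := hδc.1 hb
  simp only [Finset.coe_biUnion, Set.mem_iUnion] at hbX
  obtain ⟨δ', hδ', hbδ'⟩ := hbX
  have := hδc.eq_of_meets (mem_components.1 (hcomp δ' hδ')) hb hbδ' (Bond.Meets.refl b)
  have h2 : δ = δ' := by exact_mod_cast this
  rwa [h2]

/-- A finite compatible family of excitations comes from a configuration. -/
lemma exists_config (X : Finset (Finset Bond)) (hexc : ∀ δ ∈ X, IsExcitation w δ)
    (hX : (X : Set (Finset Bond)).Pairwise (fun a b => ¬ Conflict a b)) :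
    ∃ h : ℤ → ℤ, (∀ i, w i ≤ h i) ∧ {i | h i ≠ w i}.Finite ∧
      lineDiff w h = ((X.biUnion id : Finset Bond) : Set Bond) := by
  induction X using Finset.induction_on with
  | empty =>
    refine ⟨w, fun i => le_rfl, by simp, ?_⟩
    simp [lineDiff]
  | insert δ X hδX ih =>
    obtain ⟨h, hge, hfin, hh⟩ := ih (fun δ hδ => hexc δ (Finset.mem_insert_of_mem hδ))
      (hX.mono (by simp))
    obtain ⟨g, hge', hfin', hg, -⟩ := isExcitation_iff.1 (hexc δ (Finset.mem_insert_self _ _))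
    refine ⟨fun i => max (g i) (h i), fun i => (hge i).trans (le_max_right _ _), ?_, ?_⟩
    · refine (hfin.union hfin').subset ?_
      intro i hi
      simp only [Set.mem_ofPred_eq, Set.mem_union] at hi ⊢
      omega
    · rw [lineDiff_max hge' hge, ← hg, hh]
      · simp
      · intro b hb hbX
        rw [hh] at hbX
        rw [← hg] at hb
        simp only [Finset.coe_biUnion, Set.mem_iUnion] at hbX
        obtain ⟨δ', hδ', hbδ'⟩ := hbX
        have hne : δ ≠ δ' := by
          rintro rfl
          exact hδX hδ'
        exact hX (Finset.mem_insert_self _ _) (Finset.mem_insert_of_mem hδ') hne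
          (Or.inl ⟨b, by exact_mod_cast hb, b, by exact_mod_cast hbδ', Bond.Meets.refl b⟩)

end Excitations

/-! ### The energy of excitations -/

section Energy

variable {w h : ℤ → ℤ}

/-- The column to which a bond belongs. -/
def Bond.col : Bond → ℤ
  | .horiz i _ => i
  | .vert i _ => i - 1

/-- The part of the line of `h` in the columns `A, …, B - 1`. -/
def lineOn (A B : ℤ) (h : ℤ → ℤ) : Finset Bond := (Finset.Ico A B).biUnion fun i => column h i

lemma col_of_mem_column {b : Bond} {i : ℤ} (hb : b ∈ column h i) : b.col = i := by
  unfold column at hb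
  rw [Finset.mem_insert, Finset.mem_image] at hb
  rcases hb with rfl | ⟨y, -, rfl⟩
  · rfl
  · simp [Bond.col]

lemma mem_lineOn {A B : ℤ} {b : Bond} : b ∈ lineOn A B h ↔ b ∈ line h ∧ A ≤ b.col ∧ b.col < B := by
  unfold lineOn line
  rw [Finset.mem_biUnion]
  constructor
  · rintro ⟨i, hi, hb⟩
    rw [Finset.mem_Ico] at hi
    rw [col_of_mem_column hb]
    exact ⟨⟨i, hb⟩, hi⟩
  · rintro ⟨⟨i, hb⟩, hi⟩
    rw [col_of_mem_column hb] at hi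
    exact ⟨i, Finset.mem_Ico.2 hi, hb⟩

lemma boxLine_eq_lineOn (N : ℕ) : boxLine N h = lineOn 0 N h := by
  ext b
  unfold boxLine lineOn
  simp only [Finset.mem_biUnion, Finset.mem_range, Finset.mem_Ico]
  constructor
  · rintro ⟨i, hi, hb⟩
    exact ⟨i, by omega, hb⟩
  · rintro ⟨i, hi, hb⟩
    obtain ⟨n, rfl⟩ := Int.eq_ofNat_of_zero_le hi.1
    exact ⟨n, by omega, hb⟩

lemma card_column (i : ℤ) : ((column h i).card : ℤ) = 1 + |h (i + 1) - h i| := by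
  unfold column
  rw [Finset.card_insert_of_notMem (by simp), Finset.card_image_of_injective, Int.card_Ico]
  · rw [max_sub_min_eq_abs']
    push_cast
    rw [Int.toNat_of_nonneg (abs_nonneg _), abs_sub_comm]
    ring
  · intro a b hab
    simpa using hab

lemma pairwise_disjoint_column : Pairwise fun i j => Disjoint (column h i) (column h j) := by
  intro i j hij
  rw [Finset.disjoint_left]
  intro b hi hj
  exact hij ((col_of_mem_column hi).symm.trans (col_of_mem_column hj))

lemma card_lineOn {A B : ℤ} (hAB : A ≤ B) :
    ((lineOn A B h).card : ℤ) = (B - A) + variation A B h := by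
  unfold lineOn variation
  rw [Finset.card_biUnion fun i _ j _ hij => pairwise_disjoint_column hij]
  push_cast
  simp only [card_column]
  rw [Finset.sum_add_distrib, Finset.sum_const, Int.card_Ico, nsmul_eq_mul, mul_one,
    Int.toNat_of_nonneg (by omega)]
  congr 1
  refine Finset.sum_nbij' (fun i => i + 1) (fun i => i - 1) ?_ ?_ ?_ ?_ ?_
  · intro i hi; rw [Finset.mem_Ico] at hi; rw [Finset.mem_Ioc]; omega
  · intro i hi; rw [Finset.mem_Ioc] at hi; rw [Finset.mem_Ico]; omega
  · intro i _; ring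
  · intro i _; ring
  · intro i _; rw [add_sub_cancel_right]

lemma col_of_mem_diff {A B : ℤ} (hout : ∀ i, i ≤ A ∨ B ≤ i → h i = w i) {b : Bond}
    (hb : b ∈ lineDiff w h) : A ≤ b.col ∧ b.col < B := by
  by_contra hcon
  have key : ∀ i, ¬ (A ≤ i ∧ i < B) → column h i = column w i := by
    intro i hi
    unfold column
    rw [hout i (by omega), hout (i + 1) (by omega)]
  rcases hb.1 with ⟨i, hi⟩ | ⟨i, hi⟩
  · rw [col_of_mem_column hi] at hcon
    exact hb.2 ⟨⟨i, hi⟩, i, key i hcon ▸ hi⟩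
  · rw [col_of_mem_column hi] at hcon
    exact hb.2 ⟨⟨i, (key i hcon).symm ▸ hi⟩, i, hi⟩

section Counting

variable {A B : ℤ} {S : Finset Bond}

lemma filter_notMem_wall (hout : ∀ i, i ≤ A ∨ B ≤ i → h i = w i)
    (hS : (S : Set Bond) = lineDiff w h) :
    (S.filter fun b => b ∉ line w) = lineOn A B h \ lineOn A B w := by
  ext b
  have hbS : b ∈ S ↔ b ∈ lineDiff w h := by rw [← hS, Finset.mem_coe]
  rw [Finset.mem_filter, Finset.mem_sdiff, mem_lineOn, mem_lineOn, hbS]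
  constructor
  · rintro ⟨hb, hbw⟩
    exact ⟨⟨hb.1.resolve_right hbw, col_of_mem_diff hout hb⟩, fun h => hbw h.1⟩
  · rintro ⟨⟨hb, hc⟩, hbw⟩
    have : b ∉ line w := fun h => hbw ⟨h, hc⟩
    exact ⟨⟨Or.inl hb, fun h => this h.2⟩, this⟩

lemma filter_mem_wall (hout : ∀ i, i ≤ A ∨ B ≤ i → h i = w i)
    (hS : (S : Set Bond) = lineDiff w h) :
    (S.filter fun b => b ∈ line w) = lineOn A B w \ lineOn A B h := by
  ext b
  have hbS : b ∈ S ↔ b ∈ lineDiff w h := by rw [← hS, Finset.mem_coe]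
  rw [Finset.mem_filter, Finset.mem_sdiff, mem_lineOn, mem_lineOn, hbS]
  constructor
  · rintro ⟨hb, hbw⟩
    exact ⟨⟨hbw, col_of_mem_diff hout hb⟩, fun h => hb.2 ⟨h.1, hbw⟩⟩
  · rintro ⟨⟨hb, hc⟩, hbh⟩
    have : b ∉ line h := fun h => hbh ⟨h, hc⟩
    exact ⟨⟨Or.inr hb, fun h => this h.1⟩, hb⟩

lemma card_columns_le (hge : ∀ i, w i ≤ h i) (hS : (S : Set Bond) = lineDiff w h) (F : Finset ℤ)
    (hF : ∀ i ∈ F, w i < h i) : F.card ≤ (S.filter fun b => b ∉ line w).card := by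
  refine Finset.card_le_card_of_injOn (fun i => Bond.horiz i (h i)) ?_ ?_
  · intro i hi
    have hlt := hF i hi
    rw [Finset.mem_coe, Finset.mem_filter, ← Finset.mem_coe, hS, horiz_mem_lineDiff hge,
      horiz_mem_line]
    omega
  · intro i _ j _ hij
    exact (Bond.horiz.inj hij).1

/-- The wall side of an excitation is at most `ρ` times as long as the other side. -/
theorem card_wall_le {M : ℤ} (hM : ∀ i, |w i| ≤ M) (hge : ∀ i, w i ≤ h i)
    (hfin : {i | h i ≠ w i}.Finite) (hS : (S : Set Bond) = lineDiff w h) :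
    ((S.filter fun b => b ∈ line w).card : ℝ) ≤ rho w * (S.filter fun b => b ∉ line w).card := by
  obtain ⟨A, B, hAB, hout⟩ := exists_bound_of_finite hfin
  have hρ := one_le_rho hM
  have h1 := variation_sub_le hρ (fun z p q hw => wellLength_le_rho hM hw) A B h hge hout
  have h2 := card_columns_le hge hS ((Finset.Ioo A B).filter (fun i => w i < h i))
    (fun i hi => (Finset.mem_filter.1 hi).2)
  have h3 : ((S.filter fun b => b ∈ line w).card : ℤ) - (S.filter fun b => b ∉ line w).card
      = variation A B w - variation A B h := by
    rw [filter_notMem_wall hout hS, filter_mem_wall hout hS]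
    have e1 := Finset.card_sdiff_add_card_inter (lineOn A B w) (lineOn A B h)
    have e2 := Finset.card_sdiff_add_card_inter (lineOn A B h) (lineOn A B w)
    rw [Finset.inter_comm] at e2
    have e3 := card_lineOn (h := w) hAB
    have e4 := card_lineOn (h := h) hAB
    omega
  have h3' : ((S.filter fun b => b ∈ line w).card : ℝ) - (S.filter fun b => b ∉ line w).card
      = variation A B w - variation A B h := by exact_mod_cast h3
  have h2' : (((Finset.Ioo A B).filter (fun i => w i < h i)).card : ℝ)
      ≤ (S.filter fun b => b ∉ line w).card := by exact_mod_cast h2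
  have := mul_le_mul_of_nonneg_left h2' (by linarith : 0 ≤ rho w - 1)
  linarith

/-- The energy of an excitation is at least proportional to its length. -/
theorem energy_ge {JAB JAW JBW : ℝ} {M : ℤ} (hM : ∀ i, |w i| ≤ M) (hge : ∀ i, w i ≤ h i)
    (hfin : {i | h i ≠ w i}.Finite) (hS : (S : Set Bond) = lineDiff w h)
    (hstable : 0 ≤ JAB + JAW - JBW) :
    (JAB - rho w * (JAW - JBW)) / (1 + rho w) * S.card ≤ energy JAB JAW JBW w S := by
  have hρ := one_le_rho hM
  have h1 := card_wall_le hM hge hfin hS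
  have h2 : (S.card : ℝ) = (S.filter fun b => b ∈ line w).card
      + (S.filter fun b => b ∉ line w).card := by
    exact_mod_cast (Finset.card_filter_add_card_filter_not (s := S) (fun b => b ∈ line w)).symm
  rw [div_mul_eq_mul_div, div_le_iff₀ (by linarith), h2]
  unfold energy
  -- the difference of the two sides is `(J_AB + J_AW - J_BW) (ρ m - l)`
  nlinarith [mul_nonneg hstable (sub_nonneg.2 h1)]

/-- An excitation has two horizontal bonds in each of its columns, and its number of vertical bonds
at a site is at least the variation of its thickness. -/
theorem card_ge (hge : ∀ i, w i ≤ h i) (hS : (S : Set Bond) = lineDiff w h) (F T : Finset ℤ)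
    (hF : ∀ i ∈ F, w i < h i) :
    2 * F.card + ∑ j ∈ T, ((h j - w j) - (h (j - 1) - w (j - 1))).natAbs ≤ S.card := by
  set side : ℤ → Finset ℤ := fun j => (Finset.Ico (w j) (h j) \ Finset.Ico (w (j - 1)) (h (j - 1)))
    ∪ (Finset.Ico (w (j - 1)) (h (j - 1)) \ Finset.Ico (w j) (h j)) with hside
  have hsidecard : ∀ j, ((h j - w j) - (h (j - 1) - w (j - 1))).natAbs ≤ (side j).card := by
    intro j
    have e1 := Finset.le_card_sdiff (Finset.Ico (w (j - 1)) (h (j - 1))) (Finset.Ico (w j) (h j))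
    have e2 := Finset.le_card_sdiff (Finset.Ico (w j) (h j)) (Finset.Ico (w (j - 1)) (h (j - 1)))
    have e3 := Finset.card_le_card (Finset.subset_union_left
      (s₁ := Finset.Ico (w j) (h j) \ Finset.Ico (w (j - 1)) (h (j - 1)))
      (s₂ := Finset.Ico (w (j - 1)) (h (j - 1)) \ Finset.Ico (w j) (h j)))
    have e4 := Finset.card_le_card (Finset.subset_union_right
      (s₁ := Finset.Ico (w j) (h j) \ Finset.Ico (w (j - 1)) (h (j - 1)))
      (s₂ := Finset.Ico (w (j - 1)) (h (j - 1)) \ Finset.Ico (w j) (h j)))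
    rw [Int.card_Ico, Int.card_Ico] at e1 e2
    have := hge j
    have := hge (j - 1)
    simp only [hside]
    omega
  set bot := F.image fun i => Bond.horiz i (w i) with hbot
  set top := F.image fun i => Bond.horiz i (h i) with htop
  set ver := T.biUnion fun j => (side j).image (Bond.vert j) with hver
  have cbot : bot.card = F.card := Finset.card_image_of_injective _ fun i j hij =>
    (Bond.horiz.inj hij).1
  have ctop : top.card = F.card := Finset.card_image_of_injective _ fun i j hij =>
    (Bond.horiz.inj hij).1
  have cver : ver.card = ∑ j ∈ T, (side j).card := by
    rw [hver, Finset.card_biUnion]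
    · exact Finset.sum_congr rfl fun j _ => Finset.card_image_of_injective _ fun a b hab =>
        (Bond.vert.inj hab).2
    · intro i _ j _ hij
      rw [Function.onFun, Finset.disjoint_left]
      intro b hb hb'
      obtain ⟨y, -, rfl⟩ := Finset.mem_image.1 hb
      obtain ⟨y', -, hy'⟩ := Finset.mem_image.1 hb'
      exact hij (Bond.vert.inj hy').1.symm
  have d1 : Disjoint bot top := by
    rw [Finset.disjoint_left]
    intro b hb hb'
    obtain ⟨i, hi, rfl⟩ := Finset.mem_image.1 hb
    obtain ⟨j, hj, hij⟩ := Finset.mem_image.1 hb'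
    obtain ⟨h1, h2⟩ := Bond.horiz.inj hij
    subst h1
    have := hF j hj
    omega
  have d2 : Disjoint (bot ∪ top) ver := by
    rw [Finset.disjoint_left]
    intro b hb hb'
    obtain ⟨j, -, hj⟩ := Finset.mem_biUnion.1 hb'
    obtain ⟨y, -, rfl⟩ := Finset.mem_image.1 hj
    rcases Finset.mem_union.1 hb with hb | hb
    · obtain ⟨i, -, hi⟩ := Finset.mem_image.1 hb
      cases hi
    · obtain ⟨i, -, hi⟩ := Finset.mem_image.1 hb
      cases hi
  have hsub : bot ∪ top ∪ ver ⊆ S := by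
    intro b hb
    rw [← Finset.mem_coe, hS]
    rcases Finset.mem_union.1 hb with hb | hb
    · rcases Finset.mem_union.1 hb with hb | hb
      · obtain ⟨i, hi, rfl⟩ := Finset.mem_image.1 hb
        exact (horiz_mem_lineDiff hge).2 ⟨hF i hi, Or.inl rfl⟩
      · obtain ⟨i, hi, rfl⟩ := Finset.mem_image.1 hb
        exact (horiz_mem_lineDiff hge).2 ⟨hF i hi, Or.inr rfl⟩
    · obtain ⟨j, -, hj⟩ := Finset.mem_biUnion.1 hb
      obtain ⟨y, hy, rfl⟩ := Finset.mem_image.1 hj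
      rw [vert_mem_lineDiff hge]
      simp only [hside, Finset.mem_union, Finset.mem_sdiff, Finset.mem_Ico] at hy
      unfold Cell
      omega
  have hcard := Finset.card_le_card hsub
  rw [Finset.card_union_of_disjoint d2, Finset.card_union_of_disjoint d1, cbot, ctop, cver] at hcard
  have := Finset.sum_le_sum fun j (_ : j ∈ T) => hsidecard j
  omega

end Counting

end Energy

/-! ### The number of excitations -/

section Entropy

variable {w : ℤ → ℤ}

/-- The set of the columns of a set of bonds. -/
def colSet (δ : Finset Bond) : Finset ℤ :=
  (δ.filter fun b => ∃ i y, b = Bond.horiz i y).image Bond.col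

lemma mem_colSet {δ : Finset Bond} {i : ℤ} : i ∈ colSet δ ↔ InCols (δ : Set Bond) i := by
  unfold colSet InCols
  simp only [Finset.mem_image, Finset.mem_filter, Finset.mem_coe]
  constructor
  · rintro ⟨b, ⟨hb, j, y, rfl⟩, hi⟩
    exact ⟨y, by simpa [Bond.col, ← hi] using hb⟩
  · rintro ⟨y, hy⟩
    exact ⟨_, ⟨hy, i, y, rfl⟩, rfl⟩

lemma mem_colSet_iff_lt {δ : Finset Bond} {h : ℤ → ℤ} (hge : ∀ i, w i ≤ h i)
    (hδ : (δ : Set Bond) = lineDiff w h) {i : ℤ} : i ∈ colSet δ ↔ w i < h i := by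
  rw [mem_colSet, hδ, inCols_lineDiff hge]

lemma IsExcitation.colSet_eq {δ : Finset Bond} (hδ : IsExcitation w δ) :
    0 < (colSet δ).card ∧ ∃ p : ℤ, colSet δ = Finset.Ico p (p + (colSet δ).card) := by
  obtain ⟨h, hge, hfin, hh, hc⟩ := isExcitation_iff.1 hδ
  have hne : (colSet δ).Nonempty := by
    obtain ⟨b, hb⟩ := hc.1
    obtain ⟨p, hp⟩ := b.ends_nonempty
    rcases lt_of_mem_ends hge hb hp with h1 | h1
    · exact ⟨_, (mem_colSet_iff_lt hge hh).2 h1⟩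
    · exact ⟨_, (mem_colSet_iff_lt hge hh).2 h1⟩
  refine ⟨hne.card_pos, (colSet δ).min' hne, ?_⟩
  have hIcc : colSet δ = Finset.Icc ((colSet δ).min' hne) ((colSet δ).max' hne) := by
    ext i
    rw [Finset.mem_Icc]
    constructor
    · exact fun hi => ⟨Finset.min'_le _ _ hi, Finset.le_max' _ _ hi⟩
    · rintro ⟨h1, h2⟩
      have h3 := (mem_colSet_iff_lt hge hh).1 ((colSet δ).min'_mem hne)
      have h4 := (mem_colSet_iff_lt hge hh).1 ((colSet δ).max'_mem hne)
      exact (mem_colSet_iff_lt hge hh).2 (lt_of_between hge hc h3 h4 h1 h2)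
  have hle := (colSet δ).min'_le_max' hne
  have hcard : ((colSet δ).card : ℤ) = (colSet δ).max' hne + 1 - (colSet δ).min' hne := by
    conv_lhs => rw [hIcc]
    rw [Int.card_Icc, Int.toNat_of_nonneg (by omega)]
  conv_lhs => rw [hIcc]
  ext i
  rw [Finset.mem_Icc, Finset.mem_Ico]
  omega

lemma sum_natAbs_le (t : Finset ℤ) : ∑ k ∈ t, (1 / 6 : ℝ) ^ k.natAbs ≤ 7 / 5 := by
  have h1 : HasSum (fun n : ℕ => (1 / 6 : ℝ) ^ ((n : ℤ)).natAbs) (6 / 5) := by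
    simp only [Int.natAbs_natCast]
    convert hasSum_geometric_of_lt_one (r := (1 / 6 : ℝ)) (by norm_num) (by norm_num) using 1
    norm_num
  have h2 : HasSum (fun n : ℕ => (1 / 6 : ℝ) ^ (-((n : ℤ) + 1)).natAbs) (1 / 5) := by
    have : ∀ n : ℕ, (1 / 6 : ℝ) ^ (-((n : ℤ) + 1)).natAbs = 1 / 6 * (1 / 6 : ℝ) ^ n := by
      intro n
      rw [show (-((n : ℤ) + 1)).natAbs = n + 1 by omega, pow_succ']
    simp only [this]
    rw [show (1 / 5 : ℝ) = 1 / 6 * (1 - 1 / 6)⁻¹ by norm_num]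
    exact (hasSum_geometric_of_lt_one (by norm_num) (by norm_num)).mul_left (1 / 6)
  have h3 := HasSum.of_nat_of_neg_add_one (f := fun k : ℤ => (1 / 6 : ℝ) ^ k.natAbs) h1 h2
  refine (sum_le_hasSum t (fun k _ => by positivity) h3).trans (by norm_num)

/-- The excitations above given columns are encoded by the increments of their thickness: the two
horizontal bonds of a column give the factor `1 / 36`, and the sum over an increment the factor
`7 / 5`. -/
lemma sum_excitations_le (Λ : Finset (Finset Bond)) (hΛ : ∀ δ ∈ Λ, IsExcitation w δ) (p : ℤ)
    (L : ℕ) (hL : ∀ δ ∈ Λ, colSet δ = Finset.Ico p (p + L)) :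
    ∑ δ ∈ Λ, (1 / 6 : ℝ) ^ δ.card ≤ (7 / 180) ^ L := by
  have hex : ∀ δ : Finset Bond, ∃ h : ℤ → ℤ, δ ∈ Λ → (∀ i, w i ≤ h i) ∧
      (δ : Set Bond) = lineDiff w h := by
    intro δ
    by_cases hδ : δ ∈ Λ
    · obtain ⟨h, hge, -, hh, -⟩ := isExcitation_iff.1 (hΛ δ hδ)
      exact ⟨h, fun _ => ⟨hge, hh⟩⟩
    · exact ⟨w, fun h => absurd h hδ⟩
  choose H hH using hex
  set g : Finset Bond → ℤ → ℤ := fun δ i => H δ i - w i with hg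
  set d : Finset Bond → Fin L → ℤ := fun δ k => g δ (p + k) - g δ (p + k - 1) with hd
  have hout : ∀ δ ∈ Λ, ∀ i, i < p ∨ p + L ≤ i → g δ i = 0 := by
    intro δ hδ i hi
    have h1 := (hH δ hδ).1 i
    have h2 : ¬ w i < H δ i := by
      rw [← mem_colSet_iff_lt (hH δ hδ).1 (hH δ hδ).2, hL δ hδ, Finset.mem_Ico]
      omega
    simp only [hg]
    omega
  have hinj : Set.InjOn d (Λ : Set (Finset Bond)) := by
    intro δ hδ δ' hδ' hdd
    have key : ∀ n : ℕ, n ≤ L → g δ (p + n - 1) = g δ' (p + n - 1) := by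
      intro n
      induction n with
      | zero =>
        intro _
        rw [hout δ hδ _ (by simp), hout δ' hδ' _ (by simp)]
      | succ n ih =>
        intro hn
        have h1 := ih (by omega)
        have h2 := congrFun hdd ⟨n, by omega⟩
        simp only [hd] at h2
        rw [show (p + ((n + 1 : ℕ) : ℤ) - 1) = p + n by push_cast; ring]
        omega
    have hgg : H δ = H δ' := by
      funext i
      have h3 : g δ i = g δ' i := by
        by_cases hi : i < p ∨ p + L ≤ i
        · rw [hout δ hδ i hi, hout δ' hδ' i hi]
        · have := key (i - p + 1).toNat (by omega)
          rwa [show p + ((i - p + 1).toNat : ℤ) - 1 = i by omega] at this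
      simp only [hg] at h3
      omega
    have : (δ : Set Bond) = δ' := by rw [(hH δ hδ).2, (hH δ' hδ').2, hgg]
    exact_mod_cast this
  have hcard : ∀ δ ∈ Λ, 2 * L + ∑ k : Fin L, (d δ k).natAbs ≤ δ.card := by
    intro δ hδ
    have h1 := card_ge (hH δ hδ).1 (hH δ hδ).2 (Finset.Ico p (p + L))
      (Finset.univ.image fun k : Fin L => p + (k : ℤ))
      (fun i hi => (mem_colSet_iff_lt (hH δ hδ).1 (hH δ hδ).2).1 (by rw [hL δ hδ]; exact hi))
    rw [Int.card_Ico, Finset.sum_image] at h1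
    · simpa [hd, hg] using h1
    · intro a _ b _ hab
      have : (a : ℤ) = b := by simpa using hab
      exact Fin.ext (by exact_mod_cast this)
  set t : Finset ℤ := Λ.biUnion fun δ => Finset.univ.image (d δ) with ht
  calc ∑ δ ∈ Λ, (1 / 6 : ℝ) ^ δ.card
      ≤ ∑ δ ∈ Λ, (1 / 36) ^ L * ∏ k : Fin L, (1 / 6 : ℝ) ^ (d δ k).natAbs := by
        refine Finset.sum_le_sum fun δ hδ => ?_
        refine (pow_le_pow_of_le_one (by norm_num) (by norm_num) (hcard δ hδ)).trans (le_of_eq ?_)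
        rw [pow_add, pow_mul, Finset.prod_pow_eq_pow_sum]
        norm_num
    _ = (1 / 36) ^ L * ∑ e ∈ Λ.image d, ∏ k : Fin L, (1 / 6 : ℝ) ^ (e k).natAbs := by
        rw [← Finset.mul_sum, Finset.sum_image hinj]
    _ ≤ (1 / 36) ^ L * ∑ e ∈ Fintype.piFinset (fun _ : Fin L => t),
          ∏ k : Fin L, (1 / 6 : ℝ) ^ (e k).natAbs := by
        refine mul_le_mul_of_nonneg_left ?_ (by positivity)
        refine Finset.sum_le_sum_of_subset_of_nonneg ?_ fun e _ _ => by positivity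
        intro e he
        obtain ⟨δ, hδ, rfl⟩ := Finset.mem_image.1 he
        rw [Fintype.mem_piFinset]
        intro k
        exact Finset.mem_biUnion.2 ⟨δ, hδ, Finset.mem_image_of_mem _ (Finset.mem_univ k)⟩
    _ = (1 / 36) ^ L * ∏ _k : Fin L, ∑ x ∈ t, (1 / 6 : ℝ) ^ x.natAbs := by
        rw [Finset.prod_univ_sum]
    _ ≤ (1 / 36) ^ L * ∏ _k : Fin L, (7 / 5 : ℝ) := by
        refine mul_le_mul_of_nonneg_left ?_ (by positivity)
        exact Finset.prod_le_prod (fun _ _ => Finset.sum_nonneg fun x _ => by positivity)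
          fun _ _ => sum_natAbs_le t
    _ = (7 / 180) ^ L := by
        rw [Finset.prod_const, Finset.card_univ, Fintype.card_fin, ← mul_pow]
        norm_num

lemma sum_range_mul_pow_le (M : ℕ) :
    ∑ L ∈ Finset.range M, (L : ℝ) * (11 / 100 : ℝ) ^ L ≤ 1 / 3 := by
  have h := hasSum_coe_mul_geometric_of_norm_lt_one (r := (11 / 100 : ℝ)) (by norm_num)
  refine (sum_le_hasSum _ (fun L _ => by positivity) h).trans (by norm_num)

/-- The excitations above a given column, with a weight that grows with the number of columns. -/
theorem sum_column_le (Λ : Finset (Finset Bond)) (hΛ : ∀ δ ∈ Λ, IsExcitation w δ) (i : ℤ) :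
    ∑ δ ∈ Λ.filter (fun δ => i ∈ colSet δ), (1 / 6 : ℝ) ^ δ.card * Real.exp (colSet δ).card
      ≤ 1 / 3 := by
  have hex : ∀ δ : Finset Bond, ∃ p : ℤ, δ ∈ Λ → colSet δ = Finset.Ico p (p + (colSet δ).card) := by
    intro δ
    by_cases hδ : δ ∈ Λ
    · obtain ⟨-, p, hp⟩ := (hΛ δ hδ).colSet_eq
      exact ⟨p, fun _ => hp⟩
    · exact ⟨0, fun h => absurd h hδ⟩
  choose p hp using hex
  set M := Λ.sup (fun δ => (colSet δ).card) + 1 with hM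
  -- The factor per column: `exp 1` from the weight, `7 / 180` from `sum_excitations_le`.
  have hexp : Real.exp 1 * (7 / 180) ≤ 11 / 100 := by
    have := Real.exp_one_lt_d9
    linarith
  -- Sort the excitations by their number `L` of columns and by the position of `i` among these.
  rw [← Finset.sum_fiberwise_of_maps_to (t := (Finset.range M).sigma fun L => Finset.range L)
    (g := fun δ => (⟨(colSet δ).card, (i - p δ).toNat⟩ : Σ _ : ℕ, ℕ))]
  · rw [Finset.sum_sigma]
    refine le_trans (Finset.sum_le_sum (g := fun L : ℕ => (L : ℝ) * (11 / 100 : ℝ) ^ L)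
      fun L _ => ?_) (sum_range_mul_pow_le M)
    have hb : ∀ k ∈ Finset.range L, ∑ δ ∈ (Λ.filter fun δ => i ∈ colSet δ).filter (fun δ =>
        (⟨(colSet δ).card, (i - p δ).toNat⟩ : Σ _ : ℕ, ℕ) = ⟨L, k⟩),
          (1 / 6 : ℝ) ^ δ.card * Real.exp (colSet δ).card ≤ (11 / 100 : ℝ) ^ L := by
      intro k _
      set Λ' := (Λ.filter fun δ => i ∈ colSet δ).filter (fun δ =>
        (⟨(colSet δ).card, (i - p δ).toNat⟩ : Σ _ : ℕ, ℕ) = ⟨L, k⟩) with hΛ'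
      have hmem : ∀ δ ∈ Λ', δ ∈ Λ ∧ (colSet δ).card = L ∧
          colSet δ = Finset.Ico (i - k) (i - k + L) := by
        intro δ hδ
        rw [hΛ', Finset.mem_filter, Finset.mem_filter] at hδ
        obtain ⟨⟨h1, h2⟩, h3⟩ := hδ
        simp only [Sigma.mk.injEq, heq_eq_eq] at h3
        have h4 := hp δ h1
        have h5 := h2
        rw [h4, Finset.mem_Ico] at h5
        refine ⟨h1, h3.1, ?_⟩
        rw [h3.1] at h4
        rw [h4, show p δ = i - k by omega]
      have h1 := sum_excitations_le Λ' (fun δ hδ => hΛ δ (hmem δ hδ).1) (i - k) L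
        (fun δ hδ => (hmem δ hδ).2.2)
      calc ∑ δ ∈ Λ', (1 / 6 : ℝ) ^ δ.card * Real.exp (colSet δ).card
          = (∑ δ ∈ Λ', (1 / 6 : ℝ) ^ δ.card) * Real.exp L := by
            rw [Finset.sum_mul]
            exact Finset.sum_congr rfl fun δ hδ => by rw [(hmem δ hδ).2.1]
        _ ≤ (7 / 180) ^ L * Real.exp L := mul_le_mul_of_nonneg_right h1 (Real.exp_pos _).le
        _ = (Real.exp 1 * (7 / 180)) ^ L := by
            rw [mul_pow, ← Real.exp_nat_mul, mul_one, mul_comm]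
        _ ≤ (11 / 100) ^ L := pow_le_pow_left₀ (by positivity) hexp L
    refine (Finset.sum_le_sum hb).trans (le_of_eq ?_)
    simp
  · intro δ hδ
    rw [Finset.mem_filter] at hδ
    have h4 := hp δ hδ.1
    have h5 := hδ.2
    rw [h4, Finset.mem_Ico] at h5
    have h6 : (colSet δ).card ≤ Λ.sup (fun δ => (colSet δ).card) :=
      Finset.le_sup (f := fun δ => (colSet δ).card) hδ.1
    simp only [Finset.mem_sigma, Finset.mem_range]
    omega

lemma sum_biUnion_le_sum {α κ : Type*} [DecidableEq α] (I : Finset κ) (t : κ → Finset α) {f : α → ℝ}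
    (hf : ∀ x, 0 ≤ f x) : ∑ x ∈ I.biUnion t, f x ≤ ∑ i ∈ I, ∑ x ∈ t i, f x := by
  induction I using Finset.induction_on with
  | empty => simp
  | insert i I hi ih =>
    rw [Finset.biUnion_insert, Finset.sum_insert hi]
    have h := Finset.sum_union_inter (s₁ := t i) (s₂ := I.biUnion t) (f := f)
    have h' : 0 ≤ ∑ x ∈ t i ∩ I.biUnion t, f x := Finset.sum_nonneg fun x _ => hf x
    linarith

lemma sum_columns_le (Λ : Finset (Finset Bond)) (hΛ : ∀ δ ∈ Λ, IsExcitation w δ)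
    {ζ : Finset Bond → ℝ} (hζ : ∀ δ ∈ Λ, ζ δ ≤ (1 / 6) ^ δ.card) (Q : Finset Bond → Prop)
    (I : Finset ℤ) (hQ : ∀ δ ∈ Λ, Q δ → ∃ i ∈ I, i ∈ colSet δ) :
    ∑ δ ∈ Λ.filter Q, ζ δ * Real.exp (colSet δ).card ≤ I.card * (1 / 3) := by
  calc ∑ δ ∈ Λ.filter Q, ζ δ * Real.exp (colSet δ).card
      ≤ ∑ δ ∈ Λ.filter Q, (1 / 6) ^ δ.card * Real.exp (colSet δ).card :=
        Finset.sum_le_sum fun δ hδ => mul_le_mul_of_nonneg_right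
          (hζ δ (Finset.mem_filter.1 hδ).1) (Real.exp_pos _).le
    _ ≤ ∑ δ ∈ I.biUnion fun i => Λ.filter (fun δ => i ∈ colSet δ),
          (1 / 6) ^ δ.card * Real.exp (colSet δ).card := by
        refine Finset.sum_le_sum_of_subset_of_nonneg ?_ fun δ _ _ => by positivity
        intro δ hδ
        rw [Finset.mem_filter] at hδ
        obtain ⟨i, hi, hiδ⟩ := hQ δ hδ.1 hδ.2
        exact Finset.mem_biUnion.2 ⟨i, hi, Finset.mem_filter.2 ⟨hδ.1, hiδ⟩⟩
    _ ≤ ∑ i ∈ I, ∑ δ ∈ Λ.filter (fun δ => i ∈ colSet δ),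
          (1 / 6) ^ δ.card * Real.exp (colSet δ).card :=
        sum_biUnion_le_sum _ _ fun δ => by positivity
    _ ≤ ∑ _i ∈ I, (1 / 3 : ℝ) := Finset.sum_le_sum fun i _ => sum_column_le Λ hΛ i
    _ = I.card * (1 / 3) := by rw [Finset.sum_const, nsmul_eq_mul]

lemma IsExcitation.exists_col {δ : Finset Bond} (hδ : IsExcitation w δ) {b : Bond} (hb : b ∈ δ)
    {x : ℤ × ℤ} (hx : x ∈ b.ends) : x.1 - 1 ∈ colSet δ ∨ x.1 ∈ colSet δ := by
  obtain ⟨h, hge, -, hh, -⟩ := isExcitation_iff.1 hδ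
  rw [mem_colSet_iff_lt hge hh, mem_colSet_iff_lt hge hh]
  refine lt_of_mem_ends hge (b := b) ?_ hx
  rw [← hh]
  exact_mod_cast hb

/-- The criterion of Kotecký and Preiss, with the number of columns as the size of an excitation. -/
theorem kotecky_preiss (Λ : Finset (Finset Bond)) (hΛ : ∀ δ ∈ Λ, IsExcitation w δ)
    {ζ : Finset Bond → ℝ} (hζ : ∀ δ ∈ Λ, ζ δ ≤ (1 / 6) ^ δ.card) :
    ∀ γ ∈ Λ, ∑ δ ∈ Λ.filter (Conflict γ), ζ δ * Real.exp (colSet δ).card ≤ (colSet γ).card := by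
  intro γ hγ
  -- An excitation that meets `γ` has a column among those of `γ` and their neighbours.
  set I := (colSet γ).biUnion fun i => ({i - 1, i, i + 1} : Finset ℤ) with hI
  have hcard : I.card ≤ (colSet γ).card * 3 :=
    Finset.card_biUnion_le_card_mul _ _ _ fun i _ => Finset.card_le_three
  have hmain := sum_columns_le Λ hΛ hζ (Conflict γ) I ?_
  · have : (I.card : ℝ) ≤ (colSet γ).card * 3 := by exact_mod_cast hcard
    linarith
  · intro δ hδ hc
    have hmem : ∀ i j, i ∈ colSet γ → j ∈ colSet δ → (j = i - 1 ∨ j = i ∨ j = i + 1) →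
        ∃ i ∈ I, i ∈ colSet δ := by
      intro i j hi hj hij
      refine ⟨j, Finset.mem_biUnion.2 ⟨i, hi, ?_⟩, hj⟩
      simpa using hij
    rcases hc with ⟨b, hb, c, hc, ⟨x, hx1, hx2⟩⟩ | rfl
    · rcases (hΛ γ hγ).exists_col hb hx1 with h1 | h1 <;>
      rcases (hΛ δ hδ).exists_col hc hx2 with h2 | h2 <;>
      exact hmem _ _ h1 h2 (by omega)
    · obtain ⟨i, hi⟩ := Finset.card_pos.1 (hΛ γ hγ).colSet_eq.1
      exact hmem i i hi hi (Or.inr (Or.inl rfl))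

/-- Above the threshold for `β`, the Boltzmann factor of an excitation decays by a factor `6` per
bond, because `6 < exp 1.9`. -/
theorem exp_energy_le {JAB JAW JBW β : ℝ} {M : ℤ} (hM : ∀ i, |w i| ≤ M)
    (hstable : 0 ≤ JAB + JAW - JBW) (hground : JAB > rho w * (JAW - JBW))
    (hβ : β > 1.9 * (1 + rho w) / (JAB - rho w * (JAW - JBW))) {δ : Finset Bond}
    (hδ : IsExcitation w δ) : Real.exp (-β * energy JAB JAW JBW w δ) ≤ (1 / 6) ^ δ.card := by
  obtain ⟨h, hge, hfin, hh, -⟩ := isExcitation_iff.1 hδ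
  have hρ := one_le_rho hM
  have hE := energy_ge (JAB := JAB) (JAW := JAW) (JBW := JBW) hM hge hfin hh hstable
  have hd : 0 < JAB - rho w * (JAW - JBW) := sub_pos.2 hground
  have hβ0 : 0 < β := lt_trans (by positivity) hβ
  have h1 : 1.9 ≤ β * ((JAB - rho w * (JAW - JBW)) / (1 + rho w)) := by
    rw [gt_iff_lt, div_lt_iff₀ hd] at hβ
    rw [mul_div_assoc', le_div_iff₀ (by linarith)]
    exact hβ.le
  have h2 : 1.9 * (δ.card : ℝ) ≤ β * energy JAB JAW JBW w δ := by
    calc 1.9 * (δ.card : ℝ) ≤ β * ((JAB - rho w * (JAW - JBW)) / (1 + rho w)) * δ.card :=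
          mul_le_mul_of_nonneg_right h1 (Nat.cast_nonneg _)
      _ = β * ((JAB - rho w * (JAW - JBW)) / (1 + rho w) * δ.card) := by ring
      _ ≤ _ := mul_le_mul_of_nonneg_left hE hβ0.le
  have h6 : Real.exp (-1.9) ≤ 1 / 6 := by
    have h7 : (6 : ℝ) ^ 10 ≤ Real.exp 1.9 ^ 10 := by
      rw [← Real.exp_nat_mul]
      norm_num
      have := Real.exp_one_gt_d9
      calc (60466176 : ℝ) ≤ 2.7 ^ 19 := by norm_num
        _ ≤ Real.exp 1 ^ 19 := pow_le_pow_left₀ (by norm_num) (by linarith) 19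
        _ = Real.exp 19 := by rw [← Real.exp_nat_mul]; norm_num
    have h8 : (6 : ℝ) ≤ Real.exp 1.9 := le_of_pow_le_pow_left₀ (by norm_num) (Real.exp_pos _).le h7
    rw [Real.exp_neg, ← one_div]
    exact one_div_le_one_div_of_le (by norm_num) h8
  calc Real.exp (-β * energy JAB JAW JBW w δ) ≤ Real.exp (δ.card * (-1.9)) :=
        Real.exp_le_exp.2 (by linarith)
    _ = Real.exp (-1.9) ^ δ.card := Real.exp_nat_mul _ _
    _ ≤ _ := pow_le_pow_left₀ (Real.exp_pos _).le h6 _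

end Entropy

/-! ### Sums over families of excitations -/

section FamilyWeights

/-- The finite families of sets of bonds. -/
abbrev Family : Type := Σ n : ℕ, Fin n → Finset Bond

lemma arithCoeff_eq_ursell {n : ℕ} (δ : Fin n → Finset Bond) : arithCoeff δ = ursell Conflict δ := by
  unfold arithCoeff ursell connSum
  refine Finset.sum_congr ?_ fun _ _ => rfl
  ext S
  have hedge : edgesIn (polyGraph Conflict δ) Finset.univ = (incompatGraph δ).edgeFinset := by
    ext e
    rw [SimpleGraph.mem_edgeFinset, edgesIn, Finset.mem_filter]
    simp [incompatGraph, polyGraph, Conflict]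
  rw [Finset.mem_filter, Finset.mem_filter, hedge]
  refine and_congr_right fun _ => ?_
  rw [SimpleGraph.connected_iff, Connects, Finset.univ_nonempty_iff]
  simp only [Finset.mem_univ, true_imp_iff, SimpleGraph.Preconnected]
  exact and_comm

lemma arithCoeff_eq_zero {n : ℕ} {δ : Fin n → Finset Bond} (h : ¬ (incompatGraph δ).Connected) :
    arithCoeff δ = 0 := by
  unfold arithCoeff
  rw [Finset.filter_false_of_mem, Finset.sum_empty]
  intro S hS hc
  refine h (hc.mono ?_)
  rw [Finset.mem_powerset] at hS
  intro i j hij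
  rw [SimpleGraph.fromEdgeSet_adj] at hij
  have := hS (show s(i, j) ∈ S by exact_mod_cast hij.1)
  rwa [SimpleGraph.mem_edgeFinset] at this

variable (JAB JAW JBW β : ℝ) (w : ℤ → ℤ)

/-- The Boltzmann factor of an excitation. -/
def activity (δ : Finset Bond) : ℝ := Real.exp (-β * energy JAB JAW JBW w δ)

/-- The truncated function of a family of excitations. It is extended by `0` to the other families,
and it vanishes on the families of excitations that are not clusters, as `arithCoeff` does; so the
sums over clusters are sums over the type `Family`. -/
def weight (x : Family) : ℝ :=
  if ∀ i, IsExcitation w (x.2 i) then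
    (arithCoeff x.2 : ℝ) / (x.1.factorial : ℝ) * ∏ i, activity JAB JAW JBW β w (x.2 i)
  else 0

/-- The set of the bonds of the members of a family. -/
def support (x : Family) : Finset Bond := Finset.univ.biUnion x.2

/-- The truncated function of a family, divided by the number of its bonds in the wall. For a
cluster this number is positive, since an excitation contains the bottom of each of its columns. -/
def share (x : Family) : ℝ :=
  weight JAB JAW JBW β w x / (((support x).filter fun b => b ∈ line w).card : ℝ)

/-- All the columns of the members of the family lie strictly between `A` and `B`. The column `A` is
excluded because the heights `h A` and `h B` at the ends of a box are those of the wall. -/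
def InBox (A B : ℤ) (x : Family) : Prop := ∀ i, ∀ j ∈ colSet (x.2 i), A < j ∧ j < B

variable {JAB JAW JBW β w}

/-- A cluster, as a family. -/
def Cluster.toFamily (C : Cluster w) : Family := ⟨C.n, C.δ⟩

lemma toFamily_injective : Function.Injective (Cluster.toFamily (w := w)) := by
  rintro ⟨n, δ, _, _⟩ ⟨n', δ', _, _⟩ h
  simp only [Cluster.toFamily, Sigma.mk.injEq] at h
  obtain ⟨rfl, h⟩ := h
  obtain rfl := eq_of_heq h
  rfl

lemma weight_toFamily (C : Cluster w) :
    weight JAB JAW JBW β w C.toFamily = C.truncated JAB JAW JBW β := by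
  have h : ∀ i, IsExcitation w (C.toFamily.2 i) := C.isExcitation
  unfold weight
  rw [if_pos h]
  rfl

lemma exists_toFamily {x : Family} (hx : weight JAB JAW JBW β w x ≠ 0) :
    ∃ C : Cluster w, C.toFamily = x := by
  unfold weight at hx
  split_ifs at hx with hexc
  · have hc : (incompatGraph x.2).Connected := by
      by_contra hcon
      rw [arithCoeff_eq_zero hcon] at hx
      simp at hx
    exact ⟨⟨x.1, x.2, hexc, hc⟩, rfl⟩
  · exact absurd rfl hx

lemma isExcitation_of_weight {x : Family} (hx : weight JAB JAW JBW β w x ≠ 0) (i : Fin x.1) :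
    IsExcitation w (x.2 i) := by
  obtain ⟨C, rfl⟩ := exists_toFamily hx
  exact C.isExcitation i

lemma nonempty_of_weight {x : Family} (hx : weight JAB JAW JBW β w x ≠ 0) : Nonempty (Fin x.1) := by
  obtain ⟨C, rfl⟩ := exists_toFamily hx
  exact C.connected.nonempty

lemma activity_pos (δ : Finset Bond) : 0 < activity JAB JAW JBW β w δ := Real.exp_pos _

lemma abs_share_le (x : Family) :
    |share JAB JAW JBW β w x| ≤ |weight JAB JAW JBW β w x| := by
  unfold share
  rw [abs_div, Nat.abs_cast]
  rcases Nat.eq_zero_or_pos ((support x).filter fun b => b ∈ line w).card with h | h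
  · rw [h, Nat.cast_zero, div_zero]
    exact abs_nonneg _
  · exact div_le_self (abs_nonneg _) (by exact_mod_cast h)

/-- The series over the clusters that contain `b`, as a series over families. -/
lemma tsum_clusterTerm (b : Bond) :
    ∑' C : ClustersThrough w b, clusterTerm JAB JAW JBW β w b C
      = ∑' x : Family, if b ∈ support x then share JAB JAW JBW β w x else 0 := by
  have hinj : Function.Injective fun C : ClustersThrough w b => C.1.toFamily := fun C D h =>
    Subtype.ext (toFamily_injective h)
  rw [← hinj.tsum_eq]
  · refine tsum_congr fun C => ?_
    have hC : b ∈ support C.1.toFamily := C.2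
    rw [if_pos hC, share, weight_toFamily]
    rfl
  · intro x hx
    rw [Function.mem_support] at hx
    split_ifs at hx with hb
    · have hw : weight JAB JAW JBW β w x ≠ 0 := by
        intro h0
        rw [share, h0, zero_div] at hx
        exact hx rfl
      obtain ⟨C, rfl⟩ := exists_toFamily hw
      exact ⟨⟨C, hb⟩, rfl⟩
    · exact absurd rfl hx

lemma weight_eq_of_forall {n : ℕ} {δ : Fin n → Finset Bond} (h : ∀ i, IsExcitation w (δ i)) :
    weight JAB JAW JBW β w ⟨n, δ⟩
      = (ursell Conflict δ : ℝ) / (n.factorial : ℝ) * ∏ i, activity JAB JAW JBW β w (δ i) := by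
  unfold weight
  rw [if_pos h, arithCoeff_eq_ursell]

end FamilyWeights

section Convergence

variable {JAB JAW JBW β : ℝ} {w : ℤ → ℤ}

/-- The truncated functions of the families with a member in a class `q` are absolutely summable
when all the excitations of the class meet a finite set `I` of columns. -/
lemma summable_weight
    (hact : ∀ δ, IsExcitation w δ → activity JAB JAW JBW β w δ ≤ (1 / 6) ^ δ.card)
    (q : Finset Bond → Prop) (I : Finset ℤ)
    (hq : ∀ δ, IsExcitation w δ → q δ → ∃ i ∈ I, i ∈ colSet δ) :
    Summable fun x : Family => if ∃ i, q (x.2 i) then |weight JAB JAW JBW β w x| else 0 := by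
  set f : Family → ℝ := fun x => if ∃ i, q (x.2 i) then |weight JAB JAW JBW β w x| else 0 with hf
  have hf0 : ∀ x, 0 ≤ f x := fun x => by simp only [hf]; split_ifs <;> positivity
  refine summable_of_sum_le (c := I.card * (1 / 3)) hf0 fun s => ?_
  set Λ : Finset (Finset Bond) :=
    (s.biUnion fun x => Finset.univ.image x.2).filter (IsExcitation w) with hΛ
  have hexc : ∀ δ ∈ Λ, IsExcitation w δ := fun δ hδ => (Finset.mem_filter.1 hδ).2
  set N := s.sup (fun x => x.1) + 1 with hN
  have hz : ∀ γ ∈ Λ, 0 ≤ activity JAB JAW JBW β w γ := fun γ _ => (activity_pos γ).le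
  calc ∑ x ∈ s, f x = ∑ x ∈ s.filter (fun x => f x ≠ 0), f x := (Finset.sum_filter_ne_zero s).symm
    _ ≤ ∑ x ∈ (Finset.range N).sigma fun n => Fintype.piFinset (fun _ : Fin n => Λ), f x := by
        refine Finset.sum_le_sum_of_subset_of_nonneg ?_ fun x _ _ => hf0 x
        intro x hx
        rw [Finset.mem_filter] at hx
        obtain ⟨hxs, hx0⟩ := hx
        have hw : weight JAB JAW JBW β w x ≠ 0 := by
          intro h0
          apply hx0
          simp only [hf, h0, abs_zero, ite_self]
        rw [Finset.mem_sigma, Finset.mem_range, Fintype.mem_piFinset]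
        refine ⟨Nat.lt_succ_of_le (Finset.le_sup (f := fun x : Family => x.1) hxs), fun i => ?_⟩
        exact Finset.mem_filter.2 ⟨Finset.mem_biUnion.2 ⟨x, hxs,
          Finset.mem_image_of_mem _ (Finset.mem_univ i)⟩, isExcitation_of_weight hw i⟩
    _ = ∑ n ∈ Finset.range N, tupleSum (activity JAB JAW JBW β w) Λ n
          (fun δ => if ∃ i, q (δ i) then |(ursell Conflict δ : ℝ)| else 0) / (n.factorial : ℝ) := by
        rw [Finset.sum_sigma]
        refine Finset.sum_congr rfl fun n _ => ?_
        rw [tupleSum, Finset.sum_div]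
        refine Finset.sum_congr rfl fun δ hδ => ?_
        rw [Fintype.mem_piFinset] at hδ
        simp only [hf]
        split_ifs
        · rw [weight_eq_of_forall (fun i => hexc _ (hδ i)), abs_mul, abs_div, Nat.abs_cast,
            abs_of_nonneg (Finset.prod_nonneg fun i _ => (activity_pos (δ i)).le)]
          ring
        · simp
    _ ≤ ∑ γ ∈ Λ.filter q, activity JAB JAW JBW β w γ * Real.exp (colSet γ).card :=
        sum_exists_ursell_le (a := fun δ => ((colSet δ).card : ℝ)) (fun _ _ h => h.symm) hz
          (kotecky_preiss Λ hexc fun δ hδ => hact δ (hexc δ hδ)) q N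
    _ ≤ I.card * (1 / 3) := sum_columns_le Λ hexc (fun δ hδ => hact δ (hexc δ hδ)) q I
        fun δ hδ h => hq δ (hexc δ hδ) h

lemma summable_through
    (hact : ∀ δ, IsExcitation w δ → activity JAB JAW JBW β w δ ≤ (1 / 6) ^ δ.card) (b : Bond) :
    Summable fun x : Family => if b ∈ support x then |weight JAB JAW JBW β w x| else 0 := by
  obtain ⟨p, hp⟩ := b.ends_nonempty
  have h := summable_weight hact (fun δ => b ∈ δ) {p.1 - 1, p.1} (fun δ hδ hb => by
    rcases hδ.exists_col hb hp with h | h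
    · exact ⟨_, by simp, h⟩
    · exact ⟨_, by simp, h⟩)
  refine h.congr fun x => ?_
  congr 1
  simp [support]

lemma summable_inBox
    (hact : ∀ δ, IsExcitation w δ → activity JAB JAW JBW β w δ ≤ (1 / 6) ^ δ.card) (A B : ℤ) :
    Summable fun x : Family => if InBox A B x then |weight JAB JAW JBW β w x| else 0 := by
  have h := summable_weight hact (fun δ => ∃ j ∈ Finset.Ioo A B, j ∈ colSet δ) (Finset.Ioo A B)
    (fun δ _ h => h)
  refine Summable.of_nonneg_of_le (fun x => by split_ifs <;> positivity) (fun x => ?_) h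
  by_cases hw : weight JAB JAW JBW β w x = 0
  · simp [hw]
  split_ifs with h1 h2
  · exact le_rfl
  · exfalso
    obtain ⟨i⟩ := nonempty_of_weight hw
    obtain ⟨j, hj⟩ := Finset.card_pos.1 (isExcitation_of_weight hw i).colSet_eq.1
    exact h2 ⟨i, j, Finset.mem_Ioo.2 (h1 i j hj), hj⟩
  · exact abs_nonneg _
  · exact le_rfl

end Convergence

/-! ### The partition function of a box -/

section Box

variable {JAB JAW JBW β : ℝ} {w : ℤ → ℤ} {N : ℕ}

lemma BoxConfig.finite (h : BoxConfig N w) : {i | h.1 i ≠ w i}.Finite := by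
  refine (Set.finite_Ioo (0 : ℤ) N).subset fun i hi => ?_
  by_contra hcon
  rw [Set.mem_Ioo] at hcon
  exact hi (h.2.2 i (by omega))

/-- The bonds that belong to exactly one of the lines of the configuration and of the wall. -/
def BoxConfig.diff (h : BoxConfig N w) : Finset Bond := (finite_lineDiff h.2.1 h.finite).toFinset

lemma BoxConfig.coe_diff (h : BoxConfig N w) : (h.diff : Set Bond) = lineDiff w h.1 :=
  Set.Finite.coe_toFinset _

/-- The set of bonds is an excitation of the box of length `N`. -/
def BoxExcitation (N : ℕ) (w : ℤ → ℤ) (δ : Finset Bond) : Prop :=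
  IsExcitation w δ ∧ ∀ i ∈ colSet δ, 0 < i ∧ i < (N : ℤ)

lemma BoxConfig.boxExcitation (h : BoxConfig N w) {δ : Finset Bond} (hδ : δ ∈ components h.diff) :
    BoxExcitation N w δ := by
  have hc := mem_components.1 hδ
  rw [h.coe_diff] at hc
  refine ⟨⟨h.1, h.2.1, h.finite, maximal_iff_isComp.2 hc⟩, fun i hi => ?_⟩
  have hlt := (hc.horiz_mem h.2.1 h.finite (mem_colSet.1 hi)).1
  by_contra hcon
  have := h.2.2 i (by omega)
  omega

lemma components_diff_injective :
    Function.Injective fun h : BoxConfig N w => components h.diff := by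
  intro h h' heq
  have h1 : h.diff = h'.diff := by
    rw [← biUnion_components h.diff, ← biUnion_components h'.diff]
    exact congrArg (fun X => X.biUnion id) heq
  refine Subtype.ext (lineDiff_injective h.2.1 h'.2.1 ?_)
  rw [← h.coe_diff, ← h'.coe_diff, h1]

lemma exists_components_eq (X : Finset (Finset Bond)) (hexc : ∀ δ ∈ X, BoxExcitation N w δ)
    (hX : (X : Set (Finset Bond)).Pairwise (fun a b => ¬ Conflict a b)) :
    ∃ h : BoxConfig N w, components h.diff = X := by
  obtain ⟨h, hge, hfin, hh⟩ := exists_config X (fun δ hδ => (hexc δ hδ).1) hX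
  have hbox : ∀ i, i ≤ 0 ∨ (N : ℤ) ≤ i → h i = w i := by
    intro i hi
    by_contra hne
    have hlt : w i < h i := lt_of_le_of_ne (hge i) (Ne.symm hne)
    obtain ⟨y, hy⟩ := (inCols_lineDiff hge).2 hlt
    rw [hh] at hy
    simp only [Finset.coe_biUnion, Set.mem_iUnion] at hy
    obtain ⟨δ, hδ, hyδ⟩ := hy
    have := (hexc δ hδ).2 i (mem_colSet.2 ⟨y, hyδ⟩)
    omega
  refine ⟨⟨h, hge, hbox⟩, ?_⟩
  have hd : BoxConfig.diff (⟨h, hge, hbox⟩ : BoxConfig N w) = X.biUnion id := by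
    have := BoxConfig.coe_diff (⟨h, hge, hbox⟩ : BoxConfig N w)
    rw [hh] at this
    exact_mod_cast this
  rw [hd]
  refine components_biUnion hX fun δ hδ => ?_
  obtain ⟨g, -, -, hg, hc⟩ := isExcitation_iff.1 (hexc δ hδ).1
  rwa [hg]

lemma sum_energy_components (h : BoxConfig N w) :
    ∑ δ ∈ components h.diff, energy JAB JAW JBW w δ = energy JAB JAW JBW w h.diff := by
  have key : ∀ (Q : Bond → Prop) [DecidablePred Q], ((h.diff.filter Q).card : ℝ)
      = ∑ δ ∈ components h.diff, ((δ.filter Q).card : ℝ) := by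
    intro Q _
    conv_lhs => rw [← biUnion_components h.diff, Finset.filter_biUnion]
    rw [Finset.card_biUnion]
    · push_cast
      rfl
    · intro δ hδ δ' hδ' hne
      rw [Function.onFun, Finset.disjoint_left]
      intro b hb hb'
      exact pairwise_components h.diff hδ hδ' hne (Or.inl ⟨b, (Finset.mem_filter.1 hb).1, b,
        (Finset.mem_filter.1 hb').1, Bond.Meets.refl b⟩)
  unfold energy
  rw [Finset.sum_sub_distrib, ← Finset.mul_sum, ← Finset.mul_sum, key, key]

lemma boltzmann_eq (h : BoxConfig N w) :
    boltzmann JAB JAW JBW β N w h = Real.exp (-β * (JAW * (boxLine N w).card))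
      * ∏ δ ∈ components h.diff, activity JAB JAW JBW β w δ := by
  unfold boltzmann activity
  rw [← Real.exp_sum, ← Finset.mul_sum, sum_energy_components, ← Real.exp_add, energy,
    filter_notMem_wall h.2.2 h.coe_diff, filter_mem_wall h.2.2 h.coe_diff, hamiltonian,
    boxLine_eq_lineOn, boxLine_eq_lineOn]
  have h1 : ((lineOn 0 N w).card : ℝ) = (lineOn 0 N w \ lineOn 0 N h.1).card
      + (lineOn 0 N h.1 ∩ lineOn 0 N w).card := by
    rw [Finset.inter_comm]
    exact_mod_cast (Finset.card_sdiff_add_card_inter _ _).symm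
  rw [h1]
  congr 1
  ring

/-- The sum of the truncated functions of the clusters strictly between the columns `A` and `B`. -/
def boxSum (JAB JAW JBW β : ℝ) (w : ℤ → ℤ) (A B : ℤ) : ℝ :=
  ∑' x : Family, if InBox A B x then weight JAB JAW JBW β w x else 0

/-- The cluster expansion for a finite set of excitations of the box. -/
lemma partition_eq_exp_families
    (hact : ∀ δ, IsExcitation w δ → activity JAB JAW JBW β w δ ≤ (1 / 6) ^ δ.card)
    (Λ : Finset (Finset Bond)) (hΛ : ∀ δ ∈ Λ, BoxExcitation N w δ) :
    ∑ X ∈ Λ.powerset.filter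
        (fun X : Finset (Finset Bond) => (X : Set (Finset Bond)).Pairwise (fun a b => ¬ Conflict a b)),
          ∏ γ ∈ X, activity JAB JAW JBW β w γ
      = Real.exp (∑' x : Family, if ∀ i, x.2 i ∈ Λ then weight JAB JAW JBW β w x else 0) := by
  have hexp := partition_eq_exp (R := Conflict) (z := activity JAB JAW JBW β w) (Λ := Λ)
    Conflict.refl (fun _ _ h => h.symm) (fun γ _ => (activity_pos γ).le)
    (a := fun δ => ((colSet δ).card : ℝ))
    (kotecky_preiss Λ (fun δ hδ => (hΛ δ hδ).1) fun δ hδ => hact δ (hΛ δ hδ).1)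
  refine (Finset.sum_congr (by ext X; simp only [Finset.mem_filter]) fun _ _ => rfl).trans
    (hexp.trans ?_)
  congr 1
  have hsum : Summable fun x : Family =>
      if ∀ i, x.2 i ∈ Λ then weight JAB JAW JBW β w x else 0 := by
    refine Summable.of_norm_bounded (summable_inBox hact 0 N) fun x => ?_
    split_ifs with h1 h2
    · exact le_rfl
    · exact absurd (fun i j hj => (hΛ _ (h1 i)).2 j hj) h2
    · simp
    · simp
  rw [hsum.tsum_sigma]
  refine tsum_congr fun n => ?_
  rw [tsum_eq_sum (s := Fintype.piFinset (fun _ : Fin n => Λ)), tupleSum, Finset.sum_div]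
  · refine Finset.sum_congr rfl fun δ hδ => ?_
    rw [Fintype.mem_piFinset] at hδ
    rw [if_pos hδ, weight_eq_of_forall fun i => (hΛ _ (hδ i)).1]
    ring
  · intro δ hδ
    rw [Fintype.mem_piFinset] at hδ
    rw [if_neg hδ]

/-- The partition function of a box is the Boltzmann factor of the wall times the exponential of the
sum over the clusters of the box. A box has infinitely many configurations; the identity is the
limit of `partition_eq_exp_families` along the finite sets of excitations. -/
theorem hasSum_boltzmann
    (hact : ∀ δ, IsExcitation w δ → activity JAB JAW JBW β w δ ≤ (1 / 6) ^ δ.card) (N : ℕ) :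
    HasSum (boltzmann JAB JAW JBW β N w)
      (Real.exp (-β * (JAW * (boxLine N w).card)) * Real.exp (boxSum JAB JAW JBW β w 0 N)) := by
  set φ : BoxConfig N w → ℝ := fun h => ∏ δ ∈ components h.diff, activity JAB JAW JBW β w δ with hφ
  have hφ0 : ∀ h, 0 ≤ φ h := fun h => Finset.prod_nonneg fun δ _ => (activity_pos δ).le
  suffices HasSum φ (Real.exp (boxSum JAB JAW JBW β w 0 N)) by
    have h2 := this.mul_left (Real.exp (-β * (JAW * (boxLine N w).card)))
    refine h2.congr_fun ?_
    intro h
    exact (boltzmann_eq h)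
  set box : Finset (Finset Bond) → Finset (Finset Bond) := fun Λ => Λ.filter (BoxExcitation N w)
    with hbox
  have hboxm : ∀ Λ, ∀ δ ∈ box Λ, BoxExcitation N w δ := fun Λ δ hδ => (Finset.mem_filter.1 hδ).2
  set F : Finset (Finset Bond) → ℝ := fun Λ =>
    ∑' x : Family, if ∀ i, x.2 i ∈ box Λ then weight JAB JAW JBW β w x else 0 with hF
  have hdom : ∀ Λ, ∀ x : Family, ‖if ∀ i, x.2 i ∈ box Λ then weight JAB JAW JBW β w x else 0‖
      ≤ if InBox 0 N x then |weight JAB JAW JBW β w x| else 0 := by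
    intro Λ x
    split_ifs with h1 h2
    · exact le_rfl
    · exact absurd (fun i j hj => (hboxm Λ _ (h1 i)).2 j hj) h2
    · simp
    · simp
  set K := ∑' x : Family, if InBox 0 N x then |weight JAB JAW JBW β w x| else 0 with hK
  have hFK : ∀ Λ, F Λ ≤ K := fun Λ =>
    (le_abs_self _).trans (tsum_of_norm_bounded (summable_inBox hact 0 N).hasSum (hdom Λ))
  have hFlim : Tendsto F atTop (𝓝 (boxSum JAB JAW JBW β w 0 N)) := by
    refine tendsto_tsum_of_dominated_convergence (summable_inBox hact 0 N) (fun x => ?_)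
      (Eventually.of_forall fun Λ x => hdom Λ x)
    refine tendsto_const_nhds.congr' ?_
    filter_upwards [eventually_ge_atTop (Finset.univ.image x.2)] with Λ hΛ
    by_cases hw : weight JAB JAW JBW β w x = 0
    · simp [hw]
    · congr 1
      rw [eq_iff_iff]
      constructor
      · intro hx i
        exact Finset.mem_filter.2 ⟨hΛ (Finset.mem_image_of_mem _ (Finset.mem_univ i)),
          isExcitation_of_weight hw i, hx i⟩
      · intro hx i
        exact (hboxm Λ _ (hx i)).2
  -- the configurations whose excitations belong to `Λ`
  set conf : Finset (Finset Bond) → Finset (BoxConfig N w) := fun Λ =>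
    ((box Λ).powerset.filter (fun X : Finset (Finset Bond) =>
      (X : Set (Finset Bond)).Pairwise (fun a b => ¬ Conflict a b))).preimage
        (fun h : BoxConfig N w => components h.diff) components_diff_injective.injOn with hconf
  have hmem : ∀ Λ h, h ∈ conf Λ ↔ components h.diff ⊆ Λ := by
    intro Λ h
    simp only [hconf, Finset.mem_preimage, Finset.mem_filter, Finset.mem_powerset]
    constructor
    · exact fun hh => hh.1.trans (Finset.filter_subset _ _)
    · exact fun hh => ⟨fun δ hδ => Finset.mem_filter.2 ⟨hh hδ, h.boxExcitation hδ⟩,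
        pairwise_components _⟩
  have hsumconf : ∀ Λ, ∑ h ∈ conf Λ, φ h = Real.exp (F Λ) := by
    intro Λ
    simp only [hF]
    rw [← partition_eq_exp_families hact (box Λ) (hboxm Λ)]
    simp only [hconf, hφ]
    refine Finset.sum_preimage (fun h : BoxConfig N w => components h.diff) _
      components_diff_injective.injOn (fun X => ∏ δ ∈ X, activity JAB JAW JBW β w δ) ?_
    intro X hX hXr
    rw [Finset.mem_filter, Finset.mem_powerset] at hX
    exact absurd (exists_components_eq X (fun δ hδ => hboxm Λ δ (hX.1 hδ)) hX.2) hXr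
  have hsum : Summable φ := by
    refine summable_of_sum_le (c := Real.exp K) hφ0 fun s => ?_
    set Λ := s.biUnion fun h => components h.diff with hΛ
    calc ∑ h ∈ s, φ h ≤ ∑ h ∈ conf Λ, φ h := by
          refine Finset.sum_le_sum_of_subset_of_nonneg ?_ fun h _ _ => hφ0 h
          intro h hs
          rw [hmem]
          exact Finset.subset_biUnion_of_mem (fun h : BoxConfig N w => components h.diff) hs
      _ = Real.exp (F Λ) := hsumconf Λ
      _ ≤ Real.exp K := Real.exp_le_exp.2 (hFK Λ)
  have hconflim : Tendsto conf atTop atTop := by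
    refine tendsto_atTop_finset_of_monotone ?_ ?_
    · intro Λ Λ' hΛ h hh
      rw [hmem] at hh ⊢
      exact hh.trans hΛ
    · intro h
      exact ⟨components h.diff, (hmem _ _).2 subset_rfl⟩
  have h1 : Tendsto (fun Λ => ∑ h ∈ conf Λ, φ h) atTop (𝓝 (∑' h, φ h)) :=
    (show Tendsto (fun s : Finset (BoxConfig N w) => ∑ h ∈ s, φ h) atTop (𝓝 (∑' h, φ h)) from
      hsum.hasSum).comp hconflim
  have h2 : Tendsto (fun Λ => ∑ h ∈ conf Λ, φ h) atTop
      (𝓝 (Real.exp (boxSum JAB JAW JBW β w 0 N))) := by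
    simp only [hsumconf]
    exact (Real.continuous_exp.tendsto _).comp hFlim
  rw [← tendsto_nhds_unique h1 h2]
  exact hsum.hasSum

end Box

/-! ### Translations -/

/-- The translation of the bonds by `k` columns. -/
def Bond.shift (k : ℤ) : Bond ≃ Bond where
  toFun b := match b with
    | .horiz i y => .horiz (i + k) y
    | .vert i y => .vert (i + k) y
  invFun b := match b with
    | .horiz i y => .horiz (i - k) y
    | .vert i y => .vert (i - k) y
  left_inv b := by cases b <;> simp
  right_inv b := by cases b <;> simp

/-- The translation of the finite sets of bonds by `k` columns. -/
def shiftSet (k : ℤ) : Finset Bond ≃ Finset Bond := (Bond.shift k).finsetCongr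

/-- The translation of the families by `k` columns. -/
def shiftFamily (k : ℤ) : Family ≃ Family :=
  Equiv.sigmaCongrRight fun n => (Equiv.refl (Fin n)).arrowCongr (shiftSet k)

section Shift

variable {JAB JAW JBW β : ℝ} {w h : ℤ → ℤ} {k : ℤ} {b c : Bond} {δ δ' : Finset Bond}

@[simp] lemma shift_horiz (i y : ℤ) : Bond.shift k (.horiz i y) = .horiz (i + k) y := rfl

@[simp] lemma shift_vert (i y : ℤ) : Bond.shift k (.vert i y) = .vert (i + k) y := rfl

lemma mem_ends_shift {x : ℤ × ℤ} : x ∈ (Bond.shift k b).ends ↔ (x.1 - k, x.2) ∈ b.ends := by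
  obtain ⟨u, v⟩ := x
  cases b <;> simp only [shift_horiz, shift_vert, Bond.ends, Set.mem_insert_iff,
    Set.mem_singleton_iff, Prod.mk.injEq] <;> omega

lemma meets_shift : (Bond.shift k b).Meets (Bond.shift k c) ↔ b.Meets c := by
  constructor
  · rintro ⟨x, hb, hc⟩
    exact ⟨_, mem_ends_shift.1 hb, mem_ends_shift.1 hc⟩
  · rintro ⟨x, hb, hc⟩
    refine ⟨(x.1 + k, x.2), mem_ends_shift.2 ?_, mem_ends_shift.2 ?_⟩ <;> simpa

lemma shift_mem_line : Bond.shift k b ∈ line (fun i => h (i - k)) ↔ b ∈ line h := by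
  cases b with
  | horiz i y => rw [shift_horiz, horiz_mem_line, horiz_mem_line, add_sub_cancel_right]
  | vert i y =>
    rw [shift_vert, vert_mem_line, vert_mem_line, add_sub_cancel_right,
      show i + k - 1 - k = i - 1 by ring]

lemma shift_mem_shiftSet : Bond.shift k b ∈ shiftSet k δ ↔ b ∈ δ := by
  simp [shiftSet]

lemma shiftSet_eq_map : shiftSet k δ = δ.map (Bond.shift k).toEmbedding := rfl

lemma IsConn.shift {S T : Set Bond} (hS : IsConn S) (hT : ∀ b, Bond.shift k b ∈ T ↔ b ∈ S) :
    IsConn T := by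
  have hT' : ∀ b ∈ T, ∃ c ∈ S, Bond.shift k c = b := fun b hb => by
    obtain ⟨c, rfl⟩ := (Bond.shift k).surjective b
    exact ⟨c, (hT c).1 hb, rfl⟩
  obtain ⟨⟨b, hb⟩, hj⟩ := hS
  refine ⟨⟨_, (hT b).2 hb⟩, fun b hb c hc x hx y hy => ?_⟩
  obtain ⟨b, hbS, rfl⟩ := hT' b hb
  obtain ⟨c, hcS, rfl⟩ := hT' c hc
  have h1 := hj b hbS c hcS _ (mem_ends_shift.1 hx) _ (mem_ends_shift.1 hy)
  have hstep : ∀ u v : ℤ × ℤ, (∃ b ∈ S, u ∈ b.ends ∧ v ∈ b.ends) →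
      ∃ b ∈ T, (u.1 + k, u.2) ∈ b.ends ∧ (v.1 + k, v.2) ∈ b.ends := fun u v ⟨d, hd, hu, hv⟩ =>
    ⟨_, (hT d).2 hd, mem_ends_shift.2 (by simpa), mem_ends_shift.2 (by simpa)⟩
  have h2 := Relation.ReflTransGen.lift (fun x : ℤ × ℤ => (x.1 + k, x.2))
    (p := fun x y => ∃ b ∈ T, x ∈ b.ends ∧ y ∈ b.ends) hstep _ _ h1
  simpa [Joined, Function.onFun] using h2

lemma mem_line_shift (hk : ∀ i, w (i + k) = w i) : Bond.shift k b ∈ line w ↔ b ∈ line w := by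
  have hw : w = fun i => w (i - k) := by
    funext i
    rw [← hk (i - k), sub_add_cancel]
  conv_lhs => rw [hw]
  exact shift_mem_line

lemma IsExcitation.shift (hk : ∀ i, w (i + k) = w i) (hδ : IsExcitation w δ) :
    IsExcitation w (shiftSet k δ) := by
  obtain ⟨h, hge, hfin, hh, hc⟩ := isExcitation_iff.1 hδ
  have hw : ∀ i, w i = w (i - k) := fun i => by rw [← hk (i - k), sub_add_cancel]
  have hmem : ∀ b, Bond.shift k b ∈ lineDiff w (fun i => h (i - k)) ↔ b ∈ lineDiff w h := fun b => by
    simp only [lineDiff, Set.mem_sdiff, Set.mem_union, Set.mem_inter_iff, shift_mem_line,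
      mem_line_shift hk]
  refine isExcitation_iff.2 ⟨fun i => h (i - k), fun i => by rw [hw i]; exact hge _, ?_, ?_,
    hc.shift hmem⟩
  · refine (hfin.preimage (f := fun i : ℤ => i - k) (sub_left_injective).injOn).subset ?_
    intro i hi
    simpa [hw i] using hi
  · ext b
    obtain ⟨c, rfl⟩ := (Bond.shift k).surjective b
    rw [hmem, Finset.mem_coe, shift_mem_shiftSet, ← hh, Finset.mem_coe]

lemma isExcitation_shift (hk : ∀ i, w (i + k) = w i) :
    IsExcitation w (shiftSet k δ) ↔ IsExcitation w δ := by
  refine ⟨fun h => ?_, IsExcitation.shift hk⟩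
  have h' := h.shift (k := -k) fun i => by rw [← hk (i + -k), neg_add_cancel_right]
  have hinv : shiftSet (-k) (shiftSet k δ) = δ := by
    ext b
    obtain ⟨c, rfl⟩ := (Bond.shift (-k)).surjective b
    rw [shift_mem_shiftSet]
    have hc : Bond.shift k (Bond.shift (-k) c) = c := by cases c <;> simp
    conv_lhs => rw [← hc, shift_mem_shiftSet]
  rwa [hinv] at h'

lemma card_filter_shift (Q : Bond → Prop) [DecidablePred Q] (hQ : ∀ b, Q (Bond.shift k b) ↔ Q b) :
    ((shiftSet k δ).filter Q).card = (δ.filter Q).card := by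
  rw [shiftSet_eq_map, Finset.filter_map, Finset.card_map]
  congr 1
  exact Finset.filter_congr fun b _ => hQ b

lemma activity_shift (hk : ∀ i, w (i + k) = w i) :
    activity JAB JAW JBW β w (shiftSet k δ) = activity JAB JAW JBW β w δ := by
  unfold activity energy
  rw [card_filter_shift _ fun b => mem_line_shift hk,
    card_filter_shift _ fun b => (mem_line_shift hk).not]

lemma conflict_shift : Conflict (shiftSet k δ) (shiftSet k δ') ↔ Conflict δ δ' := by
  unfold Conflict
  refine or_congr ?_ (shiftSet k).injective.eq_iff
  simp only [Incompatible, shiftSet_eq_map, Finset.mem_map, exists_exists_and_eq_and,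
    Equiv.coe_toEmbedding, meets_shift]

lemma ursell_shift {n : ℕ} (δ : Fin n → Finset Bond) :
    ursell Conflict (fun i => shiftSet k (δ i)) = ursell Conflict δ := by
  have hgraph : polyGraph Conflict (fun i => shiftSet k (δ i)) = polyGraph Conflict δ := by
    ext i j
    simp [polyGraph, conflict_shift]
  unfold ursell
  rw [hgraph]

lemma weight_shift (hk : ∀ i, w (i + k) = w i) (x : Family) :
    weight JAB JAW JBW β w (shiftFamily k x) = weight JAB JAW JBW β w x := by
  obtain ⟨n, δ⟩ := x
  by_cases hexc : ∀ i, IsExcitation w (δ i)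
  · have hexc' : ∀ i, IsExcitation w (shiftSet k (δ i)) := fun i => (hexc i).shift hk
    rw [weight_eq_of_forall hexc]
    refine (weight_eq_of_forall hexc').trans ?_
    rw [ursell_shift]
    simp only [activity_shift hk]
  · have hexc' : ¬ ∀ i, IsExcitation w ((shiftFamily k ⟨n, δ⟩).2 i) := fun hcon =>
      hexc fun i => (isExcitation_shift hk).1 (hcon i)
    unfold weight
    rw [if_neg hexc, if_neg hexc']

lemma support_shift (x : Family) : support (shiftFamily k x) = shiftSet k (support x) := by
  ext b
  obtain ⟨c, rfl⟩ := (Bond.shift k).surjective b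
  rw [shift_mem_shiftSet]
  unfold support
  simp only [Finset.mem_biUnion, Finset.mem_univ, true_and]
  exact exists_congr fun i => shift_mem_shiftSet

lemma share_shift (hk : ∀ i, w (i + k) = w i) (x : Family) :
    share JAB JAW JBW β w (shiftFamily k x) = share JAB JAW JBW β w x := by
  unfold share
  rw [weight_shift hk, support_shift, card_filter_shift _ fun b => mem_line_shift hk]

lemma mem_colSet_shift {j : ℤ} : j ∈ colSet (shiftSet k δ) ↔ j - k ∈ colSet δ := by
  rw [mem_colSet, mem_colSet]
  unfold InCols
  refine exists_congr fun y => ?_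
  rw [Finset.mem_coe, Finset.mem_coe, ← shift_mem_shiftSet (k := k) (δ := δ), shift_horiz,
    sub_add_cancel]

lemma inBox_shift {A B : ℤ} (x : Family) :
    InBox A B (shiftFamily k x) ↔ InBox (A - k) (B - k) x := by
  constructor
  · intro h i j hj
    have := h i (j + k) (mem_colSet_shift.2 (by simpa using hj))
    omega
  · intro h i j hj
    have := h i (j - k) (mem_colSet_shift.1 hj)
    omega

lemma column_shift (hk : ∀ i, w (i + k) = w i) (i : ℤ) :
    column w (i + k) = (column w i).map (Bond.shift k).toEmbedding := by
  unfold column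
  rw [Finset.map_insert, hk, show i + k + 1 = i + 1 + k by ring, hk]
  congr 1
  ext b
  simp only [Finset.mem_image, Finset.mem_map, Equiv.coe_toEmbedding]
  constructor
  · rintro ⟨y, hy, rfl⟩
    exact ⟨_, ⟨y, hy, rfl⟩, rfl⟩
  · rintro ⟨_, ⟨y, hy, rfl⟩, rfl⟩
    exact ⟨y, hy, rfl⟩

lemma sum_boxLine (N : ℕ) (F : Bond → ℝ) :
    ∑ b ∈ boxLine N w, F b = ∑ i ∈ Finset.range N, ∑ b ∈ column w (i : ℤ), F b := by
  unfold boxLine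
  rw [Finset.sum_biUnion]
  intro i _ j _ hij
  exact pairwise_disjoint_column (by exact_mod_cast hij)

lemma periodic_mul {a : ℕ} (hw : ∀ i, w (i + (a : ℤ)) = w i) (j : ℕ) (i : ℤ) :
    w (i + ((j * a : ℕ) : ℤ)) = w i := by
  induction j with
  | zero => simp
  | succ j ih =>
    rw [← ih, ← hw (i + ((j * a : ℕ) : ℤ))]
    congr 1
    push_cast
    ring

/-- A sum over the bonds of the wall in a box of `p` periods, arranged by periods. -/
lemma sum_boxLine_mul {a : ℕ} (hw : ∀ i, w (i + (a : ℤ)) = w i) (p : ℕ) (F : Bond → ℝ) :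
    ∑ b ∈ boxLine (p * a) w, F b
      = ∑ j ∈ Finset.range p, ∑ b ∈ boxLine a w, F (Bond.shift ((j * a : ℕ) : ℤ) b) := by
  induction p with
  | zero => simp [boxLine]
  | succ p ih =>
    rw [Finset.sum_range_succ, ← ih, sum_boxLine, sum_boxLine, sum_boxLine, Nat.succ_mul,
      Finset.sum_range_add]
    congr 1
    refine Finset.sum_congr rfl fun i _ => ?_
    rw [show ((p * a + i : ℕ) : ℤ) = (i : ℤ) + ((p * a : ℕ) : ℤ) by push_cast; ring,
      column_shift (periodic_mul hw p), Finset.sum_map]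
    rfl

end Shift

/-! ### The thermodynamic limit -/

section Limit

variable {JAB JAW JBW β : ℝ} {w : ℤ → ℤ} {a : ℕ}

/-- The sum of the shares of the families through `b` that lie in a box. -/
def boxShare (JAB JAW JBW β : ℝ) (w : ℤ → ℤ) (A B : ℤ) (b : Bond) : ℝ :=
  ∑' x : Family, if b ∈ support x ∧ InBox A B x then share JAB JAW JBW β w x else 0

/-- The total weight of the families through `b` that leave the box between `-k` and `k`. -/
def tail (JAB JAW JBW β : ℝ) (w : ℤ → ℤ) (b : Bond) (k : ℕ) : ℝ :=
  ∑' x : Family,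
    if b ∈ support x ∧ ¬ InBox (-(k : ℤ)) k x then |weight JAB JAW JBW β w x| else 0

lemma boxShare_shift {k : ℤ} (hk : ∀ i, w (i + k) = w i) (A B : ℤ) (b : Bond) :
    boxShare JAB JAW JBW β w A B (Bond.shift k b)
      = boxShare JAB JAW JBW β w (A - k) (B - k) b := by
  unfold boxShare
  rw [← (shiftFamily k).tsum_eq]
  refine tsum_congr fun x => ?_
  simp only [support_shift, shift_mem_shiftSet, inBox_shift, share_shift hk]

/-- Each family is counted once for each of its bonds in the wall, and all of these lie in the
box. -/
lemma boxSum_eq_sum_boxShare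
    (hact : ∀ δ, IsExcitation w δ → activity JAB JAW JBW β w δ ≤ (1 / 6) ^ δ.card) (N : ℕ) :
    boxSum JAB JAW JBW β w 0 N = ∑ b ∈ boxLine N w, boxShare JAB JAW JBW β w 0 N b := by
  unfold boxSum boxShare
  rw [← Summable.tsum_finsetSum]
  · refine tsum_congr fun x => ?_
    by_cases hin : InBox 0 N x
    swap
    · simp [hin]
    by_cases hw : weight JAB JAW JBW β w x = 0
    · simp [share, hw]
    simp only [hin, and_true, if_true]
    rw [← Finset.sum_filter, Finset.sum_const, nsmul_eq_mul]
    have hset : (boxLine N w).filter (fun b => b ∈ support x)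
        = (support x).filter fun b => b ∈ line w := by
      ext b
      rw [Finset.mem_filter, Finset.mem_filter, boxLine_eq_lineOn, mem_lineOn]
      refine ⟨fun h => ⟨h.2, h.1.1⟩, fun h => ⟨⟨h.2, ?_⟩, h.1⟩⟩
      obtain ⟨i, -, hi⟩ := Finset.mem_biUnion.1 h.1
      obtain ⟨g, hge, -, hg, -⟩ := isExcitation_iff.1 (isExcitation_of_weight hw i)
      refine col_of_mem_diff (h := g) (w := w) (fun j hj => ?_) (by rw [← hg]; exact hi)
      by_contra hne
      have := hin i j ((mem_colSet_iff_lt hge hg).2 (lt_of_le_of_ne (hge j) (Ne.symm hne)))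
      omega
    have hpos : (support x).filter (fun b => b ∈ line w) ≠ ∅ := by
      obtain ⟨i⟩ := nonempty_of_weight hw
      obtain ⟨g, hge, -, hg, -⟩ := isExcitation_iff.1 (isExcitation_of_weight hw i)
      obtain ⟨j, hj⟩ := Finset.card_pos.1 (isExcitation_of_weight hw i).colSet_eq.1
      rw [← Finset.nonempty_iff_ne_empty]
      refine ⟨Bond.horiz j (w j), Finset.mem_filter.2 ⟨Finset.mem_biUnion.2 ⟨i, Finset.mem_univ i, ?_⟩,
        horiz_mem_line.2 rfl⟩⟩
      rw [← Finset.mem_coe, hg, horiz_mem_lineDiff hge]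
      exact ⟨(mem_colSet_iff_lt hge hg).1 hj, Or.inl rfl⟩
    rw [hset, share, mul_div_cancel₀]
    exact_mod_cast Finset.card_ne_zero.2 (Finset.nonempty_iff_ne_empty.2 hpos)
  · intro b _
    refine Summable.of_norm_bounded (summable_through hact b) fun x => ?_
    split_ifs with h1 h2
    · exact abs_share_le x
    · exact absurd h1.1 h2
    · simp
    · simp

lemma summable_tail
    (hact : ∀ δ, IsExcitation w δ → activity JAB JAW JBW β w δ ≤ (1 / 6) ^ δ.card)
    (b : Bond) (k : ℕ) :
    Summable fun x : Family =>
      if b ∈ support x ∧ ¬ InBox (-(k : ℤ)) k x then |weight JAB JAW JBW β w x| else 0 := by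
  refine Summable.of_nonneg_of_le (fun x => by split_ifs <;> positivity) (fun x => ?_)
    (summable_through hact b)
  split_ifs with h1 h2
  · exact le_rfl
  · exact absurd h1.1 h2
  · exact abs_nonneg _
  · exact le_rfl

lemma tendsto_tail
    (hact : ∀ δ, IsExcitation w δ → activity JAB JAW JBW β w δ ≤ (1 / 6) ^ δ.card) (b : Bond) :
    Tendsto (tail JAB JAW JBW β w b) atTop (𝓝 0) := by
  have h := tendsto_tsum_of_dominated_convergence (𝓕 := atTop) (g := fun _ : Family => (0 : ℝ))
    (f := fun (k : ℕ) (x : Family) =>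
      if b ∈ support x ∧ ¬ InBox (-(k : ℤ)) k x then |weight JAB JAW JBW β w x| else 0)
    (summable_through hact b) (fun x => ?_) (Eventually.of_forall fun k x => ?_)
  · rwa [tsum_zero] at h
  · refine tendsto_const_nhds.congr' ?_
    set S : Finset ℤ := Finset.univ.biUnion fun i => colSet (x.2 i)
    filter_upwards [eventually_gt_atTop (S.sup Int.natAbs)] with k hk
    rw [if_neg]
    rintro ⟨-, hout⟩
    refine hout fun i j hj => ?_
    have : j.natAbs ≤ S.sup Int.natAbs :=
      Finset.le_sup (f := Int.natAbs) (Finset.mem_biUnion.2 ⟨i, Finset.mem_univ i, hj⟩)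
    omega
  · split_ifs with h1 h2
    · simp
    · exact absurd h1.1 h2
    · simp
    · simp

/-- The effect of the box on the series through a bond is controlled by the distances to the two
ends of the box. -/
lemma abs_boxShare_sub_le
    (hact : ∀ δ, IsExcitation w δ → activity JAB JAW JBW β w δ ≤ (1 / 6) ^ δ.card)
    (b : Bond) {A B : ℤ} {k l : ℕ} (hA : A ≤ -k) (hB : (l : ℤ) ≤ B) :
    |boxShare JAB JAW JBW β w A B b
        - ∑' C : ClustersThrough w b, clusterTerm JAB JAW JBW β w b C|
      ≤ tail JAB JAW JBW β w b k + tail JAB JAW JBW β w b l := by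
  have hs : ∀ Q : Family → Prop, Summable fun x : Family =>
      if b ∈ support x ∧ Q x then share JAB JAW JBW β w x else 0 := fun Q => by
    refine Summable.of_norm_bounded (summable_through hact b) fun x => ?_
    split_ifs with h1 h2
    · exact abs_share_le x
    · exact absurd h1.1 h2
    · simp
    · simp
  have hs' : Summable fun x : Family => if b ∈ support x then share JAB JAW JBW β w x else 0 := by
    simpa using hs fun _ => True
  rw [tsum_clusterTerm, boxShare, tail, tail, ← (hs _).tsum_sub hs',
    ← (summable_tail hact b k).tsum_add (summable_tail hact b l), ← Real.norm_eq_abs]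
  refine tsum_of_norm_bounded ((summable_tail hact b k).add (summable_tail hact b l)).hasSum
    fun x => ?_
  have hw0 := abs_nonneg (weight JAB JAW JBW β w x)
  have hshare := abs_share_le (JAB := JAB) (JAW := JAW) (JBW := JBW) (β := β) (w := w) x
  by_cases hb : b ∈ support x
  swap
  · simp [hb]
  by_cases hin : InBox A B x
  · simp only [hb, hin, true_and, and_true, if_true, sub_self, norm_zero]
    positivity
  · simp only [hb, hin, true_and, and_false, if_true, if_false, zero_sub, norm_neg,
      Real.norm_eq_abs]
    by_cases hk : InBox (-(k : ℤ)) k x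
    · have hl : ¬ InBox (-(l : ℤ)) l x := by
        intro hl
        refine hin fun i j hj => ?_
        have h1 := hk i j hj
        have h2 := hl i j hj
        omega
      simpa [hk, hl] using hshare
    · rw [if_pos hk]
      refine hshare.trans (le_add_of_nonneg_right ?_)
      split_ifs
      · exact le_rfl
      · exact hw0

lemma abs_boxSum_sub_le
    (hact : ∀ δ, IsExcitation w δ → activity JAB JAW JBW β w δ ≤ (1 / 6) ^ δ.card)
    (ha : 0 < a) (hw : ∀ i, w (i + (a : ℤ)) = w i) (p : ℕ) :
    |boxSum JAB JAW JBW β w 0 ((p * a : ℕ) : ℤ) - p * clusterSeries JAB JAW JBW β a w|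
      ≤ ∑ j ∈ Finset.range p, ((∑ b ∈ boxLine a w, tail JAB JAW JBW β w b j)
          + ∑ b ∈ boxLine a w, tail JAB JAW JBW β w b (j + 1)) := by
  have hreflect : ∑ j ∈ Finset.range p, ∑ b ∈ boxLine a w, tail JAB JAW JBW β w b (j + 1)
      = ∑ j ∈ Finset.range p, ∑ b ∈ boxLine a w, tail JAB JAW JBW β w b (p - j) := by
    rw [← Finset.sum_range_reflect]
    refine Finset.sum_congr rfl fun j hj => ?_
    rw [Finset.mem_range] at hj
    rw [show p - 1 - j + 1 = p - j by omega]
  have hconst : (p : ℝ) * clusterSeries JAB JAW JBW β a w = ∑ _j ∈ Finset.range p,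
      ∑ b ∈ boxLine a w, ∑' C : ClustersThrough w b, clusterTerm JAB JAW JBW β w b C := by
    rw [Finset.sum_const, Finset.card_range, nsmul_eq_mul]
    rfl
  -- The translation by `j` periods moves the period `j` of the box to the first one.
  rw [Finset.sum_add_distrib, hreflect, ← Finset.sum_add_distrib, boxSum_eq_sum_boxShare hact,
    sum_boxLine_mul hw, hconst, ← Finset.sum_sub_distrib]
  refine (Finset.abs_sum_le_sum_abs _ _).trans (Finset.sum_le_sum fun j hj => ?_)
  rw [Finset.mem_range] at hj
  rw [← Finset.sum_sub_distrib, ← Finset.sum_add_distrib]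
  refine (Finset.abs_sum_le_sum_abs _ _).trans (Finset.sum_le_sum fun b _ => ?_)
  rw [boxShare_shift (periodic_mul hw j)]
  refine abs_boxShare_sub_le hact b ?_ ?_
  · have : j ≤ j * a := Nat.le_mul_of_pos_right j ha
    omega
  · have h1 : p - j ≤ (p - j) * a := Nat.le_mul_of_pos_right _ ha
    rw [Nat.sub_mul] at h1
    have h2 : j * a ≤ p * a := Nat.mul_le_mul_right a hj.le
    omega

/-- The sum over the clusters of a box, per period, converges to the series of one period. -/
lemma tendsto_boxSum_div
    (hact : ∀ δ, IsExcitation w δ → activity JAB JAW JBW β w δ ≤ (1 / 6) ^ δ.card)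
    (ha : 0 < a) (hw : ∀ i, w (i + (a : ℤ)) = w i) :
    Tendsto (fun p : ℕ => boxSum JAB JAW JBW β w 0 ((p * a : ℕ) : ℤ) / p) atTop
      (𝓝 (clusterSeries JAB JAW JBW β a w)) := by
  have htail : Tendsto (fun j : ℕ => ∑ b ∈ boxLine a w, tail JAB JAW JBW β w b j) atTop (𝓝 0) := by
    have := tendsto_finsetSum (boxLine a w) fun b _ => tendsto_tail hact b
    simpa using this
  -- The error is a Cesàro mean of tails: the period `j` is at distance at least `j` from one end of
  -- the box and at least `p - j` from the other.
  have hsum := (htail.add (htail.comp (tendsto_add_atTop_nat 1))).cesaro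
  rw [add_zero] at hsum
  rw [tendsto_iff_norm_sub_tendsto_zero]
  refine squeeze_zero' (Eventually.of_forall fun p => norm_nonneg _) ?_ hsum
  filter_upwards [eventually_gt_atTop 0] with p hp
  have hp' : (0 : ℝ) < p := by exact_mod_cast hp
  have h := abs_boxSum_sub_le hact ha hw p
  rw [Real.norm_eq_abs, div_sub' hp'.ne', abs_div, abs_of_pos hp', div_eq_inv_mul]
  exact mul_le_mul_of_nonneg_left h (inv_nonneg.2 hp'.le)

lemma card_boxLine_mul (hw : ∀ i, w (i + (a : ℤ)) = w i) (p : ℕ) :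
    ((boxLine (p * a) w).card : ℝ) = p * (boxLine a w).card := by
  have h := sum_boxLine_mul hw p fun _ => 1
  simpa using h

lemma roughness_eq (ha : 0 < a) : roughness a w = (boxLine a w).card / (a : ℝ) := by
  have ha' : (a : ℝ) ≠ 0 := by exact_mod_cast ha.ne'
  have hcard := card_lineOn (h := w) (A := 0) (B := a) (by omega)
  have hvar : ((variation 0 a w : ℤ) : ℝ)
      = ∑ i ∈ Finset.Icc 1 a, |(w (i : ℤ) : ℝ) - (w ((i : ℤ) - 1) : ℝ)| := by
    unfold variation
    push_cast
    refine (Finset.sum_nbij (fun i : ℕ => (i : ℤ)) ?_ ?_ ?_ fun _ _ => rfl).symm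
    · intro i hi
      rw [Finset.mem_Icc] at hi
      rw [Finset.mem_Ioc]
      omega
    · exact Nat.cast_injective.injOn
    · intro i hi
      rw [Finset.mem_coe, Finset.mem_Ioc] at hi
      refine ⟨i.toNat, ?_, ?_⟩
      · rw [Finset.mem_coe, Finset.mem_Icc]
        omega
      · exact Int.toNat_of_nonneg (by omega)
  have hcard' : ((lineOn 0 a w).card : ℝ) = a + (variation 0 a w : ℤ) := by
    have : (((lineOn 0 a w).card : ℤ) : ℝ) = ((a - 0 + variation 0 a w : ℤ) : ℝ) := by rw [hcard]
    push_cast at this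
    linarith
  rw [boxLine_eq_lineOn, hcard', roughness, hvar, add_div, div_self ha']

/-- The free energy per unit length: the wall itself contributes `r J_AW`, the clusters contribute
the series of one period. -/
theorem isTauAW_of_activity_le
    (hact : ∀ δ, IsExcitation w δ → activity JAB JAW JBW β w δ ≤ (1 / 6) ^ δ.card)
    (hβ : 0 < β) (ha : 0 < a) (hw : ∀ i, w (i + (a : ℤ)) = w i) :
    IsTauAW JAB JAW JBW β a w
      (roughness a w * JAW - 1 / (β * (a : ℝ)) * clusterSeries JAB JAW JBW β a w) := by
  refine ⟨fun p => (hasSum_boltzmann hact (p * a)).summable, ?_⟩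
  have ha' : (a : ℝ) ≠ 0 := by exact_mod_cast ha.ne'
  refine (((tendsto_boxSum_div hact ha hw).const_mul (1 / (β * (a : ℝ)))).const_sub
    (roughness a w * JAW)).congr' ?_
  filter_upwards [eventually_gt_atTop 0] with p hp
  have hp' : (p : ℝ) ≠ 0 := by exact_mod_cast hp.ne'
  rw [(hasSum_boltzmann hact (p * a)).tsum_eq, ← Real.exp_add, Real.log_exp,
    card_boxLine_mul hw, roughness_eq ha]
  push_cast
  field_simp
  ring

lemma summable_clusterTerm
    (hact : ∀ δ, IsExcitation w δ → activity JAB JAW JBW β w δ ≤ (1 / 6) ^ δ.card) (b : Bond) :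
    Summable fun C : ClustersThrough w b => |clusterTerm JAB JAW JBW β w b C| := by
  have hinj : Function.Injective fun C : ClustersThrough w b => C.1.toFamily := fun C D h =>
    Subtype.ext (toFamily_injective h)
  refine Summable.of_nonneg_of_le (fun C => abs_nonneg _) (fun C => ?_)
    ((summable_through hact b).comp_injective hinj)
  have hC : b ∈ support C.1.toFamily := C.2
  have hle := abs_share_le (JAB := JAB) (JAW := JAW) (JBW := JBW) (β := β) (w := w) C.1.toFamily
  have hterm : clusterTerm JAB JAW JBW β w b C = share JAB JAW JBW β w C.1.toFamily := by
    rw [share, weight_toFamily]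
    rfl
  rw [hterm, Function.comp_apply, if_pos hC]
  exact hle

end Limit

end RoughWall

end


theorem theorem4p1 (a : ℕ) (ha : 0 < a) (w : ℤ → ℤ) (hw : ∀ i : ℤ, w (i + (a : ℤ)) = w i)
    (JAB JAW JBW β : ℝ)
    (hstable : 0 ≤ JAB + JAW - JBW)
    (hground : JAB > RoughWall.rho w * (JAW - JBW))
    (hβ : β > 1.9 * (1 + RoughWall.rho w) / (JAB - RoughWall.rho w * (JAW - JBW))) :
    (∀ b ∈ RoughWall.boxLine a w,
      Summable fun C : RoughWall.ClustersThrough w b =>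
        |RoughWall.clusterTerm JAB JAW JBW β w b C|) ∧
    ∃ τ : ℝ, RoughWall.IsTauAW JAB JAW JBW β a w τ ∧
      τ = RoughWall.roughness a w * JAW
          - 1 / (β * (a : ℝ)) * RoughWall.clusterSeries JAB JAW JBW β a w ∧
      τ - RoughWall.tauBW JBW a w = RoughWall.roughness a w * (JAW - JBW)
          - 1 / (β * (a : ℝ)) * RoughWall.clusterSeries JAB JAW JBW β a w := by
  obtain ⟨M, hM⟩ := RoughWall.exists_abs_le_of_periodic ha hw
  have hact : ∀ δ, RoughWall.IsExcitation w δ →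
      RoughWall.activity JAB JAW JBW β w δ ≤ (1 / 6) ^ δ.card := fun δ hδ =>
    RoughWall.exp_energy_le hM hstable hground hβ hδ
  have hρ : 1 ≤ RoughWall.rho w := RoughWall.one_le_rho hM
  have hd : 0 < JAB - RoughWall.rho w * (JAW - JBW) := sub_pos.2 hground
  have hβ0 : 0 < β := lt_trans (by positivity) hβ
  refine ⟨fun b _ => RoughWall.summable_clusterTerm hact b, _,
    RoughWall.isTauAW_of_activity_le hact hβ0 ha hw, rfl, ?_⟩
  unfold RoughWall.tauBW
  ring
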